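/- A valued difference field is a field $K$ with a valuation $v$ from $K^\times$ onto an ordered abelian group, with valuation ring $\mathcal{O}$ and residue field $\mathbf{k}$, together with a field automorphism $\sigma$ of $K$ such that $\sigma(\mathcal{O})=\mathcal{O}$; $\bar\sigma$ denotes the automorphism of $\mathbf{k}$ induced by $\sigma$. An extension of $K$ is a valued difference field $L$ that extends $K$ as a valued field and whose automorphism extends that of $K$; it is immediate if $L$ has the same value group and residue field as $K$, and $\sigma$-algebraic if every $b\in L$ satisfies $F(b,\sigma(b),\dots,\sigma^n(b))=0$ for some $n$ and some nonzero polynomial $F\in K[x_0,\dots,x_n]$. A valued difference field is maximal if it has no proper immediate extension, and $\sigma$-algebraically maximal if it has no proper immediate $\sigma$-algebraic extension. Theorem. Let $K$ be a valued difference field whose residue field $\mathbf{k}$ has characteristic $0$. Assume that for all $n\ge 0$ and all $\alpha_0,\dots,\alpha_n\in\mathbf{k}$, not all zero, the equation $$1+\alpha_0x+\alpha_1\bar\sigma(x)+\cdots+\alpha_n\bar\sigma^n(x)=0$$ has a solution in $\mathbf{k}$. Then any two maximal valued difference fields that are immediate extensions of $K$ are isomorphic over $K$ (as valued difference fields), and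 any two $\sigma$-algebraically maximal valued difference fields that are immediate $\sigma$-algebraic extensions of $K$ are isomorphic over $K$ (as valued difference fields). -/

import Mathlib

universe u v w

/-- A valued difference field structure on a field `K`: a valuation ring `O` of `K` (which carries
the valuation, the value group and the residue field) and a field automorphism `σ` of `K` with
`σ(O) = O`. -/
class ValuedDifferenceField (K : Type u) [Field K] where
  /-- the valuation ring -/
  O : ValuationSubring K
  /-- the difference operator -/
  σ : K ≃+* K
  /-- the difference operator maps the valuation ring onto itself -/
  image_O : σ '' (O : Set K) = (O : Set K)

namespace ValuedDifferenceField

section Basic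

variable (K : Type u) [Field K] [ValuedDifferenceField K]

theorem σ_mem_iff {K : Type u} [Field K] [ValuedDifferenceField K] (x : K) :
    σ x ∈ O (K := K) ↔ x ∈ O (K := K) := by
  have h := image_O (K := K)
  constructor
  · intro hx
    have hx' : σ x ∈ σ '' (O (K := K) : Set K) := by rw [h]; exact hx
    obtain ⟨y, hy, hyx⟩ := hx'
    have hyx' : y = x := σ.injective hyx
    rw [← hyx']
    exact hy
  · intro hx
    have hx' : σ x ∈ σ '' (O (K := K) : Set K) := ⟨x, hx, rfl⟩
    rw [h] at hx'
    exact hx'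

/-- The valuation of a valued difference field, with values in the (multiplicatively written) value
group of its valuation ring, with a zero adjoined. It is onto. -/
noncomputable abbrev val : Valuation K (O (K := K)).ValueGroup := (O (K := K)).valuation

/-- The residue field. -/
abbrev Residue : Type u := IsLocalRing.ResidueField (O (K := K))

/-- The automorphism of the valuation ring that the difference operator restricts to. -/
def σInt : O (K := K) ≃+* O (K := K) where
  toFun x := ⟨σ x.1, (σ_mem_iff x.1).2 x.2⟩
  invFun x := ⟨σ.symm x.1, (σ_mem_iff _).1 (by rw [RingEquiv.apply_symm_apply]; exact x.2)⟩
  left_inv x := Subtype.ext (σ.symm_apply_apply x.1)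
  right_inv x := Subtype.ext (σ.apply_symm_apply x.1)
  map_mul' x y := Subtype.ext (map_mul σ x.1 y.1)
  map_add' x y := Subtype.ext (map_add σ x.1 y.1)

/-- The automorphism of the residue field induced by the difference operator. -/
noncomputable def σBar : Residue K ≃+* Residue K := IsLocalRing.ResidueField.mapEquiv (σInt K)

/-- The residue difference field is linear difference closed: if `α₀, …, αₙ` in the residue field
are not all zero, then `1 + α₀ x + α₁ σBar(x) + ⋯ + αₙ σBarⁿ(x) = 0` has a solution there. -/
def ResidueLinearDifferenceClosed : Prop :=
  ∀ (n : ℕ) (α : Fin (n + 1) → Residue K), (∃ i, α i ≠ 0) →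
    ∃ x : Residue K, 1 + ∑ i : Fin (n + 1), α i * (σBar K)^[(i : ℕ)] x = 0

end Basic

/-- `L` is an extension of the valued difference field `K`: the field embedding `K → L` is an
embedding of valued fields and commutes with the difference operators. -/
class Extension (K : Type u) (L : Type v) [Field K] [ValuedDifferenceField K]
    [Field L] [ValuedDifferenceField L] [Algebra K L] : Prop where
  mem_O_iff : ∀ a : K, algebraMap K L a ∈ O (K := L) ↔ a ∈ O (K := K)
  map_σ : ∀ a : K, algebraMap K L (σ a) = σ (algebraMap K L a)

section Ext

variable (K : Type u) (L : Type v) [Field K] [ValuedDifferenceField K]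
  [Field L] [ValuedDifferenceField L] [Algebra K L]

/-- The inclusion of valuation rings in an extension. -/
def intMap [Extension K L] (a : O (K := K)) : O (K := L) :=
  ⟨algebraMap K L a.1, (Extension.mem_O_iff a.1).2 a.2⟩

/-- An extension is immediate if it has the same value group and the same residue field: every value
`v(b)`, `b ∈ L`, is the value of an element of `K`, and every residue of an integral element of `L`
is the residue of an integral element of `K`. -/
structure IsImmediate [Extension K L] : Prop where
  value : ∀ b : L, ∃ a : K, val L (algebraMap K L a) = val L b
  residue : ∀ b : O (K := L), ∃ a : O (K := K),
    IsLocalRing.residue (O (K := L)) (intMap K L a) = IsLocalRing.residue (O (K := L)) b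

/-- The value at `b ∈ L` of a difference polynomial over `K`. The polynomial ring is
`K[x₀, x₁, x₂, …]` with `xₙ` standing for `σⁿ(x)`. -/
noncomputable def sigmaEval (F : MvPolynomial ℕ K) (b : L) : L :=
  MvPolynomial.aeval (fun n : ℕ => (σ (K := L))^[n] b) F

/-- Every element of `L` is a zero of a nonzero difference polynomial over `K`. -/
def IsSigmaAlgebraic : Prop :=
  ∀ b : L, ∃ F : MvPolynomial ℕ K, F ≠ 0 ∧ sigmaEval K L F b = 0

end Ext

/-- A valued difference field is maximal if it has no proper immediate extension. -/
def IsMaximal (K : Type u) [Field K] [ValuedDifferenceField K] : Prop :=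
  ∀ (L : Type u) [Field L] [ValuedDifferenceField L] [Algebra K L] [Extension K L],
    IsImmediate K L → Function.Surjective (algebraMap K L)

/-- A valued difference field is σ-algebraically maximal if it has no proper immediate σ-algebraic
extension. -/
def IsSigmaAlgebraicallyMaximal (K : Type u) [Field K] [ValuedDifferenceField K] : Prop :=
  ∀ (L : Type u) [Field L] [ValuedDifferenceField L] [Algebra K L] [Extension K L],
    IsImmediate K L → IsSigmaAlgebraic K L → Function.Surjective (algebraMap K L)

/-- `L₁` and `L₂` are isomorphic over `K` as valued difference fields. -/
def IsIsomorphicOver (K : Type u) (L₁ : Type v) (L₂ : Type w) [Field K]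
    [Field L₁] [ValuedDifferenceField L₁] [Algebra K L₁]
    [Field L₂] [ValuedDifferenceField L₂] [Algebra K L₂] : Prop :=
  ∃ e : L₁ ≃ₐ[K] L₂, (∀ x : L₁, e x ∈ O (K := L₂) ↔ x ∈ O (K := L₁)) ∧
    ∀ x : L₁, e (σ x) = σ (e x)

end ValuedDifferenceField

/-!
Maximal immediate extensions are compared through the cuts that their elements realize over smaller
fields. Let `v` be the valuation and let `b` be an element without a best approximation in a
subfield `E`; its cut is the function `a ↦ v (b - a)` on `E`. A polynomial `G` over `E` in the
variables `x, σ x, σ² x, …` is *stable* at `b` if the constant term of its Taylor expansion at `b`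
dominates the other terms on the scale of some `b - a`. For a class of polynomials closed under
derivation whose nonzero members are stable at `b`, the values at `b` are determined by the cut
(`aeval_eq_of_sameCut`); here residue characteristic zero is used, as a coefficient of the Taylor
expansion of `G` has the same value as a coefficient of the expansion of a derivative of `G`. If
`G` is not stable but its derivatives are, then near `b` the linear part of the Taylor expansion
dominates the higher terms, and a Newton approximation finds a zero of `G` in the cut
(`exists_zero_of_not_isStableAt`). This approximation needs spherical completeness, to pass to
limits, and the solvability of inhomogeneous linear difference equations in the residue field, for
the single step; without `σ` the latter is automatic.

For pure valued fields this gives Kaplansky's uniqueness theorem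
(`exists_algEquiv_of_sphericallyComplete`): a partial isomorphism is extended by an element whose
minimal unstable polynomial vanishes there, or by any realization of the cut if all polynomials are
stable. For valued difference fields (`exists_difference_algEquiv`) the case in which all difference
polynomials are stable at `b` is the same. Otherwise let `n` be the least order of an unstable
difference polynomial `G`, taken of least degree, and choose zeros `b'` and `c'` of `G` in the cut
in the two fields. The elements `b', …, σⁿ⁻¹ b'` are algebraically independent, and Kaplansky's
theorem gives an isomorphism `e` of valued fields carrying them to the transforms of `c'`. Linear
dominance leaves room for only one value of `σⁿ c'`, so `e` carries `σⁿ b'` to `σⁿ c'`; the maps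
`e` and `σ⁻¹ e σ` then agree on `E(b', …, σⁿ⁻¹ b')`, hence on its relative algebraic closure
(`eq_of_isAlgebraic`), which is closed under `σ` and `σ⁻¹`.

It remains to see that maximal valued difference fields are spherically complete. A valued field of
residue characteristic zero has a spherically complete immediate extension in the same universe
(`exists_sphericallyComplete_extension`): a maximal immediate extension inside an algebraically
closed field too large to be exhausted by immediate extensions, whose cardinality is bounded by
Krull's argument. The operator `σ` extends to it by Kaplansky's theorem, applied to the inclusion
and to its composition with `σ`. For the `σ`-algebraic statement, `L₁` and `L₂` are embedded in
spherically complete immediate extensions, which are isomorphic over `K`; in these, `L₁` and `L₂`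
are the subfields of elements that are `σ`-algebraic over `K`
(`mem_range_iff_isDifferenceAlgebraic`), so the isomorphism carries one to the other.
-/

namespace Kaplansky

open MvPolynomial

/-! ### Cuts, limits and spherical completeness -/

section Basic

variable {Γ : Type*} [LinearOrderedCommGroupWithZero Γ]

/-- `L` is an immediate extension of `E`, for a valuation `v` on `L`: every nonzero element of `L`
is approximated by an element of `E` to within less than its own value. This single condition says
that `E` and `L` have the same value group and the same residue field. -/
def IsImmediateOver (E : Type*) {L : Type*} [Field E] [Field L] [Algebra E L]
    (v : Valuation L Γ) : Prop :=
  ∀ b : L, b ≠ 0 → ∃ a : E, v (b - algebraMap E L a) < v b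

/-- `b` is a limit over `E`: no element of `E` is a best approximation of `b`. -/
def IsLimitOver (E : Type*) {L : Type*} [Field E] [Field L] [Algebra E L]
    (v : Valuation L Γ) (b : L) : Prop :=
  ∀ a : E, ∃ a' : E, v (b - algebraMap E L a') < v (b - algebraMap E L a)

/-- `b ∈ L₁` and `c ∈ L₂` realize the same cut over `E`: they have the same distance to every
element of `E`. -/
def SameCut (E : Type*) {L₁ L₂ : Type*} [Field E] [Field L₁] [Field L₂] [Algebra E L₁]
    [Algebra E L₂] (v₁ : Valuation L₁ Γ) (v₂ : Valuation L₂ Γ) (b : L₁) (c : L₂) : Prop :=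
  ∀ a : E, v₁ (b - algebraMap E L₁ a) = v₂ (c - algebraMap E L₂ a)

/-- Spherical completeness: every family of closed balls that meet pairwise has a common point. The
pair `(c, t)` stands for the ball with centre `c` and radius `v t`. -/
def SphericallyComplete {L : Type*} [Field L] (v : Valuation L Γ) : Prop :=
  ∀ S : Set (L × L), (∀ p ∈ S, ∀ q ∈ S, v (p.1 - q.1) ≤ max (v p.2) (v q.2)) →
    ∃ x, ∀ p ∈ S, v (x - p.1) ≤ v p.2

variable {E L L₁ L₂ : Type*} [Field E] [Field L] [Field L₁] [Field L₂] [Algebra E L]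
  [Algebra E L₁] [Algebra E L₂] {v : Valuation L Γ} {v₁ : Valuation L₁ Γ} {v₂ : Valuation L₂ Γ}

/-- If `y` is closer to `x` than `z` is, then `y` and `x` have the same distance to `z`. -/
theorem map_sub_eq_of_lt {x y z : L} (h : v (x - y) < v (x - z)) : v (y - z) = v (x - z) := by
  have : y - z = (x - z) - (x - y) := by ring
  rw [this, v.map_sub_eq_of_lt_left h]

theorem IsLimitOver.notMem {b : L} (hb : IsLimitOver E v b) (a : E) : b ≠ algebraMap E L a := by
  rintro rfl
  obtain ⟨a', ha'⟩ := hb a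
  simp at ha'

theorem IsImmediateOver.isLimitOver (h : IsImmediateOver E v) {b : L}
    (hb : ∀ a, b ≠ algebraMap E L a) : IsLimitOver E v b := by
  intro a
  obtain ⟨a', ha'⟩ := h (b - algebraMap E L a) (sub_ne_zero.2 (hb a))
  refine ⟨a + a', ?_⟩
  rwa [map_add, ← sub_sub]

theorem SameCut.isLimitOver {b : L₁} {c : L₂} (h : SameCut E v₁ v₂ b c)
    (hb : IsLimitOver E v₁ b) : IsLimitOver E v₂ c := by
  intro a
  obtain ⟨a', ha'⟩ := hb a
  exact ⟨a', by rwa [← h a, ← h a']⟩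

theorem SameCut.symm {b : L₁} {c : L₂} (h : SameCut E v₁ v₂ b c) : SameCut E v₂ v₁ c b :=
  fun a => (h a).symm

theorem SameCut.refl (b : L) : SameCut E v v b b := fun _ => rfl

/-- An element close to `b` realizes the cut of `b`. -/
theorem sameCut_of_forall_lt {b b' : L}
    (h : ∀ a : E, v (b' - b) < v (b - algebraMap E L a)) : SameCut E v v b b' := by
  intro a
  rw [show b' - algebraMap E L a = (b' - b) + (b - algebraMap E L a) by ring,
    v.map_add_eq_of_lt_right (h a)]

theorem SameCut.trans {L₃ : Type*} [Field L₃] [Algebra E L₃] {v₃ : Valuation L₃ Γ} {b : L₁} {c : L₂}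
    {d : L₃} (h : SameCut E v₁ v₂ b c) (h' : SameCut E v₂ v₃ c d) : SameCut E v₁ v₃ b d :=
  fun a => (h a).trans (h' a)

/-- Two realizations of the cut of a limit are closer to each other than to any element of the
ground field. -/
theorem SameCut.sub_lt {b b' : L} (h : SameCut E v v b b') (hb : IsLimitOver E v b) (a : E) :
    v (b' - b) < v (b - algebraMap E L a) := by
  obtain ⟨a', ha'⟩ := hb a
  rw [show b' - b = (b' - algebraMap E L a') - (b - algebraMap E L a') by ring]
  refine (v.map_sub _ _).trans_lt (max_lt ?_ ha')
  rwa [← h a']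

/-- In a spherically complete extension of `E` the cut of a limit is realized. -/
theorem SphericallyComplete.exists_sameCut (hsc : SphericallyComplete v₂)
    (hE : ∀ a : E, v₁ (algebraMap E L₁ a) = v₂ (algebraMap E L₂ a)) {b : L₁}
    (hb : IsLimitOver E v₁ b) : ∃ c : L₂, SameCut E v₁ v₂ b c := by
  -- The ball around `a` of radius `v₁ (b - a)`: the radius is the value of `n a - a`, for an element
  -- `n a` of `E` closer to `b` than `a`.
  choose n hn using hb
  have hE' : ∀ a a' : E, v₂ (algebraMap E L₂ a - algebraMap E L₂ a')
      = v₁ (algebraMap E L₁ a - algebraMap E L₁ a') := fun a a' => by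
    rw [← map_sub, ← map_sub, hE]
  have hrad : ∀ a, v₂ (algebraMap E L₂ (n a - a)) = v₁ (b - algebraMap E L₁ a) := fun a => by
    rw [map_sub, hE', map_sub_eq_of_lt (hn a)]
  obtain ⟨c, hc⟩ := hsc (Set.range fun a : E => (algebraMap E L₂ a, algebraMap E L₂ (n a - a))) (by
    rintro _ ⟨a, rfl⟩ _ ⟨a', rfl⟩
    simp only [hrad, hE']
    rw [show algebraMap E L₁ a - algebraMap E L₁ a'
      = (b - algebraMap E L₁ a') - (b - algebraMap E L₁ a) by ring, max_comm]
    exact v₁.map_sub _ _)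
  have hle : ∀ a, v₂ (c - algebraMap E L₂ a) ≤ v₁ (b - algebraMap E L₁ a) := fun a => by
    rw [← hrad]
    exact hc _ ⟨a, rfl⟩
  refine ⟨c, fun a => ?_⟩
  have h1 := map_sub_eq_of_lt (hn a)
  rw [← h1, ← hE', show c - algebraMap E L₂ a = (c - algebraMap E L₂ (n a)) +
    (algebraMap E L₂ (n a) - algebraMap E L₂ a) by ring, v₂.map_add_eq_of_lt_right]
  rw [hE', h1]
  exact (hle _).trans_lt (hn a)

/-- A spherically complete field has no proper immediate extension. -/
theorem SphericallyComplete.surjective_of_isImmediateOver {vE : Valuation E Γ}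
    (hsc : SphericallyComplete vE) (hE : ∀ a : E, vE a = v (algebraMap E L a))
    (himm : IsImmediateOver E v) : Function.Surjective (algebraMap E L) := by
  intro b
  by_contra! hb
  have hlim := himm.isLimitOver (fun a => (hb a).symm)
  obtain ⟨c, hc⟩ := hsc.exists_sameCut (v₁ := v) (fun a => (hE a).symm) hlim
  exact (hc.isLimitOver hlim).notMem c rfl

theorem IsImmediateOver.exists_value_eq (h : IsImmediateOver E v) (b : L) :
    ∃ a : E, v (algebraMap E L a) = v b := by
  by_cases hb : b = 0
  · exact ⟨0, by simp [hb]⟩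
  obtain ⟨a, ha⟩ := h b hb
  refine ⟨a, ?_⟩
  have := map_sub_eq_of_lt (x := b) (y := algebraMap E L a) (z := 0) (v := v) (by simpa using ha)
  simpa using this

/-- For a limit `b` over `E`, finitely many conditions that hold for all elements of `E`
close to `b` hold simultaneously. -/
theorem exists_forall_finset {ι : Type*} (b : L) (S : Finset ι) (P : ι → E → Prop)
    (hP : ∀ i ∈ S, ∃ a, ∀ a', v (b - algebraMap E L a') ≤ v (b - algebraMap E L a) → P i a') :
    ∃ a, ∀ a', v (b - algebraMap E L a') ≤ v (b - algebraMap E L a) → ∀ i ∈ S, P i a' := by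
  classical
  induction S using Finset.induction_on with
  | empty => exact ⟨0, by simp⟩
  | insert i S hi ih =>
    obtain ⟨a₁, h₁⟩ := ih fun j hj => hP j (Finset.mem_insert_of_mem hj)
    obtain ⟨a₂, h₂⟩ := hP i (Finset.mem_insert_self _ _)
    rcases le_total (v (b - algebraMap E L a₁)) (v (b - algebraMap E L a₂)) with h | h
    · refine ⟨a₁, fun a' ha' j hj => ?_⟩
      rcases Finset.mem_insert.1 hj with rfl | hj
      · exact h₂ _ (ha'.trans h)
      · exact h₁ _ ha' j hj
    · refine ⟨a₂, fun a' ha' j hj => ?_⟩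
      rcases Finset.mem_insert.1 hj with rfl | hj
      · exact h₂ _ ha'
      · exact h₁ _ (ha'.trans h) j hj

end Basic

/-! ### Taylor expansions -/

section Taylor

variable {Γ : Type*} [LinearOrderedCommGroupWithZero Γ] {J : Type*}
variable {E L L₁ L₂ : Type*} [Field E] [Field L] [Field L₁] [Field L₂] [Algebra E L]
  [Algebra E L₁] [Algebra E L₂] {v : Valuation L Γ} {v₁ : Valuation L₁ Γ} {v₂ : Valuation L₂ Γ}

/-- The Taylor expansion `G(p + X)` of a polynomial `G` over `E` at a point `p` of `L`. -/
noncomputable def taylor (p : J → L) : MvPolynomial J E →ₐ[E] MvPolynomial J L :=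
  aeval fun j => X j + C (p j)

theorem eval_taylor (p y : J → L) (G : MvPolynomial J E) :
    eval y (taylor p G) = aeval (p + y) G := by
  induction G using MvPolynomial.induction_on with
  | C a => simp [taylor, IsScalarTower.algebraMap_apply E L (MvPolynomial J L), algebraMap_eq]
  | add f g hf hg => simp [hf, hg]
  | mul_X f j hf => rw [map_mul, map_mul, hf, map_mul]; simp [taylor, add_comm]

theorem coeff_zero_taylor (p : J → L) (G : MvPolynomial J E) :
    coeff 0 (taylor p G) = aeval p G := by
  have := eval_taylor p 0 G
  rw [add_zero] at this
  rw [← this, eval_zero]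
  rfl

theorem taylor_pderiv (p : J → L) (j : J) (G : MvPolynomial J E) :
    taylor p (pderiv j G) = pderiv j (taylor p G) := by
  classical
  induction G using MvPolynomial.induction_on with
  | C a => simp [taylor, IsScalarTower.algebraMap_apply E L (MvPolynomial J L), algebraMap_eq]
  | add f g hf hg => simp [hf, hg]
  | mul_X f i hf =>
    have hX : taylor p (X i : MvPolynomial J E) = X i + C (p i) := by simp [taylor]
    have h1 : taylor p (pderiv j (X i : MvPolynomial J E)) = pderiv j (X i + C (p i)) := by
      rw [pderiv_X, map_add, pderiv_X, pderiv_C, add_zero]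
      rcases eq_or_ne i j with rfl | h
      · simp
      · simp [h]
    rw [Derivation.leibniz, map_mul, map_add, hX, Derivation.leibniz, smul_eq_mul, smul_eq_mul,
      map_mul, map_mul, hf, hX, h1]
    simp [smul_eq_mul]

theorem coeff_taylor_pderiv (p : J → L) (j : J) (G : MvPolynomial J E) (k : J →₀ ℕ) :
    coeff k (taylor p (pderiv j G)) = coeff (k + Finsupp.single j 1) (taylor p G) * (k j + 1) := by
  rw [taylor_pderiv, coeff_pderiv]

/-- The value of the monomial with exponent `i` at a tuple whose `j`-th entry has value `s j γ`. -/
noncomputable def monomialValue (s : J → Γ → Γ) (i : J →₀ ℕ) (γ : Γ) : Γ :=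
  i.prod fun j e => s j γ ^ e

theorem monomialValue_zero (s : J → Γ → Γ) (γ : Γ) : monomialValue s 0 γ = 1 := by
  simp [monomialValue]

theorem monomialValue_single (s : J → Γ → Γ) (j : J) (γ : Γ) :
    monomialValue s (Finsupp.single j 1) γ = s j γ := by
  simp [monomialValue]

theorem monomialValue_add (s : J → Γ → Γ) (i k : J →₀ ℕ) (γ : Γ) :
    monomialValue s (i + k) γ = monomialValue s i γ * monomialValue s k γ := by
  classical
  exact Finsupp.prod_add_index' (by simp) (by intros; rw [pow_add])

theorem monomialValue_mono {s : J → Γ → Γ} (hs : ∀ j, StrictMono (s j)) (i : J →₀ ℕ) {γ δ : Γ}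
    (h : γ ≤ δ) : monomialValue s i γ ≤ monomialValue s i δ :=
  Finset.prod_le_prod' fun j _ => pow_le_pow_left' ((hs j).monotone h) _

theorem monomialValue_ne_zero_split {i : J →₀ ℕ} (hi : i ≠ 0) :
    ∃ (j : J) (k : J →₀ ℕ), i = k + Finsupp.single j 1 := by
  classical
  obtain ⟨j, hj⟩ := Finsupp.ne_iff.1 hi
  refine ⟨j, i - Finsupp.single j 1, ?_⟩
  rw [tsub_add_cancel_of_le]
  rw [Finsupp.single_le_iff]
  exact Nat.one_le_iff_ne_zero.2 (by simpa using hj)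

theorem valuation_prod_eq {s : J → Γ → Γ} {τ : J → L → L} (hτ : ∀ j x, v (τ j x) = s j (v x))
    (i : J →₀ ℕ) (y : L) : v (∏ j ∈ i.support, τ j y ^ i j) = monomialValue s i (v y) := by
  rw [map_prod, monomialValue, Finsupp.prod]
  simp [hτ]

/-- If every term of a polynomial is small, so is its value. -/
theorem valuation_eval_lt {s : J → Γ → Γ} {τ : J → L → L} (hτ : ∀ j x, v (τ j x) = s j (v x))
    (Q : MvPolynomial J L) (y : L) {g : Γ} (hg : g ≠ 0)
    (h : ∀ i, v (coeff i Q) * monomialValue s i (v y) < g) :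
    v (eval (fun j => τ j y) Q) < g := by
  rw [eval_eq]
  refine v.map_sum_lt hg fun i _ => ?_
  rw [map_mul, valuation_prod_eq hτ]
  exact h i

theorem valuation_eval_le {s : J → Γ → Γ} {τ : J → L → L} (hτ : ∀ j x, v (τ j x) = s j (v x))
    (Q : MvPolynomial J L) (y : L) {g : Γ}
    (h : ∀ i, coeff i Q ≠ 0 → v (coeff i Q) * monomialValue s i (v y) ≤ g) :
    v (eval (fun j => τ j y) Q) ≤ g := by
  rw [eval_eq]
  refine v.map_sum_le fun i hi => ?_
  rw [map_mul, valuation_prod_eq hτ]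
  exact h i (mem_support_iff.1 hi)

end Taylor

/-! ### Stable polynomials -/

section Stable

variable {Γ : Type*} [LinearOrderedCommGroupWithZero Γ] {J : Type*}
variable {E L L₁ L₂ : Type*} [Field E] [Field L] [Field L₁] [Field L₂] [Algebra E L]
  [Algebra E L₁] [Algebra E L₂] {v : Valuation L Γ} {v₁ : Valuation L₁ Γ} {v₂ : Valuation L₂ Γ}
  {s : J → Γ → Γ} {τE : J → E → E}
  {τ : J → L ≃+* L} {τ₁ : J → L₁ ≃+* L₁} {τ₂ : J → L₂ ≃+* L₂}

/-- The automorphisms `τ j` of `L` act on values through the maps `s j`, and on `E` through the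
maps `τE j`. -/
structure IsValuedAction (s : J → Γ → Γ) (τE : J → E → E) (v : Valuation L Γ)
    (τ : J → L ≃+* L) : Prop where
  map_value : ∀ j x, v (τ j x) = s j (v x)
  commutes : ∀ j a, τ j (algebraMap E L a) = algebraMap E L (τE j a)

/-- The polynomial `G` is stable at `b` if, for some `a ∈ E` close to `b`, the constant term of the
Taylor expansion of `G` at `b` dominates all the other terms at `a - b`. The value of `G` is then
constant on the elements of `E` that are close to `b`. -/
def IsStableAt (s : J → Γ → Γ) (τ : J → L ≃+* L) (v : Valuation L Γ) (b : L)
    (G : MvPolynomial J E) : Prop :=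
  ∃ a : E, ∀ i ≠ 0, v (coeff i (taylor (fun j => τ j b) G)) *
    monomialValue s i (v (b - algebraMap E L a)) < v (aeval (fun j => τ j b) G)

theorem valuation_aeval_sub_lt (hτ : ∀ j x, v (τ j x) = s j (v x)) (G : MvPolynomial J E)
    (b y : L) {g : Γ} (hg : g ≠ 0)
    (h : ∀ i ≠ 0, v (coeff i (taylor (fun j => τ j b) G)) * monomialValue s i (v y) < g) :
    v (aeval (fun j => τ j (b + y)) G - aeval (fun j => τ j b) G) < g := by
  classical
  have h1 : aeval (fun j => τ j (b + y)) G - aeval (fun j => τ j b) G =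
      eval (fun j => τ j y) (taylor (fun j => τ j b) G - C (aeval (fun j => τ j b) G)) := by
    rw [map_sub, eval_taylor, eval_C]
    congr 3
    ext j
    simp
  rw [h1]
  refine valuation_eval_lt (τ := fun j => τ j) hτ _ _ hg fun i => ?_
  rw [coeff_sub, coeff_C]
  by_cases hi : i = 0
  · subst hi
    rw [if_pos rfl, coeff_zero_taylor]
    simpa using zero_lt_iff.2 hg
  · rw [if_neg (Ne.symm hi), sub_zero]
    exact h i hi

theorem valuation_aeval_sub_le (hτ : ∀ j x, v (τ j x) = s j (v x)) (G : MvPolynomial J E)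
    (b y : L) {g : Γ}
    (h : ∀ i ≠ 0, v (coeff i (taylor (fun j => τ j b) G)) * monomialValue s i (v y) ≤ g) :
    v (aeval (fun j => τ j (b + y)) G - aeval (fun j => τ j b) G) ≤ g := by
  classical
  have h1 : aeval (fun j => τ j (b + y)) G - aeval (fun j => τ j b) G =
      eval (fun j => τ j y) (taylor (fun j => τ j b) G - C (aeval (fun j => τ j b) G)) := by
    rw [map_sub, eval_taylor, eval_C]
    congr 3
    ext j
    simp
  rw [h1]
  refine valuation_eval_le (τ := fun j => τ j) hτ _ _ fun i => ?_
  rw [coeff_sub, coeff_C]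
  by_cases hi : i = 0
  · subst hi
    rw [if_pos rfl, coeff_zero_taylor]
    simp
  · rw [if_neg (Ne.symm hi), sub_zero]
    exact fun _ => h i hi

theorem IsValuedAction.aeval_algebraMap (h : IsValuedAction s τE v τ) (G : MvPolynomial J E)
    (a : E) : aeval (fun j => τ j (algebraMap E L a)) G
      = algebraMap E L (aeval (fun j => τE j a) G) := by
  simp_rw [h.commutes]
  exact aeval_algebraMap_apply L (fun j => τE j a) G

theorem IsStableAt.aeval_ne_zero [Nonempty J] {b : L} {G : MvPolynomial J E}
    (h : IsStableAt s τ v b G) : aeval (fun j => τ j b) G ≠ 0 := by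
  intro h0
  obtain ⟨a, ha⟩ := h
  have := ha (Finsupp.single (Classical.arbitrary J) 1) (by simp)
  rw [h0, map_zero] at this
  exact not_lt_zero this

theorem isStableAt_C {b : L} {c : E} (hc : c ≠ 0) :
    IsStableAt s τ v b (C c : MvPolynomial J E) := by
  classical
  refine ⟨0, fun i hi => ?_⟩
  have : taylor (fun j => τ j b) (C c : MvPolynomial J E) = C (algebraMap E L c) := by
    simp [taylor, IsScalarTower.algebraMap_apply E L (MvPolynomial J L), algebraMap_eq]
  rw [this, coeff_C, if_neg (Ne.symm hi), map_zero, zero_mul, aeval_C, v.pos_iff]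
  simpa using hc

/-- Close to `b`, the values of a stable polynomial at elements of `E` approximate its value
at `b`. -/
theorem IsStableAt.exists_approx [Nonempty J] (hτ : IsValuedAction s τE v τ)
    (hs : ∀ j, StrictMono (s j)) {b : L} {G : MvPolynomial J E} (h : IsStableAt s τ v b G) :
    ∃ a : E, ∀ a' : E, v (b - algebraMap E L a') ≤ v (b - algebraMap E L a) →
      v (aeval (fun j => τ j b) G - algebraMap E L (aeval (fun j => τE j a') G))
        < v (aeval (fun j => τ j b) G) := by
  have h0 := h.aeval_ne_zero
  obtain ⟨a, ha⟩ := h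
  refine ⟨a, fun a' ha' => ?_⟩
  have := valuation_aeval_sub_lt hτ.map_value G b (algebraMap E L a' - b) ((v.ne_zero_iff).2 h0)
    fun i hi => by
      refine lt_of_le_of_lt ?_ (ha i hi)
      rw [v.map_sub_swap]
      gcongr
      exact monomialValue_mono hs i ha'
  rwa [add_sub_cancel, hτ.aeval_algebraMap, v.map_sub_swap] at this

/-- If the nonconstant Taylor coefficients of `G` at two realizations of a cut have the same values,
and `G` is stable, then `G` has the same value at both points: this is the value of `G` at an
element of `E` close to them. -/
theorem IsStableAt.value_eq_of_coeff_eq [Nonempty J] (hτ₁ : IsValuedAction s τE v₁ τ₁)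
    (hτ₂ : IsValuedAction s τE v₂ τ₂)
    (hE : ∀ a : E, v₁ (algebraMap E L₁ a) = v₂ (algebraMap E L₂ a))
    {b : L₁} {c : L₂} (hbc : SameCut E v₁ v₂ b c) {G : MvPolynomial J E}
    (hG : ∀ i ≠ 0, v₁ (coeff i (taylor (fun j => τ₁ j b) G))
      = v₂ (coeff i (taylor (fun j => τ₂ j c) G)))
    (h : IsStableAt s τ₁ v₁ b G) :
    v₁ (aeval (fun j => τ₁ j b) G) = v₂ (aeval (fun j => τ₂ j c) G) := by
  have h0 := h.aeval_ne_zero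
  obtain ⟨a, ha⟩ := h
  have h1 := valuation_aeval_sub_lt hτ₁.map_value G b (algebraMap E L₁ a - b)
    ((v₁.ne_zero_iff).2 h0) fun i hi => by
      rw [v₁.map_sub_swap]; exact ha i hi
  have h2 := valuation_aeval_sub_lt hτ₂.map_value G c (algebraMap E L₂ a - c)
    ((v₁.ne_zero_iff).2 h0) fun i hi => by
      rw [v₂.map_sub_swap, ← hbc a, ← hG i hi]; exact ha i hi
  rw [add_sub_cancel, hτ₁.aeval_algebraMap] at h1
  rw [add_sub_cancel, hτ₂.aeval_algebraMap] at h2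
  have h3 := v₁.map_eq_of_sub_lt h1
  rw [← h3, hE] at h2 ⊢
  rw [v₂.map_sub_swap] at h2
  exact (v₂.map_eq_of_sub_lt h2).symm

theorem valuation_coeff_taylor_pderiv (hv : ∀ n : ℕ, n ≠ 0 → v n = 1) (p : J → L) (j : J)
    (G : MvPolynomial J E) (k : J →₀ ℕ) :
    v (coeff k (taylor p (pderiv j G))) = v (coeff (k + Finsupp.single j 1) (taylor p G)) := by
  rw [coeff_taylor_pderiv, map_mul]
  have := hv (k j + 1) (by omega)
  push_cast at this
  rw [this, mul_one]

/-- The values of the nonconstant Taylor coefficients of a polynomial are determined by the Taylor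
coefficients of its derivatives. -/
theorem coeff_eq_of_pderiv (hv₁ : ∀ n : ℕ, n ≠ 0 → v₁ n = 1) (hv₂ : ∀ n : ℕ, n ≠ 0 → v₂ n = 1)
    {p : J → L₁} {q : J → L₂} {G : MvPolynomial J E}
    (h : ∀ j k, v₁ (coeff k (taylor p (pderiv j G))) = v₂ (coeff k (taylor q (pderiv j G))))
    (i : J →₀ ℕ) (hi : i ≠ 0) :
    v₁ (coeff i (taylor p G)) = v₂ (coeff i (taylor q G)) := by
  obtain ⟨j, k, rfl⟩ := monomialValue_ne_zero_split hi
  rw [← valuation_coeff_taylor_pderiv hv₁, ← valuation_coeff_taylor_pderiv hv₂, h]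

theorem totalDegree_pderiv_lt {G : MvPolynomial J E} (hG : G.totalDegree ≠ 0) (j : J) :
    (pderiv j G).totalDegree < G.totalDegree := by
  classical
  rw [totalDegree, Finset.sup_lt_iff (Nat.pos_of_ne_zero hG)]
  intro m hm
  rw [mem_support_iff, coeff_pderiv] at hm
  have h := le_totalDegree (mem_support_iff.2 (left_ne_zero_of_mul hm))
  have h2 : ((m + Finsupp.single j 1).sum fun _ e => e) = (m.sum fun _ e => e) + 1 := by
    rw [Finsupp.sum_add_index' (by simp) (by simp), Finsupp.sum_single_index rfl]
  omega

theorem pderiv_eq_zero_of_totalDegree_eq_zero {G : MvPolynomial J E} (hG : G.totalDegree = 0)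
    (j : J) : pderiv j G = 0 := by
  rw [totalDegree_eq_zero_iff_eq_C.1 hG, pderiv_C]

/-- If all nonzero members of a class of polynomials closed under derivation are stable at `b`, then
the values of their Taylor coefficients depend on the cut of `b` only. The proof is by induction on
the degree: up to a positive integer, which has value `1`, the nonconstant coefficients are
coefficients of derivatives. -/
theorem coeff_taylor_eq_of_sameCut [Nonempty J] (hv₁ : ∀ n : ℕ, n ≠ 0 → v₁ n = 1)
    (hv₂ : ∀ n : ℕ, n ≠ 0 → v₂ n = 1) (hτ₁ : IsValuedAction s τE v₁ τ₁)
    (hτ₂ : IsValuedAction s τE v₂ τ₂)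
    (hE : ∀ a : E, v₁ (algebraMap E L₁ a) = v₂ (algebraMap E L₂ a))
    {b : L₁} {c : L₂} (hbc : SameCut E v₁ v₂ b c) {𝒞 : Set (MvPolynomial J E)}
    (h𝒞 : ∀ G ∈ 𝒞, ∀ j, pderiv j G ∈ 𝒞) (hst : ∀ G ∈ 𝒞, G ≠ 0 → IsStableAt s τ₁ v₁ b G)
    (G : MvPolynomial J E) (hG : G ∈ 𝒞) (i : J →₀ ℕ) :
    v₁ (coeff i (taylor (fun j => τ₁ j b) G)) = v₂ (coeff i (taylor (fun j => τ₂ j c) G)) := by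
  induction hd : G.totalDegree using Nat.strong_induction_on generalizing G i with
  | _ d ih =>
  have hne : ∀ i ≠ 0, v₁ (coeff i (taylor (fun j => τ₁ j b) G))
      = v₂ (coeff i (taylor (fun j => τ₂ j c) G)) := by
    refine coeff_eq_of_pderiv hv₁ hv₂ fun j k => ?_
    by_cases h0 : G.totalDegree = 0
    · rw [pderiv_eq_zero_of_totalDegree_eq_zero h0]
      simp
    · exact ih _ (hd ▸ totalDegree_pderiv_lt h0 j) _ (h𝒞 G hG j) k rfl
  by_cases hi : i = 0
  · subst hi
    rw [coeff_zero_taylor, coeff_zero_taylor]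
    by_cases hG0 : G = 0
    · simp [hG0]
    · exact (hst G hG hG0).value_eq_of_coeff_eq hτ₁ hτ₂ hE hbc hne
  · exact hne i hi

theorem aeval_eq_of_sameCut [Nonempty J] (hv₁ : ∀ n : ℕ, n ≠ 0 → v₁ n = 1)
    (hv₂ : ∀ n : ℕ, n ≠ 0 → v₂ n = 1) (hτ₁ : IsValuedAction s τE v₁ τ₁)
    (hτ₂ : IsValuedAction s τE v₂ τ₂)
    (hE : ∀ a : E, v₁ (algebraMap E L₁ a) = v₂ (algebraMap E L₂ a))
    {b : L₁} {c : L₂} (hbc : SameCut E v₁ v₂ b c) {𝒞 : Set (MvPolynomial J E)}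
    (h𝒞 : ∀ G ∈ 𝒞, ∀ j, pderiv j G ∈ 𝒞) (hst : ∀ G ∈ 𝒞, G ≠ 0 → IsStableAt s τ₁ v₁ b G)
    (G : MvPolynomial J E) (hG : G ∈ 𝒞) :
    v₁ (aeval (fun j => τ₁ j b) G) = v₂ (aeval (fun j => τ₂ j c) G) := by
  have := coeff_taylor_eq_of_sameCut hv₁ hv₂ hτ₁ hτ₂ hE hbc h𝒞 hst G hG 0
  rwa [coeff_zero_taylor, coeff_zero_taylor] at this

/-- Stability depends on the cut only. -/
theorem isStableAt_iff_of_sameCut [Nonempty J] (hv₁ : ∀ n : ℕ, n ≠ 0 → v₁ n = 1)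
    (hv₂ : ∀ n : ℕ, n ≠ 0 → v₂ n = 1) (hτ₁ : IsValuedAction s τE v₁ τ₁)
    (hτ₂ : IsValuedAction s τE v₂ τ₂)
    (hE : ∀ a : E, v₁ (algebraMap E L₁ a) = v₂ (algebraMap E L₂ a))
    {b : L₁} {c : L₂} (hbc : SameCut E v₁ v₂ b c) {𝒞 : Set (MvPolynomial J E)}
    (h𝒞 : ∀ G ∈ 𝒞, ∀ j, pderiv j G ∈ 𝒞) (hst : ∀ G ∈ 𝒞, G ≠ 0 → IsStableAt s τ₁ v₁ b G)
    (G : MvPolynomial J E) (hG : ∀ j, pderiv j G ∈ 𝒞) :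
    IsStableAt s τ₁ v₁ b G ↔ IsStableAt s τ₂ v₂ c G := by
  have hne : ∀ i ≠ 0, v₁ (coeff i (taylor (fun j => τ₁ j b) G))
      = v₂ (coeff i (taylor (fun j => τ₂ j c) G)) :=
    coeff_eq_of_pderiv hv₁ hv₂ fun j k =>
      coeff_taylor_eq_of_sameCut hv₁ hv₂ hτ₁ hτ₂ hE hbc h𝒞 hst _ (hG j) k
  constructor
  · intro h
    have h1 := h.value_eq_of_coeff_eq hτ₁ hτ₂ hE hbc hne
    obtain ⟨a, ha⟩ := h
    refine ⟨a, fun i hi => ?_⟩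
    rw [← hne i hi, ← hbc a, ← h1]
    exact ha i hi
  · intro h
    have h1 := h.value_eq_of_coeff_eq hτ₂ hτ₁ (fun a => (hE a).symm) hbc.symm
      (fun i hi => (hne i hi).symm)
    obtain ⟨a, ha⟩ := h
    refine ⟨a, fun i hi => ?_⟩
    rw [hne i hi, hbc a, ← h1]
    exact ha i hi

/-- If the nonzero first derivatives of `G` are stable at `b`, then close to `b` every term of
degree at least two of the Taylor expansion of `G` at `b` is dominated by a linear term. -/
theorem exists_linear_dominance [Nonempty J] (hv : ∀ n : ℕ, n ≠ 0 → v n = 1)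
    (hs : ∀ j, StrictMono (s j)) {b : L} {G : MvPolynomial J E}
    (hst : ∀ j, pderiv j G ≠ 0 → IsStableAt s τ v b (pderiv j G)) :
    ∃ a : E, ∀ a' : E, v (b - algebraMap E L a') ≤ v (b - algebraMap E L a) →
      ∀ j, pderiv j G ≠ 0 → ∀ k ≠ 0,
        v (coeff (k + Finsupp.single j 1) (taylor (fun j => τ j b) G)) *
          monomialValue s k (v (b - algebraMap E L a'))
          < v (coeff (Finsupp.single j 1) (taylor (fun j => τ j b) G)) := by
  obtain ⟨a, ha⟩ := exists_forall_finset (v := v) b G.vars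
    (fun j a' => pderiv j G ≠ 0 → ∀ k ≠ 0,
        v (coeff (k + Finsupp.single j 1) (taylor (fun j => τ j b) G)) *
          monomialValue s k (v (b - algebraMap E L a'))
          < v (coeff (Finsupp.single j 1) (taylor (fun j => τ j b) G))) (by
    intro j _
    by_cases h0 : pderiv j G = 0
    · exact ⟨0, fun _ _ h => absurd h0 h⟩
    obtain ⟨a, ha⟩ := hst j h0
    refine ⟨a, fun a' ha' _ k hk => ?_⟩
    have h1 := ha k hk
    rw [← coeff_zero_taylor, valuation_coeff_taylor_pderiv hv, valuation_coeff_taylor_pderiv hv,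
      zero_add] at h1
    refine lt_of_le_of_lt ?_ h1
    gcongr
    exact monomialValue_mono hs k ha')
  refine ⟨a, fun a' ha' j hj => ha a' ha' j ?_ hj⟩
  by_contra hvar
  exact hj (pderiv_eq_zero_of_notMem_vars hvar)

end Stable

/-! ### Hensel's lemma -/

section Hensel

variable {Γ : Type*} [LinearOrderedCommGroupWithZero Γ] {J : Type*}
variable {E L L₁ L₂ : Type*} [Field E] [Field L] [Field L₁] [Field L₂] [Algebra E L]
  [Algebra E L₁] [Algebra E L₂] {v : Valuation L Γ} {v₁ : Valuation L₁ Γ} {v₂ : Valuation L₂ Γ}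
  {s : J → Γ → Γ} {τE : J → E → E}
  {τ : J → L ≃+* L} {τ₁ : J → L₁ ≃+* L₁} {τ₂ : J → L₂ ≃+* L₂}

/-- Inhomogeneous linear equations `1 + ∑ α j * τ j x = 0` with integral coefficients, not all of
them in the maximal ideal, are solvable modulo the maximal ideal. -/
def IsLinearlyClosed (v : Valuation L Γ) (τ : J → L ≃+* L) : Prop :=
  ∀ (S : Finset J) (α : J → L), (∀ j ∈ S, v (α j) ≤ 1) → (∃ j ∈ S, v (α j) = 1) →
    ∃ x, v x ≤ 1 ∧ v (1 + ∑ j ∈ S, α j * τ j x) < 1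

/-- For the trivial action the only equation to be solved is `1 + α x = 0`. -/
theorem IsLinearlyClosed.of_unit (v : Valuation L Γ) :
    IsLinearlyClosed v (fun _ : Unit => RingEquiv.refl L) := by
  rintro S α - ⟨j, hj, hα⟩
  have h0 : α j ≠ 0 := by
    rintro h
    simp [h] at hα
  refine ⟨-(α j)⁻¹, by simp [hα], ?_⟩
  have hS : S = {j} := by
    ext k
    simp [Subsingleton.elim k j, hj]
  simp [hS, h0]

theorem exists_eq_single_or_split {i : J →₀ ℕ} (hi : i ≠ 0) :
    (∃ j, i = Finsupp.single j 1) ∨ ∃ (j : J) (k : J →₀ ℕ), k ≠ 0 ∧ i = k + Finsupp.single j 1 := by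
  obtain ⟨j, k, rfl⟩ := monomialValue_ne_zero_split hi
  by_cases hk : k = 0
  · exact .inl ⟨j, by simp [hk]⟩
  · exact .inr ⟨j, k, hk, rfl⟩

/-- One step of Newton approximation: if the linear part of the Taylor expansion of `G` at `z` takes
the value `v (G z)` on the scale of `t` and dominates the terms of higher degree there, then the
value of `G` can be decreased by moving `z` by at most `v t`. -/
theorem exists_valuation_aeval_lt (hτ : ∀ j x, v (τ j x) = s j (v x))
    (hs : ∀ j, StrictMono (s j)) (hlin : IsLinearlyClosed v τ) (G : MvPolynomial J E) (z t : L)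
    (hG : aeval (fun j => τ j z) G ≠ 0)
    (hle : ∀ j, v (coeff (Finsupp.single j 1) (taylor (fun j => τ j z) G)) * s j (v t) ≤
      v (aeval (fun j => τ j z) G))
    (heq : ∃ j ∈ G.vars, v (coeff (Finsupp.single j 1) (taylor (fun j => τ j z) G)) * s j (v t) =
      v (aeval (fun j => τ j z) G))
    (hvars : ∀ j ∉ G.vars, coeff (Finsupp.single j 1) (taylor (fun j => τ j z) G) = 0)
    (hhigh : ∀ (j : J) (k : J →₀ ℕ), k ≠ 0 →
      v (coeff (k + Finsupp.single j 1) (taylor (fun j => τ j z) G)) *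
        monomialValue s (k + Finsupp.single j 1) (v t) < v (aeval (fun j => τ j z) G)) :
    ∃ z', v (z' - z) ≤ v t ∧ v (aeval (fun j => τ j z') G) < v (aeval (fun j => τ j z) G) := by
  classical
  set T := taylor (fun j => τ j z) G with hT
  set h := aeval (fun j => τ j z) G with hh
  have hv0 : v h ≠ 0 := v.ne_zero_iff.2 hG
  obtain ⟨x, hx1, hx⟩ := hlin G.vars (fun j => coeff (Finsupp.single j 1) T * τ j t / h)
    (fun j _ => by
      rw [map_div₀, map_mul, hτ]
      exact div_le_one_of_le₀ (hle j) zero_le)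
    (by
      obtain ⟨j, hj, hj'⟩ := heq
      refine ⟨j, hj, ?_⟩
      rw [map_div₀, map_mul, hτ, hj', div_self hv0])
  refine ⟨z + t * x, ?_, ?_⟩
  · rw [add_sub_cancel_left, map_mul]
    exact mul_le_of_le_one_right' hx1
  have hvtx : v (t * x) ≤ v t := by
    rw [map_mul]
    exact mul_le_of_le_one_right' hx1
  set Q := T - C h - ∑ j ∈ G.vars, C (coeff (Finsupp.single j 1) T) * X j with hQ
  have hsum : ∀ i, coeff i (∑ j ∈ G.vars, C (coeff (Finsupp.single j 1) T) * X j) =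
      ∑ j ∈ G.vars, coeff (Finsupp.single j 1) T * if Finsupp.single j 1 = i then 1 else 0 := by
    intro i
    rw [coeff_sum]
    simp [coeff_C_mul, coeff_X]
  have hQlt : v (eval (fun j => τ j (t * x)) Q) < v h := by
    refine valuation_eval_lt (τ := fun j => τ j) hτ Q (t * x) hv0 fun i => ?_
    rw [hQ, coeff_sub, coeff_sub, hsum, coeff_C]
    by_cases hi : i = 0
    · subst hi
      rw [Finset.sum_eq_zero (fun j _ => by simp), if_pos rfl, coeff_zero_taylor]
      simpa [hh] using zero_lt_iff.2 hv0
    rw [if_neg (Ne.symm hi), sub_zero]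
    rcases exists_eq_single_or_split hi with ⟨j, rfl⟩ | ⟨j, k, hk, rfl⟩
    · have : ∀ j', (Finsupp.single j' 1 = (Finsupp.single j 1 : J →₀ ℕ)) ↔ j' = j := fun j' =>
        Finsupp.single_left_inj one_ne_zero
      simp only [this, mul_ite, mul_one, mul_zero, Finset.sum_ite_eq']
      by_cases hj : j ∈ G.vars
      · simpa [hj] using zero_lt_iff.2 hv0
      · rw [if_neg hj, hT, hvars j hj]
        simpa using zero_lt_iff.2 hv0
    · rw [Finset.sum_eq_zero, sub_zero]
      · refine lt_of_le_of_lt ?_ (hhigh j k hk)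
        gcongr
        exact monomialValue_mono hs _ hvtx
      · intro j' _
        rw [if_neg, mul_zero]
        intro h'
        apply hk
        have h1 := congrArg Finsupp.degree h'
        exact (Finsupp.degree_eq_zero_iff k).1 (by simpa [Finsupp.degree_single] using h1)
  have hval : aeval (fun j => τ j (z + t * x)) G = eval (fun j => τ j (t * x)) Q +
      h * (1 + ∑ j ∈ G.vars, coeff (Finsupp.single j 1) T * τ j t / h * τ j x) := by
    have h1 : aeval (fun j => τ j (z + t * x)) G = eval (fun j => τ j (t * x)) T := by
      rw [hT, eval_taylor]
      congr 2
      ext j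
      simp
    rw [h1, hQ, map_sub, map_sub, eval_C, map_sum, mul_add, Finset.mul_sum]
    have h2 : ∀ j ∈ G.vars, h * (coeff (Finsupp.single j 1) T * τ j t / h * τ j x) =
        eval (fun j => τ j (t * x)) (C (coeff (Finsupp.single j 1) T) * X j) := by
      intro j _
      simp only [map_mul, eval_C, eval_X]
      field_simp
    rw [Finset.sum_congr rfl h2]
    ring
  rw [hval]
  refine v.map_add_lt hQlt ?_
  rw [map_mul]
  exact mul_lt_of_lt_one_right (zero_lt_iff.2 hv0) hx

/-- A form of Hensel's lemma. In a spherically complete field in which linear equations can be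
solved modulo the maximal ideal, a polynomial that is not stable at a limit `c` over `E`, while its
derivatives are, has a zero that realizes the cut of `c` over `E`. -/
theorem exists_zero_of_not_isStableAt [Nonempty J] (hv : ∀ n : ℕ, n ≠ 0 → v n = 1)
    (hτ : IsValuedAction s τE v τ) (hs : ∀ j, StrictMono (s j)) (hsc : SphericallyComplete v)
    (hlin : IsLinearlyClosed v τ) {c : L} (hc : IsLimitOver E v c)
    {𝒞 : Set (MvPolynomial J E)} (h𝒞 : ∀ G ∈ 𝒞, ∀ j, pderiv j G ∈ 𝒞)
    (hst : ∀ G ∈ 𝒞, G ≠ 0 → IsStableAt s τ v c G)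
    {G : MvPolynomial J E} (hG : ∀ j, pderiv j G ∈ 𝒞) (hns : ¬ IsStableAt s τ v c G) :
    ∃ c', SameCut E v v c c' ∧ aeval (fun j => τ j c') G = 0 := by
  classical
  by_contra! hno
  set T := taylor (fun j => τ j c) G with hT
  -- The values of the nonconstant Taylor coefficients are the same at all points of the cut.
  have H1 : ∀ z, SameCut E v v c z → ∀ i ≠ 0,
      v (coeff i (taylor (fun j => τ j z) G)) = v (coeff i T) := fun z hz i hi =>
    (coeff_eq_of_pderiv hv hv (fun j k =>
      coeff_taylor_eq_of_sameCut hv hv hτ hτ (fun _ => rfl) hz h𝒞 hst _ (hG j) k) i hi).symm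
  have hder : ∀ j, pderiv j G = 0 → ∀ k, coeff (k + Finsupp.single j 1) T = 0 := by
    intro j hj k
    rw [← v.zero_iff, ← valuation_coeff_taylor_pderiv hv, hj]
    simp
  obtain ⟨a₀, ha₀⟩ := exists_linear_dominance hv hs (τ := τ) (v := v) (b := c) (G := G)
    fun j hj => hst _ (hG j) hj
  have H2 : ∀ y : L, v y ≤ v (c - algebraMap E L a₀) → y ≠ 0 → ∀ (j : J) (k : J →₀ ℕ), k ≠ 0 →
      v (coeff (k + Finsupp.single j 1) T) * monomialValue s (k + Finsupp.single j 1) (v y) ≤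
        v (coeff (Finsupp.single j 1) T) * s j (v y) ∧
      (coeff (k + Finsupp.single j 1) T ≠ 0 →
      v (coeff (k + Finsupp.single j 1) T) * monomialValue s (k + Finsupp.single j 1) (v y) <
        v (coeff (Finsupp.single j 1) T) * s j (v y)) := by
    intro y hy hy0 j k hk
    by_cases hj : pderiv j G = 0
    · rw [hder j hj k]
      simp
    have h1 := ha₀ a₀ le_rfl j hj k hk
    have h2 : v (coeff (k + Finsupp.single j 1) T) * monomialValue s k (v y) <
        v (coeff (Finsupp.single j 1) T) := by
      refine lt_of_le_of_lt ?_ h1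
      gcongr
      exact monomialValue_mono hs k hy
    have h3 : 0 < s j (v y) := zero_le.trans_lt (hs j (v.pos_iff.2 hy0))
    rw [monomialValue_add, monomialValue_single, ← mul_assoc]
    have h4 := mul_lt_mul_of_pos_right h2 h3
    exact ⟨h4.le, fun _ => h4⟩
  have hvars : ∀ j ∉ G.vars, coeff (Finsupp.single j 1) T = 0 := fun j hj => by
    simpa using hder j (pderiv_eq_zero_of_notMem_vars hj) 0
  -- As `G` is not stable at `z`, some Taylor term is large on the scale of `c - a`; it can be taken
  -- linear, since near `c` the linear terms dominate.
  have H3 : ∀ z, SameCut E v v c z → ∀ a : E, ∃ j, v (aeval (fun j => τ j z) G) ≤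
      v (coeff (Finsupp.single j 1) T) * s j (v (c - algebraMap E L a)) := by
    intro z hz a
    have hz0 := hno z hz
    have hnsz : ¬ IsStableAt s τ v z G := by
      rwa [← isStableAt_iff_of_sameCut hv hv hτ hτ (fun _ => rfl) hz h𝒞 hst G hG]
    obtain ⟨a₁, h₁, h₁'⟩ : ∃ a₁, v (c - algebraMap E L a₁) ≤ v (c - algebraMap E L a) ∧
        v (c - algebraMap E L a₁) ≤ v (c - algebraMap E L a₀) := by
      rcases le_total (v (c - algebraMap E L a)) (v (c - algebraMap E L a₀)) with h | h
      · exact ⟨a, le_rfl, h⟩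
      · exact ⟨a₀, h, le_rfl⟩
    unfold IsStableAt at hnsz
    push Not at hnsz
    obtain ⟨i, hi, hi'⟩ := hnsz a₁
    rw [H1 z hz i hi, ← hz a₁] at hi'
    have hc1 : c - algebraMap E L a₁ ≠ 0 := sub_ne_zero.2 (hc.notMem a₁)
    have key : ∀ j, v (aeval (fun j => τ j z) G) ≤
        v (coeff (Finsupp.single j 1) T) * s j (v (c - algebraMap E L a₁)) →
        v (aeval (fun j => τ j z) G) ≤
        v (coeff (Finsupp.single j 1) T) * s j (v (c - algebraMap E L a)) := fun j h => by
      refine h.trans ?_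
      gcongr
      exact (hs j).monotone h₁
    rcases exists_eq_single_or_split hi with ⟨j, rfl⟩ | ⟨j, k, hk, rfl⟩
    · exact ⟨j, key j (by rwa [monomialValue_single] at hi')⟩
    · exact ⟨j, key j (hi'.trans (H2 _ h₁' hc1 j k hk).1)⟩
  -- The scale `t` at which the linear part has exactly the value of `G` at `z`. As `G` is not stable
  -- at `z`, the linear part reaches this value on the scale of every `c - a`, so `t` is smaller.
  have H4 : ∀ z : {z // SameCut E v v c z}, ∃ t : L, t ≠ 0 ∧
      (∀ a : E, v t < v (c - algebraMap E L a)) ∧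
      (∀ j, v (coeff (Finsupp.single j 1) T) * s j (v t) ≤ v (aeval (fun j => τ j z.1) G)) ∧
      (∃ j ∈ G.vars, v (coeff (Finsupp.single j 1) T) * s j (v t) =
        v (aeval (fun j => τ j z.1) G)) := by
    rintro ⟨z, hz⟩
    have hz0 := hno z hz
    set h := aeval (fun j => τ j z) G with hh
    let S := G.vars.filter fun j => coeff (Finsupp.single j 1) T ≠ 0
    have hS : S.Nonempty := by
      obtain ⟨j, hj⟩ := H3 z hz 0
      have : coeff (Finsupp.single j 1) T ≠ 0 := by
        intro h0
        rw [h0, map_zero, zero_mul] at hj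
        exact hz0 (v.zero_iff.1 (le_zero_iff.1 hj))
      refine ⟨j, Finset.mem_filter.2 ⟨?_, this⟩⟩
      by_contra hj'
      exact this (hvars j hj')
    let y : J → L := fun j => (τ j).symm (h / coeff (Finsupp.single j 1) T)
    obtain ⟨j₀, hj₀, hmin⟩ := Finset.exists_min_image S (fun j => v (y j)) hS
    have hy : ∀ j ∈ S, v (coeff (Finsupp.single j 1) T) * s j (v (y j)) = v h := by
      intro j hj
      rw [← hτ.map_value, ← map_mul]
      simp only [y, RingEquiv.apply_symm_apply]
      rw [mul_div_cancel₀ _ (Finset.mem_filter.1 hj).2]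
    have hle : ∀ j, v (coeff (Finsupp.single j 1) T) * s j (v (y j₀)) ≤ v h := by
      intro j
      by_cases hj : j ∈ S
      · rw [← hy j hj]
        gcongr
        exact (hs j).monotone (hmin j hj)
      · have : coeff (Finsupp.single j 1) T = 0 := by
          by_contra h0
          refine hj (Finset.mem_filter.2 ⟨?_, h0⟩)
          by_contra hj'
          exact h0 (hvars j hj')
        rw [this]
        simp
    refine ⟨y j₀, ?_, fun a => ?_, hle, j₀, (Finset.mem_filter.1 hj₀).1, hy j₀ hj₀⟩
    · simp only [y]
      rw [Ne, EmbeddingLike.map_eq_zero_iff]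
      exact div_ne_zero hz0 (Finset.mem_filter.1 hj₀).2
    · obtain ⟨a', ha'⟩ := hc a
      refine lt_of_le_of_lt ?_ ha'
      by_contra! hlt
      obtain ⟨j, hj⟩ := H3 z hz a'
      have hκ : 0 < v (coeff (Finsupp.single j 1) T) := by
        rw [zero_lt_iff]
        intro h0
        rw [h0, zero_mul] at hj
        exact hz0 (v.zero_iff.1 (le_zero_iff.1 hj))
      have := mul_lt_mul_of_pos_left (hs j hlt) hκ
      exact absurd (hj.trans_lt this) (hle j).not_gt
  choose t ht0 htD htle hteq using H4
  have hmem : ∀ (z : {z // SameCut E v v c z}) (z' : L), v (z' - z.1) ≤ v (t z) →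
      SameCut E v v c z' := by
    intro z z' h
    refine sameCut_of_forall_lt fun a => ?_
    rw [show z' - c = (z' - z.1) + (z.1 - c) by ring]
    exact v.map_add_lt (h.trans_lt (htD z a)) (z.2.sub_lt hc a)
  have hhigh : ∀ (z : {z // SameCut E v v c z}) (j : J) (k : J →₀ ℕ), k ≠ 0 →
      v (coeff (k + Finsupp.single j 1) (taylor (fun j => τ j z.1) G)) *
        monomialValue s (k + Finsupp.single j 1) (v (t z)) < v (aeval (fun j => τ j z.1) G) := by
    intro z j k hk
    rw [H1 z.1 z.2 _ (by simp)]
    by_cases h0 : coeff (k + Finsupp.single j 1) T = 0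
    · rw [h0, map_zero, zero_mul]
      exact v.pos_iff.2 (hno z.1 z.2)
    · exact ((H2 _ (htD z a₀).le (ht0 z) j k hk).2 h0).trans_le (htle z j)
  have hsing : ∀ (z : {z // SameCut E v v c z}) (j : J),
      v (coeff (Finsupp.single j 1) (taylor (fun j => τ j z.1) G)) =
        v (coeff (Finsupp.single j 1) T) := fun z j => H1 z.1 z.2 _ (by simp)
  -- From every point `z` of the cut one step of Newton approximation leads to a better one.
  have H5 : ∀ z : {z // SameCut E v v c z}, ∃ z' : {z // SameCut E v v c z},
      v (z'.1 - z.1) ≤ v (t z) ∧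
      v (aeval (fun j => τ j z'.1) G) < v (aeval (fun j => τ j z.1) G) := by
    intro z
    obtain ⟨z', h1, h2⟩ := exists_valuation_aeval_lt hτ.map_value hs hlin G z.1 (t z)
      (hno z.1 z.2) (fun j => by rw [hsing]; exact htle z j)
      (by simpa only [hsing] using hteq z)
      (fun j hj => by rw [← v.zero_iff, hsing, hvars j hj, map_zero])
      (hhigh z)
    exact ⟨⟨z', hmem z z' h1⟩, h1, h2⟩
  have H6 : ∀ z z' : {z // SameCut E v v c z}, v (z'.1 - z.1) ≤ v (t z) →
      v (aeval (fun j => τ j z'.1) G) ≤ v (aeval (fun j => τ j z.1) G) := by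
    intro z z' h
    have h1 := valuation_aeval_sub_le hτ.map_value G z.1 (z'.1 - z.1)
      (g := v (aeval (fun j => τ j z.1) G)) (fun i hi => by
        have h2 : v (coeff i (taylor (fun j => τ j z.1) G)) * monomialValue s i (v (z'.1 - z.1)) ≤
            v (coeff i (taylor (fun j => τ j z.1) G)) * monomialValue s i (v (t z)) := by
          gcongr
          exact monomialValue_mono hs i h
        refine h2.trans ?_
        rcases exists_eq_single_or_split hi with ⟨j, rfl⟩ | ⟨j, k, hk, rfl⟩
        · rw [hsing, monomialValue_single]
          exact htle z j
        · exact (hhigh z j k hk).le)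
    rw [add_sub_cancel] at h1
    calc v (aeval (fun j => τ j z'.1) G)
        = v ((aeval (fun j => τ j z'.1) G - aeval (fun j => τ j z.1) G) +
          aeval (fun j => τ j z.1) G) := by rw [sub_add_cancel]
      _ ≤ _ := v.map_add_le h1 le_rfl
  have H7 : ∀ z z' : {z // SameCut E v v c z},
      v (aeval (fun j => τ j z'.1) G) ≤ v (aeval (fun j => τ j z.1) G) → v (t z') ≤ v (t z) := by
    intro z z' h
    by_contra! hlt
    obtain ⟨j, -, hj⟩ := hteq z
    have hκ : 0 < v (coeff (Finsupp.single j 1) T) := by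
      rw [zero_lt_iff]
      intro h0
      rw [h0, zero_mul] at hj
      exact hno z.1 z.2 (v.zero_iff.1 hj.symm)
    have h1 := mul_lt_mul_of_pos_left (hs j hlt) hκ
    rw [hj] at h1
    exact absurd (h1.trans_le (htle z' j)) h.not_gt
  -- Zorn's lemma for the balls with centre `z` and radius `v (t z)`, ordered by inclusion. As a better
  -- point has a smaller scale, a chain of balls is nested, and a common point is an upper bound. A
  -- maximal point contradicts `H5`.
  obtain ⟨m, hm⟩ := exists_maximal_of_chains_bounded
    (r := fun z z' : {z // SameCut E v v c z} => v (z'.1 - z.1) ≤ v (t z) ∧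
      v (aeval (fun j => τ j z'.1) G) ≤ v (aeval (fun j => τ j z.1) G)) (by
    intro A hA
    rcases A.eq_empty_or_nonempty with rfl | ⟨z₀, hz₀⟩
    · exact ⟨⟨c, SameCut.refl c⟩, by simp⟩
    obtain ⟨x, hx⟩ := hsc ((fun z : {z // SameCut E v v c z} => (z.1, t z)) '' A) (by
      rintro _ ⟨z, hz, rfl⟩ _ ⟨z', hz', rfl⟩
      rcases eq_or_ne z z' with rfl | hne
      · simp
      rcases hA hz hz' hne with h | h
      · rw [v.map_sub_swap]
        exact h.1.trans (le_max_left _ _)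
      · exact h.1.trans (le_max_right _ _))
    have hx' : ∀ z ∈ A, v (x - z.1) ≤ v (t z) := fun z hz => hx _ ⟨z, hz, rfl⟩
    exact ⟨⟨x, hmem z₀ x (hx' z₀ hz₀)⟩, fun z hz => ⟨hx' z hz, H6 z _ (hx' z hz)⟩⟩) (by
    rintro z z' z'' ⟨h1, h2⟩ ⟨h3, h4⟩
    refine ⟨?_, h4.trans h2⟩
    rw [show z''.1 - z.1 = (z''.1 - z'.1) + (z'.1 - z.1) by ring]
    exact v.map_add_le (h3.trans (H7 _ _ h2)) h1)
  obtain ⟨z', h1, h2⟩ := H5 m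
  exact absurd (hm z' ⟨h1, h2.le⟩).2 h2.not_ge

end Hensel

/-! ### Extending partial isomorphisms -/

section Embedding

variable {Γ : Type*} [LinearOrderedCommGroupWithZero Γ] {J : Type*}
variable {E L L₁ L₂ : Type*} [Field E] [Field L] [Field L₁] [Field L₂] [Algebra E L]
  [Algebra E L₁] [Algebra E L₂] {v : Valuation L Γ} {v₁ : Valuation L₁ Γ} {v₂ : Valuation L₂ Γ}

open IntermediateField IntermediateField.algebraAdjoinAdjoin in
/-- Two tuples at which all polynomials over `E` take the same values generate isomorphic valued
extensions of `E`. -/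
theorem exists_algHom_adjoin_range (p : J → L₁) (q : J → L₂)
    (h : ∀ F : MvPolynomial J E, v₁ (aeval p F) = v₂ (aeval q F)) :
    ∃ f : adjoin E (Set.range p) →ₐ[E] L₂,
      (∀ j, f ⟨p j, subset_adjoin E _ ⟨j, rfl⟩⟩ = q j) ∧ ∀ x, v₂ (f x) = v₁ x := by
  let A := Algebra.adjoin E (Set.range p)
  have hAr : A = (aeval p).range := Algebra.adjoin_range_eq_range_aeval E p
  have hA : ∀ F : MvPolynomial J E, aeval p F ∈ A := fun F => by
    rw [hAr]
    exact ⟨F, rfl⟩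
  let φ : MvPolynomial J E →ₐ[E] A := (aeval p).codRestrict A hA
  have hφ : Function.Surjective φ := by
    rintro ⟨x, hx⟩
    have hx' := hx
    rw [hAr] at hx'
    obtain ⟨F, rfl⟩ := hx'
    exact ⟨F, rfl⟩
  have hφv : ∀ F, (φ F : L₁) = aeval p F := fun F => rfl
  let g : A →ₐ[E] L₂ := AlgHom.liftOfSurjective φ hφ (aeval q) (by
    intro F hF
    have h0 : φ F = 0 := hF
    have h1 : aeval p F = 0 := by rw [← hφv, h0]; rfl
    change aeval q F = 0
    rw [← v₂.zero_iff, ← h, h1, map_zero])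
  have hg : ∀ F, g (φ F) = aeval q F := AlgHom.liftOfSurjective_apply _ _ _ _
  have hgv : ∀ x : A, v₂ (g x) = v₁ x := by
    intro x
    obtain ⟨F, rfl⟩ := hφ x
    rw [hg, hφv, h]
  have hinj : Function.Injective g := by
    rw [injective_iff_map_eq_zero]
    intro x hx
    have := hgv x
    rw [hx, map_zero] at this
    exact Subtype.ext (v₁.zero_iff.1 this.symm)
  -- The map preserves values, so it is injective and extends to the field of fractions.
  let f : adjoin E (Set.range p) →ₐ[E] L₂ := IsFractionRing.liftAlgHom (A := A) (g := g) hinj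
  have hf : ∀ x : A, f (algebraMap A _ x) = g x := fun x => by
    simp [f, IsFractionRing.liftAlgHom_apply, IsFractionRing.lift_algebraMap]
  refine ⟨f, fun j => ?_, fun x => ?_⟩
  · have h1 : (⟨p j, subset_adjoin E _ ⟨j, rfl⟩⟩ : adjoin E (Set.range p)) =
        algebraMap A _ (φ (X j)) := by
      apply Subtype.ext
      change p j = (φ (X j) : L₁)
      rw [hφv, aeval_X]
    rw [h1, hf, hg, aeval_X]
  · obtain ⟨x, y, -, rfl⟩ := IsFractionRing.div_surjective (A := A) x
    have hcoe : ∀ x : A, ((algebraMap A (adjoin E (Set.range p)) x : _) : L₁) = x := fun _ => rfl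
    rw [map_div₀, map_div₀, hf, hf, hgv, hgv, ← hcoe, ← hcoe, ← map_div₀]
    rfl

section Zorn

variable {ι : Type*}

/-- A partial isomorphism over `E` that preserves the valuations, and whose domain is invariant
under the automorphisms `σ₁ i` of `L₁`, which it carries to the automorphisms `σ₂ i` of `L₂`. -/
structure IsValuedLift (v₁ : Valuation L₁ Γ) (v₂ : Valuation L₂ Γ) (σ₁ : ι → L₁ ≃+* L₁)
    (σ₂ : ι → L₂ ≃+* L₂) (D : Subfield L₁) (f : D →+* L₂) : Prop where
  map_value : ∀ x, v₂ (f x) = v₁ x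
  mem_iff : ∀ i x, σ₁ i x ∈ D ↔ x ∈ D
  commutes : ∀ i (x : D) (hx : σ₁ i x ∈ D), f ⟨σ₁ i x, hx⟩ = σ₂ i (f x)

/-- If every partial isomorphism that is not everywhere defined can be extended, then there is an
embedding of `L₁` into `L₂` over `E`. -/
theorem exists_algHom_of_extend (σE : ι → E ≃+* E) (σ₁ : ι → L₁ ≃+* L₁) (σ₂ : ι → L₂ ≃+* L₂)
    (hσ₁ : ∀ i a, σ₁ i (algebraMap E L₁ a) = algebraMap E L₁ (σE i a))
    (hσ₂ : ∀ i a, σ₂ i (algebraMap E L₂ a) = algebraMap E L₂ (σE i a))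
    (hE : ∀ a : E, v₁ (algebraMap E L₁ a) = v₂ (algebraMap E L₂ a))
    (hstep : ∀ (F : IntermediateField E L₁) (g : F →ₐ[E] L₂),
      IsValuedLift v₁ v₂ σ₁ σ₂ F.toSubfield g.toRingHom → F ≠ ⊤ →
      ∃ (D : Subfield L₁) (f : D →+* L₂) (hD : F.toSubfield ≤ D),
        IsValuedLift v₁ v₂ σ₁ σ₂ D f ∧ D ≠ F.toSubfield ∧ ∀ x : F, f ⟨x, hD x.2⟩ = g x) :
    ∃ f : L₁ →ₐ[E] L₂, (∀ x, v₂ (f x) = v₁ x) ∧ ∀ i x, f (σ₁ i x) = σ₂ i (f x) := by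
  obtain ⟨m, -, hm, hmax⟩ := zorn_le_nonempty₀
    {ℓ : IntermediateField.Lifts E L₁ L₂ |
      IsValuedLift v₁ v₂ σ₁ σ₂ ℓ.carrier.toSubfield ℓ.emb.toRingHom} (by
    intro c hcs hc y hy
    have hle := IntermediateField.Lifts.le_union c hc
    refine ⟨IntermediateField.Lifts.union c hc, ?_, fun z hz => hle hz⟩
    have hdir : Directed (· ≤ ·) fun i : c => i.1.carrier :=
      hc.directedOn.directed_val.mono_comp _ fun _ _ h => h.1
    have : Nonempty c := ⟨⟨y, hy⟩⟩
    have hmem : ∀ x, x ∈ (IntermediateField.Lifts.union c hc).carrier ↔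
        ∃ ℓ ∈ c, x ∈ ℓ.carrier := by
      intro x
      rw [IntermediateField.Lifts.carrier_union, ← SetLike.mem_coe,
        IntermediateField.coe_iSup_of_directed hdir]
      simp
    have hval : ∀ ℓ ∈ c, ∀ (x : L₁) (hx : x ∈ ℓ.carrier)
        (hx' : x ∈ (IntermediateField.Lifts.union c hc).carrier),
        (IntermediateField.Lifts.union c hc).emb ⟨x, hx'⟩ = ℓ.emb ⟨x, hx⟩ :=
      fun ℓ hℓ x hx hx' => (hle hℓ).2 ⟨x, hx⟩
    refine ⟨?_, ?_, ?_⟩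
    · rintro ⟨x, hx⟩
      obtain ⟨ℓ, hℓ, hxℓ⟩ := (hmem x).1 hx
      have := (hcs hℓ).map_value ⟨x, hxℓ⟩
      exact (congrArg v₂ (hval ℓ hℓ x hxℓ hx)).trans this
    · intro i x
      change σ₁ i x ∈ (IntermediateField.Lifts.union c hc).carrier ↔
        x ∈ (IntermediateField.Lifts.union c hc).carrier
      rw [hmem, hmem]
      exact exists_congr fun ℓ => and_congr_right fun hℓ => (hcs hℓ).mem_iff i x
    · rintro i ⟨x, hx⟩ hx'
      obtain ⟨ℓ, hℓ, hxℓ⟩ := (hmem x).1 hx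
      have hxℓ' := ((hcs hℓ).mem_iff i x).2 hxℓ
      have h1 := (hcs hℓ).commutes i ⟨x, hxℓ⟩ hxℓ'
      exact (hval ℓ hℓ _ hxℓ' hx').trans (h1.trans (congrArg (σ₂ i) (hval ℓ hℓ x hxℓ hx).symm)))
    ⊥ (by
      have hbot : ∀ x : (⊥ : IntermediateField.Lifts E L₁ L₂).carrier, ∃ a : E,
          x = algebraMap E _ a := by
        rintro ⟨x, hx⟩
        obtain ⟨a, rfl⟩ := IntermediateField.mem_bot.1 hx
        exact ⟨a, rfl⟩
      have hemb : ∀ (a : E) (h : algebraMap E L₁ a ∈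
          (⊥ : IntermediateField.Lifts E L₁ L₂).carrier),
          (⊥ : IntermediateField.Lifts E L₁ L₂).emb ⟨algebraMap E L₁ a, h⟩ = algebraMap E L₂ a :=
        fun a h => (⊥ : IntermediateField.Lifts E L₁ L₂).emb.commutes a
      refine ⟨?_, ?_, ?_⟩
      · intro x
        obtain ⟨a, rfl⟩ := hbot x
        exact (congrArg v₂ (hemb a _)).trans (hE a).symm
      · intro i x
        change σ₁ i x ∈ (⊥ : IntermediateField E L₁) ↔ x ∈ (⊥ : IntermediateField E L₁)
        rw [IntermediateField.mem_bot, IntermediateField.mem_bot]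
        constructor
        · rintro ⟨a, ha⟩
          refine ⟨(σE i).symm a, (σ₁ i).injective ?_⟩
          rw [hσ₁, RingEquiv.apply_symm_apply, ha]
        · rintro ⟨a, rfl⟩
          exact ⟨_, (hσ₁ i a).symm⟩
      · intro i x hx
        obtain ⟨a, rfl⟩ := hbot x
        have h1 : (⟨σ₁ i (algebraMap E L₁ a), hx⟩ :
            (⊥ : IntermediateField.Lifts E L₁ L₂).carrier.toSubfield) =
            ⟨algebraMap E L₁ (σE i a), by rw [← hσ₁]; exact hx⟩ := Subtype.ext (hσ₁ i a)
        refine (congrArg _ h1).trans ((hemb _ _).trans ?_)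
        rw [← hσ₂]
        exact congrArg (σ₂ i) (hemb a _).symm)
  -- A maximal partial isomorphism is defined on all of `L₁`.
  have htop : m.carrier = ⊤ := by
    by_contra hne
    obtain ⟨D, f, hD, hf, hne', hfg⟩ := hstep m.carrier m.emb hm hne
    have halg : ∀ a : E, algebraMap E L₁ a ∈ D := fun a => hD (m.carrier.algebraMap_mem a)
    let D' : IntermediateField E L₁ := D.toIntermediateField halg
    let f' : D' →ₐ[E] L₂ := { f with
      commutes' := fun a => (hfg (algebraMap E _ a)).trans (m.emb.commutes a) }
    have hle : m ≤ (⟨D', f'⟩ : IntermediateField.Lifts E L₁ L₂) := ⟨hD, hfg⟩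
    have h2 := hmax (y := ⟨D', f'⟩) hf hle
    apply hne'
    exact le_antisymm h2.1 hD
  let e : L₁ →ₐ[E] L₂ := m.emb.comp
    ((IntermediateField.equivOfEq htop).symm.toAlgHom.comp
      (IntermediateField.topEquiv (F := E) (E := L₁)).symm.toAlgHom)
  have hmem : ∀ x, x ∈ m.carrier := fun x => htop ▸ IntermediateField.mem_top
  have he : ∀ x, e x = m.emb ⟨x, hmem x⟩ := fun x => rfl
  refine ⟨e, fun x => ?_, fun i x => ?_⟩
  · rw [he]
    exact hm.map_value ⟨x, hmem x⟩
  · rw [he, he]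
    exact hm.commutes i ⟨x, hmem x⟩ (hmem _)

end Zorn

end Embedding

/-! ### Kaplansky's uniqueness theorem -/

section Pure

variable {Γ : Type*} [LinearOrderedCommGroupWithZero Γ] {J : Type*}
variable {E L L₁ L₂ : Type*} [Field E] [Field L] [Field L₁] [Field L₂] [Algebra E L]
  [Algebra E L₁] [Algebra E L₂] {v : Valuation L Γ} {v₁ : Valuation L₁ Γ} {v₂ : Valuation L₂ Γ}

/-- Among the nonzero polynomials of a class closed under derivation that are not stable at `b`,
take one of minimal degree: the polynomials of the class of smaller degree are then stable at `b`,
and its derivatives are among them. -/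
theorem exists_minimal_not_isStableAt [Nonempty J] {s : J → Γ → Γ} {τ : J → L ≃+* L} {b : L}
    {𝒮 : Set (MvPolynomial J E)} (h𝒮 : ∀ G ∈ 𝒮, ∀ j, pderiv j G ∈ 𝒮)
    (h : ∃ G ∈ 𝒮, G ≠ 0 ∧ ¬ IsStableAt s τ v b G) :
    ∃ G ∈ 𝒮, G ≠ 0 ∧ ¬ IsStableAt s τ v b G ∧ G.totalDegree ≠ 0 ∧
      (∀ H ∈ {H ∈ 𝒮 | H.totalDegree < G.totalDegree}, ∀ j,
        pderiv j H ∈ {H ∈ 𝒮 | H.totalDegree < G.totalDegree}) ∧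
      (∀ H ∈ {H ∈ 𝒮 | H.totalDegree < G.totalDegree}, H ≠ 0 → IsStableAt s τ v b H) ∧
      ∀ j, pderiv j G ∈ {H ∈ 𝒮 | H.totalDegree < G.totalDegree} := by
  classical
  obtain ⟨G, ⟨hG𝒮, hG0, hGs⟩, hmin⟩ := exists_minimalFor_of_wellFoundedLT
    (fun G => G ∈ 𝒮 ∧ G ≠ 0 ∧ ¬ IsStableAt s τ v b G) MvPolynomial.totalDegree
    (by obtain ⟨G, h1, h2, h3⟩ := h; exact ⟨G, h1, h2, h3⟩)
  have hdeg : G.totalDegree ≠ 0 := by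
    intro h0
    rw [totalDegree_eq_zero_iff_eq_C] at h0
    rw [h0] at hGs hG0
    exact hGs (isStableAt_C (by rintro h; exact hG0 (by rw [h, C_0])))
  refine ⟨G, hG𝒮, hG0, hGs, hdeg, ?_, ?_, fun j => ⟨h𝒮 G hG𝒮 j, totalDegree_pderiv_lt hdeg j⟩⟩
  · rintro H ⟨h1, h2⟩ j
    refine ⟨h𝒮 H h1 j, ?_⟩
    by_cases h0 : H.totalDegree = 0
    · rw [pderiv_eq_zero_of_totalDegree_eq_zero h0, totalDegree_zero]
      exact Nat.pos_of_ne_zero hdeg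
    · exact (totalDegree_pderiv_lt h0 j).trans h2
  · rintro H ⟨h1, h2⟩ h3
    by_contra h4
    exact absurd (hmin ⟨h1, h3, h4⟩ h2.le) h2.not_ge

theorem totalDegree_eq_natDegree (P : MvPolynomial Unit E) :
    P.totalDegree = (uniqueAlgEquiv E Unit P).natDegree := by
  have hsum : ∀ m : Unit →₀ ℕ, (m.sum fun _ e => e) = m default := fun m => by
    rw [Finsupp.unique_single m, Finsupp.sum_single_index rfl]
    simp
  apply le_antisymm
  · refine Finset.sup_le fun m hm => ?_
    rw [hsum]
    apply Polynomial.le_natDegree_of_ne_zero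
    rw [coeff_uniqueAlgEquiv, ← Finsupp.unique_single m]
    exact mem_support_iff.1 hm
  · by_cases hP : uniqueAlgEquiv E Unit P = 0
    · simp [hP]
    have h := Polynomial.leadingCoeff_ne_zero.2 hP
    rw [Polynomial.leadingCoeff, coeff_uniqueAlgEquiv] at h
    have h1 := le_totalDegree (mem_support_iff.2 h)
    rw [hsum] at h1
    simpa using h1

/-- Division with remainder by a nonconstant polynomial in one variable. -/
theorem exists_division (G F : MvPolynomial Unit E) (hG : G.totalDegree ≠ 0) :
    ∃ Q R, F = Q * G + R ∧ R.totalDegree < G.totalDegree := by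
  let e := uniqueAlgEquiv E Unit
  have hG0 : e G ≠ 0 := by
    intro h
    rw [totalDegree_eq_natDegree] at hG
    exact hG (by rw [show uniqueAlgEquiv E Unit G = 0 from h, Polynomial.natDegree_zero])
  refine ⟨e.symm (e F / e G), e.symm (e F % e G), ?_, ?_⟩
  · apply e.injective
    rw [map_add, map_mul, AlgEquiv.apply_symm_apply, AlgEquiv.apply_symm_apply, mul_comm]
    exact (EuclideanDomain.div_add_mod _ _).symm
  · rw [totalDegree_eq_natDegree, totalDegree_eq_natDegree]
    change (e (e.symm _)).natDegree < (e G).natDegree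
    rw [AlgEquiv.apply_symm_apply]
    refine Polynomial.natDegree_mod_lt _ ?_
    rwa [totalDegree_eq_natDegree] at hG

/-- The trivial action of `Unit`, under which polynomials in the variables `τ j x` are the ordinary
polynomials in one variable. -/
theorem isValuedAction_unit : IsValuedAction (E := E) (fun (_ : Unit) (γ : Γ) => γ)
    (fun _ a => a) v (fun _ => RingEquiv.refl L) :=
  ⟨fun _ _ => rfl, fun _ _ => rfl⟩

theorem strictMono_unit : ∀ _ : Unit, StrictMono (fun γ : Γ => γ) := fun _ => strictMono_id

/-- Stability of ordinary polynomials in one variable. -/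
abbrev IsStable (v : Valuation L Γ) (b : L) (G : MvPolynomial Unit E) : Prop :=
  IsStableAt (fun (_ : Unit) (γ : Γ) => γ) (fun _ => RingEquiv.refl L) v b G

/-- A limit over `E`, together with an embedding into `L₂` of an extension of `E` that contains a
realization of its cut. -/
theorem exists_extension_of_isLimitOver (hv₁ : ∀ n : ℕ, n ≠ 0 → v₁ n = 1)
    (hv₂ : ∀ n : ℕ, n ≠ 0 → v₂ n = 1)
    (hE : ∀ a : E, v₁ (algebraMap E L₁ a) = v₂ (algebraMap E L₂ a))
    (hsc₁ : SphericallyComplete v₁) (hsc₂ : SphericallyComplete v₂) {b : L₁}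
    (hb : IsLimitOver E v₁ b) :
    ∃ (D : IntermediateField E L₁) (f : D →ₐ[E] L₂),
      (∃ x ∈ D, SameCut E v₁ v₁ b x) ∧ ∀ x, v₂ (f x) = v₁ x := by
  suffices ∃ (b' : L₁) (c' : L₂), SameCut E v₁ v₁ b b' ∧ ∀ F : MvPolynomial Unit E,
      v₁ (aeval (fun _ => b') F) = v₂ (aeval (fun _ => c') F) by
    obtain ⟨b', c', hbb', h⟩ := this
    obtain ⟨f, -, hf⟩ := exists_algHom_adjoin_range _ _ h
    exact ⟨_, f, ⟨b', IntermediateField.subset_adjoin _ _ ⟨(), rfl⟩, hbb'⟩, hf⟩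
  have hτ₁ := isValuedAction_unit (E := E) (v := v₁)
  have hτ₂ := isValuedAction_unit (E := E) (v := v₂)
  obtain ⟨c, hc⟩ := hsc₂.exists_sameCut hE hb
  by_cases hall : ∀ G : MvPolynomial Unit E, G ≠ 0 → IsStable v₁ b G
  · exact ⟨b, c, SameCut.refl b, fun F => aeval_eq_of_sameCut hv₁ hv₂ hτ₁ hτ₂ hE hc
      (𝒞 := Set.univ) (fun _ _ _ => trivial) (fun G _ => hall G) F trivial⟩
  push Not at hall
  obtain ⟨G, -, hG0, hGs, hdeg, h𝒞, hst, hder⟩ := exists_minimal_not_isStableAt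
    (E := E) (𝒮 := Set.univ) (fun _ _ _ => trivial)
    (by obtain ⟨G, h1, h2⟩ := hall; exact ⟨G, trivial, h1, h2⟩)
  have hst₂ := fun H hH hH0 => (isStableAt_iff_of_sameCut hv₁ hv₂ hτ₁ hτ₂ hE hc h𝒞 hst H
    (h𝒞 H hH)).1 (hst H hH hH0)
  have hGs₂ := (isStableAt_iff_of_sameCut hv₁ hv₂ hτ₁ hτ₂ hE hc h𝒞 hst G hder).not.1 hGs
  obtain ⟨b', hb', hGb'⟩ := exists_zero_of_not_isStableAt hv₁ hτ₁ strictMono_unit hsc₁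
    (IsLinearlyClosed.of_unit v₁) hb h𝒞 hst hder hGs
  obtain ⟨c', hc', hGc'⟩ := exists_zero_of_not_isStableAt hv₂ hτ₂ strictMono_unit hsc₂
    (IsLinearlyClosed.of_unit v₂) (hc.isLimitOver hb) h𝒞 hst₂ hder hGs₂
  refine ⟨b', c', hb', fun F => ?_⟩
  -- Modulo `G`, which vanishes at both points, `F` is a polynomial of smaller degree, hence stable.
  obtain ⟨Q, R, rfl, hR⟩ := exists_division G F hdeg
  have hGb : aeval (fun _ => b') G = 0 := hGb'
  have hGc : aeval (fun _ => c') G = 0 := hGc'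
  have hb0 : aeval (fun _ => b') (Q * G + R) = aeval (fun _ => b') R := by simp [hGb]
  have hc0 : aeval (fun _ => c') (Q * G + R) = aeval (fun _ => c') R := by simp [hGc]
  rw [hb0, hc0]
  have h1 := aeval_eq_of_sameCut hv₁ hv₁ hτ₁ hτ₁ (fun _ => rfl) hb' h𝒞 hst R ⟨trivial, hR⟩
  have h2 := aeval_eq_of_sameCut hv₁ hv₂ hτ₁ hτ₂ hE (hc.trans hc') h𝒞 hst R ⟨trivial, hR⟩
  exact h1.symm.trans h2

/-- An immediate extension of `E` is an immediate extension of every field between. -/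
theorem IsImmediateOver.tower {F : Type*} [Field F] [Algebra F L] (h : IsImmediateOver E v)
    (hEF : ∀ a : E, ∃ x : F, algebraMap F L x = algebraMap E L a) : IsImmediateOver F v := by
  intro b hb
  obtain ⟨a, ha⟩ := h b hb
  obtain ⟨x, hx⟩ := hEF a
  exact ⟨x, by rwa [hx]⟩

theorem surjective_of_sphericallyComplete (f : L₁ →ₐ[E] L₂) (hf : ∀ x, v₂ (f x) = v₁ x)
    (hsc₁ : SphericallyComplete v₁) (himm₂ : IsImmediateOver E v₂) : Function.Surjective f := by
  let _ := f.toRingHom.toAlgebra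
  exact hsc₁.surjective_of_isImmediateOver (v := v₂) (fun a => (hf a).symm)
    (himm₂.tower fun a => ⟨algebraMap E L₁ a, f.commutes a⟩)

/-- Kaplansky's uniqueness theorem in residue characteristic zero: spherically complete immediate
extensions of a valued field are isomorphic. -/
theorem exists_algEquiv_of_sphericallyComplete (hv₁ : ∀ n : ℕ, n ≠ 0 → v₁ n = 1)
    (hv₂ : ∀ n : ℕ, n ≠ 0 → v₂ n = 1)
    (hE : ∀ a : E, v₁ (algebraMap E L₁ a) = v₂ (algebraMap E L₂ a))
    (himm₁ : IsImmediateOver E v₁) (himm₂ : IsImmediateOver E v₂)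
    (hsc₁ : SphericallyComplete v₁) (hsc₂ : SphericallyComplete v₂) :
    ∃ f : L₁ ≃ₐ[E] L₂, ∀ x, v₂ (f x) = v₁ x := by
  obtain ⟨f, hf, -⟩ := exists_algHom_of_extend (E := E) (v₁ := v₁) (v₂ := v₂)
    (ι := Empty) (fun i => i.elim) (fun i => i.elim) (fun i => i.elim) (fun i => i.elim)
    (fun i => i.elim) hE (by
    intro F g hg hF
    let _ := g.toRingHom.toAlgebra
    obtain ⟨b, hb⟩ : ∃ b, b ∉ F := by
      by_contra! h
      exact hF (eq_top_iff.2 fun x _ => h x)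
    have hlim : IsLimitOver F v₁ b :=
      (himm₁.tower fun a => ⟨algebraMap E F a, rfl⟩).isLimitOver fun a ha => hb (ha ▸ a.2)
    obtain ⟨D, f, ⟨x, hxD, hx⟩, hf⟩ := exists_extension_of_isLimitOver (E := F) hv₁ hv₂
      (fun a => (hg.map_value a).symm) hsc₁ hsc₂ hlim
    refine ⟨D.toSubfield, f.toRingHom, fun a ha => D.algebraMap_mem ⟨a, ha⟩,
      ⟨hf, fun i => i.elim, fun i => i.elim⟩, ?_, fun a => f.commutes a⟩
    intro h
    have hxF : x ∈ F := by
      rw [← IntermediateField.mem_toSubfield, ← h]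
      exact hxD
    exact (hx.isLimitOver hlim).notMem ⟨x, hxF⟩ rfl)
  exact ⟨AlgEquiv.ofBijective f ⟨f.injective, surjective_of_sphericallyComplete f hf hsc₁ himm₂⟩, hf⟩

end Pure

/-! ### Uniqueness of zeros in a cut -/

section Unique

variable {Γ : Type*} [LinearOrderedCommGroupWithZero Γ] {J : Type*}
variable {E L L₁ L₂ : Type*} [Field E] [Field L] [Field L₁] [Field L₂] [Algebra E L]
  [Algebra E L₁] [Algebra E L₂] {v : Valuation L Γ} {v₁ : Valuation L₁ Γ} {v₂ : Valuation L₂ Γ}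

theorem pderiv_ne_zero_of_mem_vars [CharZero E] {G : MvPolynomial J E} {j : J} (hj : j ∈ G.vars) :
    pderiv j G ≠ 0 := by
  classical
  obtain ⟨m, hm, hjm⟩ := (mem_vars_iff_mem_support j).1 hj
  rw [Finsupp.mem_support_iff] at hjm
  intro h
  have h1 := congrArg (coeff (m - Finsupp.single j 1)) h
  rw [coeff_pderiv, coeff_zero, tsub_add_cancel_of_le] at h1
  · have h2 : (((m - Finsupp.single j 1 : J →₀ ℕ) j : ℕ) : E) + 1 ≠ 0 := by
      exact Nat.cast_add_one_ne_zero _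
    exact (mul_ne_zero (mem_support_iff.1 hm) h2) h1
  · rw [Finsupp.single_le_iff]
    exact Nat.one_le_iff_ne_zero.2 hjm

/-- If the linear term in the variable `X j` dominates the higher powers of `X j` at `h`, then a
polynomial without constant term has no zero of the form `(0, …, h, …, 0)`. -/
theorem eval_single_ne_zero [DecidableEq J] (T : MvPolynomial J L) (j : J) {h : L} (hh : h ≠ 0)
    (h0 : coeff 0 T = 0)
    (hdom : ∀ m ≠ 0, v (coeff (Finsupp.single j m + Finsupp.single j 1) T) * v h ^ m <
      v (coeff (Finsupp.single j 1) T)) :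
    eval (Pi.single j h) T ≠ 0 := by
  intro hev
  set c := coeff (Finsupp.single j 1) T with hc
  have hcpos : 0 < v c := zero_le.trans_lt (hdom 1 one_ne_zero)
  have hch : v (c * h) ≠ 0 := by
    rw [map_mul]
    exact mul_ne_zero hcpos.ne' (v.ne_zero_iff.2 hh)
  have hlt : v (eval (Pi.single j h) (T - monomial (Finsupp.single j 1) c)) < v (c * h) := by
    rw [eval_eq]
    refine v.map_sum_lt hch fun i _ => ?_
    by_cases hi : ∃ k ≠ j, i k ≠ 0
    · obtain ⟨k, hk, hik⟩ := hi
      rw [Finset.prod_eq_zero (Finsupp.mem_support_iff.2 hik) (by simp [hk, hik]), mul_zero,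
        map_zero]
      exact zero_lt_iff.2 hch
    push Not at hi
    have hi' : i = Finsupp.single j (i j) := by
      ext k
      by_cases hk : k = j
      · simp [hk]
      · simp [hi k hk, Ne.symm hk]
    obtain ⟨m, rfl⟩ : ∃ m, i = Finsupp.single j m := ⟨_, hi'⟩
    rw [coeff_sub, coeff_monomial]
    rcases m with _ | _ | m
    · rw [Finsupp.single_zero, h0, if_neg (by simp)]
      simpa using zero_lt_iff.2 hch
    · rw [if_pos (by simp), ← hc]
      simpa using zero_lt_iff.2 hch
    · have hne : Finsupp.single j 1 ≠ Finsupp.single j (m + 1 + 1) := fun h' => by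
        have := Finsupp.single_injective j h'
        omega
      rw [if_neg hne, sub_zero, Finsupp.support_single _ (by omega),
        Finset.prod_singleton]
      have h1 := mul_lt_mul_of_pos_right (hdom (m + 1) (by omega)) (v.pos_iff.2 hh)
      rw [← Finsupp.single_add] at h1
      simpa [pow_succ, mul_assoc] using h1
  rw [map_sub, hev, zero_sub, v.map_neg, eval_monomial] at hlt
  simp at hlt

/-- If the derivatives of `G` are stable and `G` depends on the variable `X j`, then a zero of `G` on
the cut of `b` cannot be changed to another zero by moving its `j`-th entry by a small `h`: the
linear term of the Taylor expansion dominates. -/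
theorem eq_zero_of_isStableAt [Nonempty J] [DecidableEq J] {s : J → Γ → Γ} {τE : J → E → E}
    {τ₁ : J → L₁ ≃+* L₁} {τ₂ : J → L₂ ≃+* L₂}
    (hv₁ : ∀ n : ℕ, n ≠ 0 → v₁ n = 1)
    (hv₂ : ∀ n : ℕ, n ≠ 0 → v₂ n = 1) (hs : ∀ j, StrictMono (s j))
    (hτ₁ : IsValuedAction s τE v₁ τ₁) (hτ₂ : IsValuedAction s τE v₂ τ₂)
    (hE : ∀ a : E, v₁ (algebraMap E L₁ a) = v₂ (algebraMap E L₂ a))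
    {b : L₁} {z : L₂} (hbz : SameCut E v₁ v₂ b z) {𝒞 : Set (MvPolynomial J E)}
    (h𝒞 : ∀ G ∈ 𝒞, ∀ j, pderiv j G ∈ 𝒞) (hst : ∀ G ∈ 𝒞, G ≠ 0 → IsStableAt s τ₁ v₁ b G)
    {G : MvPolynomial J E} (hG : ∀ j, pderiv j G ∈ 𝒞) {j : J} (hj : pderiv j G ≠ 0)
    (hz : aeval (fun j => τ₂ j z) G = 0) {h : L₂}
    (hh : ∀ a : E, v₂ h ≤ s j (v₁ (b - algebraMap E L₁ a)))
    (hzh : aeval ((fun j => τ₂ j z) + Pi.single j h) G = 0) : h = 0 := by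
  by_contra h0
  obtain ⟨a, ha⟩ := exists_linear_dominance hv₁ hs fun j hj => hst _ (hG j) hj
  have hco : ∀ i ≠ 0, v₁ (coeff i (taylor (fun j => τ₁ j b) G)) =
      v₂ (coeff i (taylor (fun j => τ₂ j z) G)) :=
    coeff_eq_of_pderiv hv₁ hv₂ fun j k =>
      coeff_taylor_eq_of_sameCut hv₁ hv₂ hτ₁ hτ₂ hE hbz h𝒞 hst _ (hG j) k
  refine eval_single_ne_zero (v := v₂) (taylor (fun j => τ₂ j z) G) j h0
    (by rw [coeff_zero_taylor, hz]) (fun m hm => ?_) (by rw [eval_taylor, hzh])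
  have h1 := ha a le_rfl j hj (Finsupp.single j m) (by simpa using hm)
  rw [hco _ (by simp), hco _ (by simp)] at h1
  refine lt_of_le_of_lt ?_ h1
  have h2 : monomialValue s (Finsupp.single j m) (v₁ (b - algebraMap E L₁ a)) =
      s j (v₁ (b - algebraMap E L₁ a)) ^ m := by
    simp [monomialValue]
  rw [h2]
  gcongr
  exact hh a

theorem aeval_uniqueAlgEquiv_symm (P : Polynomial E) (x : L) :
    aeval (fun _ => x) ((uniqueAlgEquiv E Unit).symm P) = Polynomial.aeval x P := by
  have : ((aeval (fun _ => x)).comp (uniqueAlgEquiv E Unit).symm.toAlgHom :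
      Polynomial E →ₐ[E] L) = Polynomial.aeval x := by
    ext
    have h1 : (uniqueAlgEquiv E Unit).symm Polynomial.X = X () := by
      rw [AlgEquiv.symm_apply_eq]
      rw [X, uniqueAlgEquiv_monomial]
      simp [Polynomial.monomial_one_one_eq_X]
    change aeval (fun _ => x) ((uniqueAlgEquiv E Unit).symm Polynomial.X) = _
    rw [h1, aeval_X, Polynomial.aeval_X]
  exact DFunLike.congr_fun this P

theorem charZero_of_valuation (hv : ∀ n : ℕ, n ≠ 0 → v n = 1) : CharZero L := by
  refine charZero_of_inj_zero fun n hn => ?_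
  by_contra h
  have := hv n h
  rw [hn, map_zero] at this
  exact zero_ne_one this

end Unique

section Agree

variable {Γ : Type*} [LinearOrderedCommGroupWithZero Γ] {E L₁ L₂ : Type*} [Field E] [Field L₁]
  [Field L₂] [Algebra E L₁] {v₁ : Valuation L₁ Γ} {v₂ : Valuation L₂ Γ}

/-- Two embeddings of valued fields that agree on a subfield `E` agree on the elements algebraic
over `E`, if the domain is a spherically complete immediate extension of `E`. -/
theorem eq_of_isAlgebraic (hv₁ : ∀ n : ℕ, n ≠ 0 → v₁ n = 1) (himm : IsImmediateOver E v₁)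
    (hsc : SphericallyComplete v₁) (f g : L₁ →+* L₂) (hf : ∀ x, v₂ (f x) = v₁ x)
    (hg : ∀ x, v₂ (g x) = v₁ x) (hfg : ∀ a, f (algebraMap E L₁ a) = g (algebraMap E L₁ a))
    {x : L₁} (hx : IsAlgebraic E x) : f x = g x := by
  have hv₂ : ∀ n : ℕ, n ≠ 0 → v₂ n = 1 := fun n hn => by rw [← map_natCast f n, hf, hv₁ n hn]
  have hchar : CharZero L₁ := charZero_of_valuation hv₁
  -- If `f` and `g` differ at `x`, then `x` is a limit over the subfield `E'` on which they agree, and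
  -- the cut of `x` over `E'` contains a zero `y` of a minimal unstable polynomial. The elements `f y`
  -- and `g y` are zeros of this polynomial in the same cut, so they coincide, and `y ∈ E'`.
  let E' : Subfield L₁ := f.eqLocusField g
  by_contra hne
  have himm' : IsImmediateOver E' v₁ := himm.tower fun a => ⟨⟨algebraMap E L₁ a, hfg a⟩, rfl⟩
  have hlim : IsLimitOver E' v₁ x := himm'.isLimitOver fun a ha => hne (ha ▸ a.2)
  let _ : Algebra E' L₂ := (f.comp E'.subtype).toAlgebra
  have hτ₁ := isValuedAction_unit (E := E') (v := v₁)
  have hτ₂ := isValuedAction_unit (E := E') (v := v₂)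
  have hex : ∃ G ∈ (Set.univ : Set (MvPolynomial Unit E')), G ≠ 0 ∧ ¬ IsStable v₁ x G := by
    obtain ⟨P, hP, hPx⟩ := hx
    let i : E →+* E' := (algebraMap E L₁).codRestrict E' hfg
    refine ⟨(uniqueAlgEquiv E' Unit).symm (P.map i), trivial, ?_, ?_⟩
    · rw [Ne, EmbeddingLike.map_eq_zero_iff, Polynomial.map_eq_zero]
      exact hP
    · intro h
      apply h.aeval_ne_zero
      change aeval (fun _ => x) _ = 0
      rw [aeval_uniqueAlgEquiv_symm, Polynomial.aeval_def, Polynomial.eval₂_map]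
      exact hPx
  obtain ⟨G, -, hG0, hGs, hdeg, h𝒞, hst, hder⟩ := exists_minimal_not_isStableAt
    (E := E') (𝒮 := Set.univ) (fun _ _ _ => trivial) hex
  obtain ⟨y, hy, hGy⟩ := exists_zero_of_not_isStableAt hv₁ hτ₁ strictMono_unit hsc
    (IsLinearlyClosed.of_unit v₁) hlim h𝒞 hst hder hGs
  have hGy' : aeval (fun _ => y) G = 0 := hGy
  let f' : L₁ →ₐ[E'] L₂ := { f with commutes' := fun _ => rfl }
  let g' : L₁ →ₐ[E'] L₂ := { g with commutes' := fun a => a.2.symm }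
  have hcf : SameCut E' v₁ v₂ x (f y) := fun a => by
    have h1 : algebraMap E' L₂ a = f a := rfl
    rw [hy a, h1, ← map_sub, hf]
    rfl
  have hcg : SameCut E' v₁ v₂ x (g y) := fun a => by
    have h1 : algebraMap E' L₂ a = g a := a.2
    rw [hy a, h1, ← map_sub, hg]
    rfl
  have hGf : aeval (fun _ => f y) G = 0 := by
    have := comp_aeval_apply (fun _ => y) f' G
    rw [hGy', map_zero] at this
    exact this.symm
  have hGg : aeval (fun _ => g y) G = 0 := by
    have := comp_aeval_apply (fun _ => y) g' G
    rw [hGy', map_zero] at this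
    exact this.symm
  have hvars : () ∈ G.vars := by
    by_contra h
    have h1 : G.vars = ∅ := by
      ext k
      simpa using h
    rw [vars_eq_empty_iff_eq_C] at h1
    exact hdeg (by rw [h1, totalDegree_C])
  have : CharZero E' := E'.subtype.charZero
  have hzero : g y - f y = 0 := by
    refine eq_zero_of_isStableAt hv₁ hv₂ strictMono_unit hτ₁ hτ₂
      (fun a => (hf a).symm) hcf h𝒞 hst hder (pderiv_ne_zero_of_mem_vars hvars) hGf
      (fun a => ?_) ?_
    · have := (hcf.symm.trans hcg).sub_lt (hcf.isLimitOver hlim) a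
      rw [← hcf a] at this
      exact this.le
    · rw [← hGg]
      congr 2
      ext k
      simp
  have hyE : y ∈ E' := (sub_eq_zero.1 hzero).symm
  exact (hy.isLimitOver hlim).notMem ⟨y, hyE⟩ rfl

end Agree

/-! ### Automorphisms and algebraic elements -/

section Invariance

variable {E L : Type*} [Field E] [Field L] [Algebra E L]

theorem map_mem_adjoin {σ : L ≃+* L} {σE : E → E}
    (hσ : ∀ a, σ (algebraMap E L a) = algebraMap E L (σE a)) {S : Set L}
    {D : IntermediateField E L} (hS : ∀ x ∈ S, σ x ∈ D) {x : L}
    (hx : x ∈ IntermediateField.adjoin E S) : σ x ∈ D := by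
  induction hx using IntermediateField.adjoin_induction with
  | mem x hx => exact hS x hx
  | algebraMap a => rw [hσ]; exact D.algebraMap_mem _
  | add x y _ _ hx hy => rw [map_add]; exact add_mem hx hy
  | inv x _ hx => rw [map_inv₀]; exact inv_mem hx
  | mul x y _ _ hx hy => rw [map_mul]; exact mul_mem hx hy

theorem ringHom_adjoin_ext {L' : Type*} [Field L'] {S : Set L}
    {f g : IntermediateField.adjoin E S →+* L'}
    (hfg : ∀ a, f (algebraMap E _ a) = g (algebraMap E _ a))
    (hS : ∀ x (hx : x ∈ S), f ⟨x, IntermediateField.subset_adjoin E S hx⟩ =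
      g ⟨x, IntermediateField.subset_adjoin E S hx⟩) : f = g := by
  ext ⟨x, hx⟩
  induction hx using IntermediateField.adjoin_induction with
  | mem x hx => exact hS x hx
  | algebraMap a => exact hfg a
  | add x y hx hy ihx ihy =>
    have h1 : (⟨x + y, add_mem hx hy⟩ : IntermediateField.adjoin E S) = ⟨x, hx⟩ + ⟨y, hy⟩ := rfl
    rw [h1, map_add, map_add, ihx, ihy]
  | inv x hx ihx =>
    have h1 : (⟨x⁻¹, inv_mem hx⟩ : IntermediateField.adjoin E S) =
      (⟨x, hx⟩ : IntermediateField.adjoin E S)⁻¹ := rfl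
    rw [h1, map_inv₀, map_inv₀, ihx]
  | mul x y hx hy ihx ihy =>
    have h1 : (⟨x * y, mul_mem hx hy⟩ : IntermediateField.adjoin E S) = ⟨x, hx⟩ * ⟨y, hy⟩ := rfl
    rw [h1, map_mul, map_mul, ihx, ihy]

/-- If `σ` maps `F` to elements algebraic over `F'`, then it maps the elements algebraic over `F` to
elements algebraic over `F'`. -/
theorem isAlgebraic_map {F F' : IntermediateField E L} (σ : L ≃+* L)
    (hσ : ∀ y ∈ F, IsAlgebraic F' (σ y)) {x : L} (hx : IsAlgebraic F x) :
    IsAlgebraic F' (σ x) := by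
  obtain ⟨P, hP, hPx⟩ := hx
  let i : F →+* algebraicClosure F' L :=
    ((σ : L →+* L).comp F.val.toRingHom).codRestrict (algebraicClosure F' L)
      (fun y => mem_algebraicClosure_iff.2 (hσ y y.2))
  have : IsAlgebraic (algebraicClosure F' L) (σ x) := by
    refine ⟨P.map i, (Polynomial.map_ne_zero_iff i.injective).2 hP, ?_⟩
    rw [Polynomial.aeval_def, Polynomial.eval₂_map]
    have h1 : (algebraMap (algebraicClosure F' L) L).comp i =
        (σ : L →+* L).comp (algebraMap F L) := rfl
    rw [h1]
    have h2 := Polynomial.hom_eval₂ P (algebraMap F L) (σ : L →+* L) x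
    rw [← Polynomial.aeval_def, hPx, map_zero] at h2
    exact h2.symm
  exact this.restrictScalars F'

/-- If `y` together with an algebraically independent family `x` contains a dependent family `z`, then
`y` is algebraic over the field generated by `x`. -/
theorem isAlgebraic_of_not_algebraicIndependent {ι κ : Type*} {x : ι → L}
    (hx : AlgebraicIndependent E x) {y : L} {z : κ → L} (e : κ → Option ι)
    (he : Function.Injective e) (hz : ∀ k, z k = (e k).elim y x)
    (hdep : ¬ AlgebraicIndependent E z) :
    IsAlgebraic (IntermediateField.adjoin E (Set.range x)) y := by
  have h1 : ¬ Transcendental (Algebra.adjoin E (Set.range x)) y := by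
    rw [← hx.option_iff_transcendental]
    intro h
    apply hdep
    have h2 := h.comp e he
    have h3 : z = (fun o : Option ι => o.elim y x) ∘ e := funext hz
    rwa [h3]
  rw [Transcendental, not_not] at h1
  open IntermediateField.algebraAdjoinAdjoin in
  exact h1.extendScalars (S := IntermediateField.adjoin E (Set.range x))
    (FaithfulSMul.algebraMap_injective _ _)

theorem mem_supported_pderiv {J : Type*} {S : Set J} {G : MvPolynomial J E}
    (hG : G ∈ supported E S) (j : J) : pderiv j G ∈ supported E S := by
  classical
  rw [mem_supported] at hG ⊢
  intro k hk
  obtain ⟨m, hm, hkm⟩ := (mem_vars_iff_mem_support k).1 hk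
  apply hG
  rw [mem_support_iff, coeff_pderiv] at hm
  refine (mem_vars_iff_mem_support k).2 ⟨m + Finsupp.single j 1,
    mem_support_iff.2 (left_ne_zero_of_mul hm), ?_⟩
  rw [Finsupp.mem_support_iff] at hkm ⊢
  rw [Finsupp.add_apply]
  omega

theorem aeval_congr_of_mem_vars {J : Type*} {p q : J → L} {G : MvPolynomial J E}
    (h : ∀ j ∈ G.vars, p j = q j) : aeval p G = aeval q G :=
  eval₂Hom_congr' rfl (fun j hj _ => h j hj) rfl

end Invariance

/-! ### Iterates of an automorphism -/

section Iterate

variable {Γ : Type*} [LinearOrderedCommGroupWithZero Γ] {E L : Type*} [Field E] [Field L]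
  [Algebra E L] {v : Valuation L Γ} {s : Γ → Γ} {σ : L ≃+* L} {σE : E ≃+* E}

theorem pow_succ_apply (σ : L ≃+* L) (n : ℕ) (x : L) : (σ ^ (n + 1)) x = σ ((σ ^ n) x) := by
  rw [pow_succ']
  rfl

theorem pow_apply_algebraMap (hσE : ∀ a, σ (algebraMap E L a) = algebraMap E L (σE a)) (n : ℕ)
    (a : E) : (σ ^ n) (algebraMap E L a) = algebraMap E L ((σE ^ n) a) := by
  induction n with
  | zero => rfl
  | succ n ih => rw [pow_succ_apply, ih, hσE, pow_succ_apply]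

theorem isValuedAction_pow (hσ : ∀ x, v (σ x) = s (v x))
    (hσE : ∀ a, σ (algebraMap E L a) = algebraMap E L (σE a)) :
    IsValuedAction (fun n : ℕ => s^[n]) (fun n a => (σE ^ n) a) v (fun n => σ ^ n) := by
  refine ⟨fun n x => ?_, pow_apply_algebraMap hσE⟩
  induction n with
  | zero => rfl
  | succ n ih => rw [pow_succ_apply, hσ, ih, Function.iterate_succ_apply']

/-- A polynomial in the variables `σ ^ j` with `j : ℤ` is carried by a power of `σ` to a polynomial
in the variables with `j : ℕ`. -/
theorem aeval_shift (hσE : ∀ a, σ (algebraMap E L a) = algebraMap E L (σE a))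
    (F : MvPolynomial ℤ E) (m : ℕ) (hm : ∀ j ∈ F.vars, 0 ≤ j + m) (b : L) :
    aeval (fun n : ℕ => (σ ^ n) b)
      (rename (fun j : ℤ => (j + m).toNat) (map (σE ^ m : E ≃+* E).toRingHom F)) =
      (σ ^ m) (aeval (fun j : ℤ => (σ ^ j) b) F) := by
  rw [aeval_rename, aeval_def, eval₂_map]
  have h1 := map_aeval (fun j : ℤ => (σ ^ j) b) ((σ ^ m : L ≃+* L) : L →+* L) F
  refine Eq.trans ?_ h1.symm
  refine eval₂Hom_congr' ?_ ?_ rfl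
  · ext a
    exact (pow_apply_algebraMap hσE m a).symm
  · intro j hj _
    have h2 := hm j hj
    change (σ ^ (j + m).toNat) b = (σ ^ m) ((σ ^ j) b)
    have h3 : (σ ^ m) ((σ ^ j) b) = (σ ^ m * σ ^ j) b := rfl
    rw [h3, ← zpow_natCast σ (j + m).toNat, Int.toNat_of_nonneg h2, ← zpow_natCast σ m,
      ← zpow_add, add_comm]

end Iterate

/-! ### Adjoining a generic realization of a cut -/

section Difference

variable {Γ : Type*} [LinearOrderedCommGroupWithZero Γ]
variable {E L₁ L₂ : Type*} [Field E] [Field L₁] [Field L₂]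
  [Algebra E L₁] [Algebra E L₂] {v₁ : Valuation L₁ Γ} {v₂ : Valuation L₂ Γ}
  {s : Γ → Γ} {σE : E ≃+* E} {σ₁ : L₁ ≃+* L₁} {σ₂ : L₂ ≃+* L₂}

/-- If every nonzero difference polynomial is stable at `b`, then `b` generates the same valued
difference field over `E` as any other realization of its cut. -/
theorem exists_difference_extension_of_stable (hv₁ : ∀ n : ℕ, n ≠ 0 → v₁ n = 1)
    (hv₂ : ∀ n : ℕ, n ≠ 0 → v₂ n = 1)
    (hE : ∀ a : E, v₁ (algebraMap E L₁ a) = v₂ (algebraMap E L₂ a)) (hs : StrictMono s)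
    (hσ₁ : ∀ x, v₁ (σ₁ x) = s (v₁ x)) (hσ₂ : ∀ x, v₂ (σ₂ x) = s (v₂ x))
    (hσE₁ : ∀ a, σ₁ (algebraMap E L₁ a) = algebraMap E L₁ (σE a))
    (hσE₂ : ∀ a, σ₂ (algebraMap E L₂ a) = algebraMap E L₂ (σE a))
    {b : L₁} {c : L₂} (hbc : SameCut E v₁ v₂ b c)
    (hst : ∀ G : MvPolynomial ℕ E, G ≠ 0 →
      IsStableAt (fun n => s^[n]) (fun n => σ₁ ^ n) v₁ b G) :
    ∃ (D : IntermediateField E L₁) (f : D →ₐ[E] L₂), (∃ x ∈ D, SameCut E v₁ v₁ b x) ∧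
      IsValuedLift v₁ v₂ (fun _ : Unit => σ₁) (fun _ => σ₂) D.toSubfield f.toRingHom := by
  have hτ₁ := isValuedAction_pow hσ₁ hσE₁
  have hτ₂ := isValuedAction_pow hσ₂ hσE₂
  have hN : ∀ F : MvPolynomial ℕ E, v₁ (aeval (fun n => (σ₁ ^ n) b) F) =
      v₂ (aeval (fun n => (σ₂ ^ n) c) F) := fun F =>
    aeval_eq_of_sameCut hv₁ hv₂ hτ₁ hτ₂ hE hbc (𝒞 := Set.univ) (fun _ _ _ => trivial)
      (fun G _ => hst G) F trivial
  have hZ : ∀ F : MvPolynomial ℤ E, v₁ (aeval (fun n : ℤ => (σ₁ ^ n) b) F) =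
      v₂ (aeval (fun n : ℤ => (σ₂ ^ n) c) F) := by
    intro F
    obtain ⟨m, hm⟩ : ∃ m : ℕ, ∀ j ∈ F.vars, 0 ≤ j + m := by
      refine ⟨F.vars.sup fun j => (-j).toNat, fun j hj => ?_⟩
      have := Finset.le_sup (f := fun j : ℤ => (-j).toNat) hj
      omega
    apply hs.injective.iterate m
    rw [← hτ₁.map_value m, ← hτ₂.map_value m, ← aeval_shift hσE₁ F m hm, ← aeval_shift hσE₂ F m hm,
      hN]
  let p : ℤ → L₁ := fun n => (σ₁ ^ n) b
  obtain ⟨f, hfq, hfv⟩ := exists_algHom_adjoin_range p _ hZ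
  have hp : ∀ n : ℤ, σ₁ (p n) = p (n + 1) := fun n => by
    simp only [p]
    rw [add_comm n 1, zpow_one_add]
    rfl
  have hq : ∀ n : ℤ, σ₂ ((σ₂ ^ n) c) = (σ₂ ^ (n + 1)) c := fun n => by
    rw [add_comm n 1, zpow_one_add]
    rfl
  let D := IntermediateField.adjoin E (Set.range p)
  have hfwd : ∀ x ∈ D, σ₁ x ∈ D := fun x hx => map_mem_adjoin (D := D) hσE₁ (by
    rintro _ ⟨n, rfl⟩
    rw [hp]
    exact IntermediateField.subset_adjoin _ _ ⟨_, rfl⟩) hx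
  have hbwd : ∀ x ∈ D, σ₁.symm x ∈ D := fun x hx => map_mem_adjoin (D := D) (σE := σE.symm)
    (fun a => by rw [RingEquiv.symm_apply_eq, hσE₁, RingEquiv.apply_symm_apply]) (by
    rintro _ ⟨n, rfl⟩
    rw [show p n = σ₁ (p (n - 1)) by rw [hp, sub_add_cancel], RingEquiv.symm_apply_apply]
    exact IntermediateField.subset_adjoin _ _ ⟨_, rfl⟩) hx
  refine ⟨D, f, ⟨b, IntermediateField.subset_adjoin _ _ ⟨0, rfl⟩, SameCut.refl b⟩, hfv,
    fun _ x => ⟨fun h => by simpa using hbwd _ h, hfwd x⟩, ?_⟩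
  let σD : D →+* D := ((σ₁ : L₁ →+* L₁).comp D.val.toRingHom).codRestrict D
    (fun x => hfwd x x.2)
  have hcomm : f.toRingHom.comp σD = (σ₂ : L₂ →+* L₂).comp f.toRingHom := by
    refine ringHom_adjoin_ext (fun a => ?_) ?_
    · have h1 : σD (algebraMap E D a) = algebraMap E D (σE a) := Subtype.ext (hσE₁ a)
      change f (σD (algebraMap E D a)) = σ₂ (f (algebraMap E D a))
      rw [h1, f.commutes, f.commutes, hσE₂]
    · rintro _ ⟨n, rfl⟩
      change f (σD ⟨p n, _⟩) = σ₂ (f ⟨p n, _⟩)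
      have h1 : σD ⟨p n, IntermediateField.subset_adjoin _ _ ⟨n, rfl⟩⟩ =
        ⟨p (n + 1), IntermediateField.subset_adjoin _ _ ⟨_, rfl⟩⟩ := Subtype.ext (hp n)
      rw [h1, hfq, hfq, hq]
  rintro - x -
  exact DFunLike.congr_fun hcomm x

end Difference

/-! ### Uniqueness for valued difference fields -/

section Difference

variable {Γ : Type*} [LinearOrderedCommGroupWithZero Γ]
variable {E L₁ L₂ : Type*} [Field E] [Field L₁] [Field L₂]
  [Algebra E L₁] [Algebra E L₂] {v₁ : Valuation L₁ Γ} {v₂ : Valuation L₂ Γ}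
  {s : Γ → Γ} {σE : E ≃+* E} {σ₁ : L₁ ≃+* L₁} {σ₂ : L₂ ≃+* L₂}

/-- An element is algebraic over the field generated by its first `n` transforms if these are
algebraically independent and the first `n + 1` are not. -/
theorem isAlgebraic_of_minimal_dependence {n : ℕ} {b : L₁}
    (hind : AlgebraicIndependent E fun i : Fin n => (σ₁ ^ (i : ℕ)) b)
    (hdep : ¬ AlgebraicIndependent E fun i : Fin (n + 1) => (σ₁ ^ (i : ℕ)) b) :
    IsAlgebraic (IntermediateField.adjoin E (Set.range fun i : Fin n => (σ₁ ^ (i : ℕ)) b)) b := by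
  rcases Nat.eq_zero_or_pos n with rfl | hn0
  · exact isAlgebraic_of_not_algebraicIndependent hind (fun _ => none)
      (fun i j _ => Fin.ext (by omega))
      (fun k => by
        have hk : k = Fin.last 0 := Fin.ext (by omega)
        rw [hk]
        simp) hdep
  · exact isAlgebraic_algebraMap
      (⟨b, IntermediateField.subset_adjoin _ _ ⟨⟨0, hn0⟩, rfl⟩⟩ : IntermediateField.adjoin E
        (Set.range fun i : Fin n => (σ₁ ^ (i : ℕ)) b))

/-- Let `n` be minimal such that `σ ^ n b` is algebraic over `E(b, …, σ ^ (n - 1) b)`. Then the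
relative algebraic closure of this field is invariant under `σ` and `σ⁻¹`. -/
theorem map_mem_algebraicClosure {n : ℕ} {b : L₁}
    (hσE₁ : ∀ a, σ₁ (algebraMap E L₁ a) = algebraMap E L₁ (σE a))
    (hind : AlgebraicIndependent E fun i : Fin n => (σ₁ ^ (i : ℕ)) b)
    (hdep : ¬ AlgebraicIndependent E fun i : Fin (n + 1) => (σ₁ ^ (i : ℕ)) b) (x : L₁) :
    IsAlgebraic (IntermediateField.adjoin E (Set.range fun i : Fin n => (σ₁ ^ (i : ℕ)) b)) (σ₁ x) ↔
    IsAlgebraic (IntermediateField.adjoin E (Set.range fun i : Fin n => (σ₁ ^ (i : ℕ)) b)) x := by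
  set p : Fin n → L₁ := fun i => (σ₁ ^ (i : ℕ)) b with hp
  set D := IntermediateField.adjoin E (Set.range p) with hD
  let p' : Fin n → L₁ := fun i => σ₁ (p i)
  let D' := IntermediateField.adjoin E (Set.range p')
  have hmem : ∀ y ∈ D, y ∈ algebraicClosure D L₁ := fun y hy =>
    (algebraicClosure D L₁).algebraMap_mem ⟨y, hy⟩
  have hN : ∀ y, y ∈ (algebraicClosure D L₁).restrictScalars E ↔ IsAlgebraic D y :=
    fun y => mem_algebraicClosure_iff
  have hlast : IsAlgebraic D ((σ₁ ^ n) b) :=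
    isAlgebraic_of_not_algebraicIndependent hind finSuccEquivLast finSuccEquivLast.injective
      (fun k => by
        induction k using Fin.lastCases with
        | last => simp
        | cast k => rw [finSuccEquivLast_castSucc]; rfl) hdep
  have hind' : AlgebraicIndependent E p' := by
    rw [algebraicIndependent_iff] at hind ⊢
    intro P hP
    have h1 : aeval p (map (σE.symm : E →+* E) P) = 0 := by
      apply σ₁.injective
      rw [map_zero, ← hP]
      have h2 := map_aeval p (σ₁ : L₁ →+* L₁) (map (σE.symm : E →+* E) P)
      refine h2.trans ?_
      rw [coe_eval₂Hom, eval₂_map, aeval_def]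
      congr 1
      ext a
      simp [hσE₁]
    have h2 := hind _ h1
    exact map_injective _ σE.symm.injective (h2.trans (map_zero _).symm)
  have hfirst : IsAlgebraic D' b :=
    isAlgebraic_of_not_algebraicIndependent hind' (finSuccEquiv n) (finSuccEquiv n).injective
      (fun k => by
        induction k using Fin.cases with
        | zero => simp
        | succ k => simp [p', p, pow_succ_apply]) hdep
  constructor
  · intro h
    have hb : IsAlgebraic D (σ₁.symm b) := by
      refine isAlgebraic_map (F := D') (F' := D) σ₁.symm (fun y hy => ?_) hfirst
      have : σ₁.symm y ∈ D := map_mem_adjoin (D := D) (σE := σE.symm)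
        (fun a => by rw [RingEquiv.symm_apply_eq, hσE₁, RingEquiv.apply_symm_apply]) (by
          rintro _ ⟨i, rfl⟩
          simp only [p', RingEquiv.symm_apply_apply]
          exact IntermediateField.subset_adjoin _ _ ⟨i, rfl⟩) hy
      exact isAlgebraic_algebraMap (⟨_, this⟩ : D)
    have h1 := isAlgebraic_map (F := D) (F' := D) σ₁.symm (fun y hy => by
      have : σ₁.symm y ∈ (algebraicClosure D L₁).restrictScalars E :=
        map_mem_adjoin (σE := σE.symm)
        (fun a => by rw [RingEquiv.symm_apply_eq, hσE₁, RingEquiv.apply_symm_apply]) (by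
          rintro _ ⟨⟨i, hi⟩, rfl⟩
          rcases i with _ | i
          · exact (hN _).2 hb
          · simp only [p, pow_succ_apply, RingEquiv.symm_apply_apply]
            exact hmem _ (IntermediateField.subset_adjoin _ _ ⟨⟨i, by omega⟩, rfl⟩)) hy
      exact (hN _).1 this) h
    simpa using h1
  · intro h
    refine isAlgebraic_map (F := D) (F' := D) σ₁ (fun y hy => ?_) h
    have : σ₁ y ∈ (algebraicClosure D L₁).restrictScalars E :=
      map_mem_adjoin (σE := σE) hσE₁ (by
        rintro _ ⟨⟨i, hi⟩, rfl⟩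
        simp only [p, ← pow_succ_apply]
        rcases Nat.lt_or_ge (i + 1) n with h' | h'
        · exact hmem _ (IntermediateField.subset_adjoin _ _ ⟨⟨i + 1, h'⟩, rfl⟩)
        · obtain rfl : i + 1 = n := by omega
          exact (hN _).2 hlast) hy
    exact (hN _).1 this

/-- If some nonzero difference polynomial over `E` is not stable at `b`, then the cut of `b` is
realized by an element whose transforms have finite transcendence degree over `E`, and the relative
algebraic closure of the difference field that it generates embeds into `L₂`. -/
theorem exists_difference_extension_of_not_stable (hv₁ : ∀ n : ℕ, n ≠ 0 → v₁ n = 1)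
    (hv₂ : ∀ n : ℕ, n ≠ 0 → v₂ n = 1)
    (hE : ∀ a : E, v₁ (algebraMap E L₁ a) = v₂ (algebraMap E L₂ a))
    (himm₁ : IsImmediateOver E v₁) (himm₂ : IsImmediateOver E v₂)
    (hsc₁ : SphericallyComplete v₁) (hsc₂ : SphericallyComplete v₂) (hs : StrictMono s)
    (hσ₁ : ∀ x, v₁ (σ₁ x) = s (v₁ x)) (hσ₂ : ∀ x, v₂ (σ₂ x) = s (v₂ x))
    (hσE₁ : ∀ a, σ₁ (algebraMap E L₁ a) = algebraMap E L₁ (σE a))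
    (hσE₂ : ∀ a, σ₂ (algebraMap E L₂ a) = algebraMap E L₂ (σE a))
    (hlin₁ : IsLinearlyClosed v₁ fun n : ℕ => σ₁ ^ n)
    (hlin₂ : IsLinearlyClosed v₂ fun n : ℕ => σ₂ ^ n)
    {b : L₁} (hb : IsLimitOver E v₁ b) {c : L₂} (hbc : SameCut E v₁ v₂ b c)
    (hst : ∃ G : MvPolynomial ℕ E, G ≠ 0 ∧
      ¬ IsStableAt (fun n => s^[n]) (fun n => σ₁ ^ n) v₁ b G) :
    ∃ (D : IntermediateField E L₁) (f : D →ₐ[E] L₂), (∃ x ∈ D, SameCut E v₁ v₁ b x) ∧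
      IsValuedLift v₁ v₂ (fun _ : Unit => σ₁) (fun _ => σ₂) D.toSubfield f.toRingHom := by
  classical
  have hτ₁ := isValuedAction_pow hσ₁ hσE₁
  have hτ₂ := isValuedAction_pow hσ₂ hσE₂
  have hsn : ∀ n, StrictMono s^[n] := hs.iterate
  have : CharZero L₁ := charZero_of_valuation hv₁
  have : CharZero E := (algebraMap E L₁).charZero
  -- The least order of an unstable polynomial.
  have hex : ∃ n, ∃ G ∈ supported E (Set.Iio n), G ≠ 0 ∧
      ¬ IsStableAt (fun n => s^[n]) (fun n => σ₁ ^ n) v₁ b G := by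
    obtain ⟨G, h1, h2⟩ := hst
    refine ⟨G.vars.sup id + 1, G, ?_, h1, h2⟩
    rw [mem_supported]
    exact fun j hj => Nat.lt_succ_of_le (Finset.le_sup (f := id) hj)
  obtain ⟨n, hn, hmin⟩ : ∃ n, (∃ G ∈ supported E (Set.Iio (n + 1)), G ≠ 0 ∧
      ¬ IsStableAt (fun n => s^[n]) (fun n => σ₁ ^ n) v₁ b G) ∧
      ∀ G ∈ supported E (Set.Iio n), G ≠ 0 →
        IsStableAt (fun n => s^[n]) (fun n => σ₁ ^ n) v₁ b G := by
    have h0 : Nat.find hex ≠ 0 := by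
      intro h0
      obtain ⟨G, hG, hG0, hGs⟩ := Nat.find_spec hex
      rw [h0, mem_supported] at hG
      have h1 : G.vars = ∅ := by
        ext k
        constructor
        · intro hk
          simpa using hG hk
        · simp
      rw [vars_eq_empty_iff_eq_C] at h1
      rw [h1] at hGs hG0
      exact hGs (isStableAt_C (by rintro h; exact hG0 (by rw [h, C_0])))
    obtain ⟨n, hn⟩ := Nat.exists_eq_succ_of_ne_zero h0
    have hspec := Nat.find_spec hex
    rw [hn] at hspec
    refine ⟨n, hspec, fun G hG hG0 => ?_⟩
    by_contra h
    exact Nat.find_min hex (m := n) (by omega) ⟨G, hG, hG0, h⟩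
  obtain ⟨G, hG𝒮, hG0, hGs, hdeg, h𝒞, hstab, hder⟩ := exists_minimal_not_isStableAt
    (E := E) (𝒮 := (supported E (Set.Iio (n + 1)) : Set (MvPolynomial ℕ E)))
    (fun _ h j => mem_supported_pderiv h j) hn
  have hGvars : ∀ j ∈ G.vars, j < n + 1 := fun j hj => mem_supported.1 hG𝒮 hj
  have hnG : n ∈ G.vars := by
    by_contra h
    refine hGs (hmin G ?_ hG0)
    rw [mem_supported]
    intro j hj
    have h1 := hGvars j hj
    have h2 : j ≠ n := by
      rintro rfl
      exact h hj
    exact Set.mem_Iio.2 (by omega)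
  have hst₂ := fun H hH hH0 => (isStableAt_iff_of_sameCut hv₁ hv₂ hτ₁ hτ₂ hE hbc h𝒞 hstab H
    (h𝒞 H hH)).1 (hstab H hH hH0)
  have hGs₂ := (isStableAt_iff_of_sameCut hv₁ hv₂ hτ₁ hτ₂ hE hbc h𝒞 hstab G hder).not.1 hGs
  obtain ⟨b', hbb', hGb'⟩ := exists_zero_of_not_isStableAt hv₁ hτ₁ hsn hsc₁
    hlin₁ hb h𝒞 hstab hder hGs
  obtain ⟨c', hcc', hGc'⟩ := exists_zero_of_not_isStableAt hv₂ hτ₂ hsn hsc₂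
    hlin₂ (hbc.isLimitOver hb) h𝒞 hst₂ hder hGs₂
  have hbc' : SameCut E v₁ v₂ b c' := hbc.trans hcc'
  -- Polynomials of smaller order take the same values at `b'` and at `c'`.
  have hren : ∀ F : MvPolynomial (Fin n) E,
      rename (fun i : Fin n => (i : ℕ)) F ∈ supported E (Set.Iio n) := by
    intro F
    rw [mem_supported]
    intro j hj
    obtain ⟨i, -, rfl⟩ := Finset.mem_image.1 (vars_rename _ F hj)
    exact i.2
  let p : Fin n → L₁ := fun i => (σ₁ ^ (i : ℕ)) b'
  let q : Fin n → L₂ := fun i => (σ₂ ^ (i : ℕ)) c'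
  have hpb : ∀ F : MvPolynomial (Fin n) E, v₁ (aeval (fun j => (σ₁ ^ j) b)
      (rename (fun i : Fin n => (i : ℕ)) F)) = v₁ (aeval p F) := fun F => by
    rw [aeval_eq_of_sameCut hv₁ hv₁ hτ₁ hτ₁ (fun _ => rfl) hbb'
      (𝒞 := (supported E (Set.Iio n) : Set (MvPolynomial ℕ E)))
      (fun _ h j => mem_supported_pderiv h j) hmin _ (hren F), aeval_rename]
    rfl
  have hpq : ∀ F : MvPolynomial (Fin n) E, v₁ (aeval p F) = v₂ (aeval q F) := fun F => by
    rw [← hpb, aeval_eq_of_sameCut hv₁ hv₂ hτ₁ hτ₂ hE hbc'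
      (𝒞 := (supported E (Set.Iio n) : Set (MvPolynomial ℕ E)))
      (fun _ h j => mem_supported_pderiv h j) hmin _ (hren F), aeval_rename]
    rfl
  have hind : AlgebraicIndependent E p := by
    rw [algebraicIndependent_iff]
    intro F hF
    by_contra hF0
    have h1 := hmin _ (hren F) fun h => hF0 (rename_injective _ Fin.val_injective (by simpa using h))
    have h2 := hpb F
    rw [hF, map_zero, v₁.zero_iff] at h2
    exact h1.aeval_ne_zero h2
  have hdep : ¬ AlgebraicIndependent E fun i : Fin (n + 1) => (σ₁ ^ (i : ℕ)) b' := by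
    intro h
    obtain ⟨F, hF⟩ := exists_rename_eq_of_vars_subset_range G (fun i : Fin (n + 1) => (i : ℕ))
      Fin.val_injective (fun j hj => ⟨⟨j, hGvars j hj⟩, rfl⟩)
    rw [← hF, aeval_rename] at hGb'
    have := algebraicIndependent_iff.1 h F hGb'
    exact hG0 (by rw [← hF, this, map_zero])
  -- Kaplansky's theorem over `E(b', …, σ ^ (n - 1) b')` gives an isomorphism of valued fields that
  -- need not commute with `σ`.
  obtain ⟨θ, hθq, hθv⟩ := exists_algHom_adjoin_range p q hpq
  let D := IntermediateField.adjoin E (Set.range p)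
  let _ : Algebra D L₂ := θ.toRingHom.toAlgebra
  obtain ⟨e, he⟩ := exists_algEquiv_of_sphericallyComplete (E := D) hv₁ hv₂
    (fun a => (hθv a).symm) (himm₁.tower fun a => ⟨algebraMap E D a, rfl⟩)
    (himm₂.tower fun a => ⟨algebraMap E D a, θ.commutes a⟩) hsc₁ hsc₂
  have heD : ∀ x : D, e x = θ x := e.commutes
  have heE : ∀ a : E, e (algebraMap E L₁ a) = algebraMap E L₂ a := fun a =>
    (heD (algebraMap E D a)).trans (θ.commutes a)
  let eE : L₁ →ₐ[E] L₂ := { (e : L₁ →+* L₂) with commutes' := heE }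
  have hep : ∀ j < n, e ((σ₁ ^ j) b') = (σ₂ ^ j) c' := fun j hj =>
    (heD ⟨p ⟨j, hj⟩, IntermediateField.subset_adjoin _ _ ⟨_, rfl⟩⟩).trans (hθq ⟨j, hj⟩)
  -- The isomorphism `e` carries `σ ^ n b'` to `σ ^ n c'`: the polynomial `G` has only one zero in
  -- this cut with the given transforms of smaller order.
  have hen : e ((σ₁ ^ n) b') = (σ₂ ^ n) c' := by
    rw [← sub_eq_zero]
    refine eq_zero_of_isStableAt hv₁ hv₂ hsn hτ₁ hτ₂ hE hbc' h𝒞 hstab hder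
      (pderiv_ne_zero_of_mem_vars hnG) hGc' (fun a => ?_) ?_
    · have h1 : e ((σ₁ ^ n) b') - (σ₂ ^ n) c' = e ((σ₁ ^ n) (b' - algebraMap E L₁ a)) -
          (σ₂ ^ n) (c' - algebraMap E L₂ a) := by
        rw [map_sub, map_sub, map_sub, pow_apply_algebraMap hσE₁, pow_apply_algebraMap hσE₂, heE]
        ring
      rw [h1]
      refine (v₂.map_sub _ _).trans (max_le ?_ ?_)
      · rw [he, hτ₁.map_value n, ← hbb' a]
      · rw [hτ₂.map_value n, ← hbc' a]
    · have h1 := comp_aeval_apply (fun j => (σ₁ ^ j) b') eE G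
      rw [hGb', map_zero] at h1
      rw [h1]
      refine aeval_congr_of_mem_vars fun j hj => ?_
      change (σ₂ ^ j) c' + (Pi.single n (e ((σ₁ ^ n) b') - (σ₂ ^ n) c') : ℕ → L₂) j =
        e ((σ₁ ^ j) b')
      rcases eq_or_ne j n with rfl | hne
      · simp
      · have := hGvars j hj
        rw [hep j (by omega)]
        simp [hne]
  have hen' : ∀ j ≤ n, e ((σ₁ ^ j) b') = (σ₂ ^ j) c' := fun j hj => by
    rcases hj.lt_or_eq with h | rfl
    · exact hep j h
    · exact hen
  -- The embeddings `e` and `g = σ₂⁻¹ ∘ e ∘ σ₁` agree on `D`, hence on the elements algebraic over `D`.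
  let g : L₁ →+* L₂ := (σ₂.symm : L₂ →+* L₂).comp ((e : L₁ →+* L₂).comp (σ₁ : L₁ →+* L₁))
  have hgv : ∀ x, v₂ (g x) = v₁ x := by
    intro x
    apply hs.injective
    rw [← hσ₂]
    change v₂ (σ₂ (σ₂.symm (e (σ₁ x)))) = _
    rw [RingEquiv.apply_symm_apply, he, hσ₁]
  have hagree : (e : L₁ →+* L₂).comp D.val.toRingHom = g.comp D.val.toRingHom := by
    refine ringHom_adjoin_ext (fun a => ?_) ?_
    · change e (algebraMap E L₁ a) = σ₂.symm (e (σ₁ (algebraMap E L₁ a)))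
      rw [RingEquiv.eq_symm_apply, hσE₁, heE, heE, hσE₂]
    · rintro _ ⟨i, rfl⟩
      change e ((σ₁ ^ (i : ℕ)) b') = σ₂.symm (e (σ₁ ((σ₁ ^ (i : ℕ)) b')))
      rw [RingEquiv.eq_symm_apply, ← pow_succ_apply, hen' _ i.2, hep _ i.2, pow_succ_apply]
  have hcomm : ∀ x, IsAlgebraic D x → e (σ₁ x) = σ₂ (e x) := by
    intro x hx
    have h1 : e x = g x := eq_of_isAlgebraic (E := D) hv₁
      (himm₁.tower fun a => ⟨algebraMap E D a, rfl⟩) hsc₁ (e : L₁ →+* L₂) g he hgv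
      (fun a => DFunLike.congr_fun hagree a) hx
    rw [h1]
    exact (σ₂.apply_symm_apply _).symm
  have hmem := map_mem_algebraicClosure hσE₁ hind hdep
  let N : IntermediateField E L₁ := (algebraicClosure D L₁).restrictScalars E
  have hN : ∀ y, y ∈ N ↔ IsAlgebraic D y := fun y => mem_algebraicClosure_iff
  refine ⟨N, eE.comp N.val, ⟨b', (hN b').2
    (isAlgebraic_of_minimal_dependence hind hdep), hbb'⟩, fun x => he x,
    fun _ x => (hN _).trans ((hmem x).trans (hN _).symm), fun _ x _ => hcomm x ((hN _).1 x.2)⟩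

/-- The extension step for partial isomorphisms of valued difference fields: the cut of a limit `b`
is realized in a difference field over `E` that embeds into `L₂`. -/
theorem exists_difference_extension (hv₁ : ∀ n : ℕ, n ≠ 0 → v₁ n = 1)
    (hv₂ : ∀ n : ℕ, n ≠ 0 → v₂ n = 1)
    (hE : ∀ a : E, v₁ (algebraMap E L₁ a) = v₂ (algebraMap E L₂ a))
    (himm₁ : IsImmediateOver E v₁) (himm₂ : IsImmediateOver E v₂)
    (hsc₁ : SphericallyComplete v₁) (hsc₂ : SphericallyComplete v₂) (hs : StrictMono s)
    (hσ₁ : ∀ x, v₁ (σ₁ x) = s (v₁ x)) (hσ₂ : ∀ x, v₂ (σ₂ x) = s (v₂ x))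
    (hσE₁ : ∀ a, σ₁ (algebraMap E L₁ a) = algebraMap E L₁ (σE a))
    (hσE₂ : ∀ a, σ₂ (algebraMap E L₂ a) = algebraMap E L₂ (σE a))
    (hlin₁ : IsLinearlyClosed v₁ fun n : ℕ => σ₁ ^ n)
    (hlin₂ : IsLinearlyClosed v₂ fun n : ℕ => σ₂ ^ n)
    {b : L₁} (hb : IsLimitOver E v₁ b) :
    ∃ (D : IntermediateField E L₁) (f : D →ₐ[E] L₂), (∃ x ∈ D, SameCut E v₁ v₁ b x) ∧
      IsValuedLift v₁ v₂ (fun _ : Unit => σ₁) (fun _ => σ₂) D.toSubfield f.toRingHom := by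
  obtain ⟨c, hbc⟩ := hsc₂.exists_sameCut hE hb
  by_cases hst : ∀ G : MvPolynomial ℕ E, G ≠ 0 →
      IsStableAt (fun n => s^[n]) (fun n => σ₁ ^ n) v₁ b G
  · exact exists_difference_extension_of_stable hv₁ hv₂ hE hs hσ₁ hσ₂ hσE₁ hσE₂ hbc hst
  · push Not at hst
    exact exists_difference_extension_of_not_stable hv₁ hv₂ hE himm₁ himm₂ hsc₁ hsc₂ hs hσ₁ hσ₂
      hσE₁ hσE₂ hlin₁ hlin₂ hb hbc hst

/-- Spherically complete immediate extensions of a valued difference field are isomorphic, if linear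
difference equations can be solved modulo their maximal ideals. -/
theorem exists_difference_algEquiv (hv₁ : ∀ n : ℕ, n ≠ 0 → v₁ n = 1)
    (hv₂ : ∀ n : ℕ, n ≠ 0 → v₂ n = 1)
    (hE : ∀ a : E, v₁ (algebraMap E L₁ a) = v₂ (algebraMap E L₂ a))
    (himm₁ : IsImmediateOver E v₁) (himm₂ : IsImmediateOver E v₂)
    (hsc₁ : SphericallyComplete v₁) (hsc₂ : SphericallyComplete v₂) (hs : StrictMono s)
    (hσ₁ : ∀ x, v₁ (σ₁ x) = s (v₁ x)) (hσ₂ : ∀ x, v₂ (σ₂ x) = s (v₂ x))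
    (hσE₁ : ∀ a, σ₁ (algebraMap E L₁ a) = algebraMap E L₁ (σE a))
    (hσE₂ : ∀ a, σ₂ (algebraMap E L₂ a) = algebraMap E L₂ (σE a))
    (hlin₁ : IsLinearlyClosed v₁ fun n : ℕ => σ₁ ^ n)
    (hlin₂ : IsLinearlyClosed v₂ fun n : ℕ => σ₂ ^ n) :
    ∃ f : L₁ ≃ₐ[E] L₂, (∀ x, v₂ (f x) = v₁ x) ∧ ∀ x, f (σ₁ x) = σ₂ (f x) := by
  obtain ⟨f, hf, hfσ⟩ := exists_algHom_of_extend (E := E) (v₁ := v₁) (v₂ := v₂)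
    (fun _ : Unit => σE) (fun _ => σ₁) (fun _ => σ₂) (fun _ => hσE₁) (fun _ => hσE₂) hE (by
    intro F g hg hF
    let _ := g.toRingHom.toAlgebra
    obtain ⟨b, hb⟩ : ∃ b, b ∉ F := by
      by_contra! h
      exact hF (eq_top_iff.2 fun x _ => h x)
    have himmF : IsImmediateOver F v₁ := himm₁.tower fun a => ⟨algebraMap E F a, rfl⟩
    have hlim : IsLimitOver F v₁ b := himmF.isLimitOver fun a ha => hb (ha ▸ a.2)
    have hmem := hg.mem_iff ()
    let σF : F ≃+* F :=
      { (σ₁ : L₁ →+* L₁).restrict F F (fun x hx => (hmem x).2 hx) with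
        invFun := fun x => ⟨σ₁.symm x, (hmem _).1 (by rw [RingEquiv.apply_symm_apply]; exact x.2)⟩
        left_inv := fun x => Subtype.ext (σ₁.symm_apply_apply x)
        right_inv := fun x => Subtype.ext (σ₁.apply_symm_apply x) }
    obtain ⟨D, f, ⟨x, hxD, hx⟩, hf⟩ := exists_difference_extension (E := F) (σE := σF) hv₁ hv₂
      (fun a => (hg.map_value a).symm) himmF
      (himm₂.tower fun a => ⟨algebraMap E F a, g.commutes a⟩) hsc₁ hsc₂ hs hσ₁ hσ₂
      (fun a => rfl) (fun a => (hg.commutes () a ((hmem a).2 a.2)).symm) hlin₁ hlin₂ hlim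
    refine ⟨D.toSubfield, f.toRingHom, fun a ha => D.algebraMap_mem ⟨a, ha⟩, hf, ?_,
      fun a => f.commutes a⟩
    intro h
    have hxF : x ∈ F := by
      rw [← IntermediateField.mem_toSubfield, ← h]
      exact hxD
    exact (hx.isLimitOver hlim).notMem ⟨x, hxF⟩ rfl)
  exact ⟨AlgEquiv.ofBijective f ⟨f.injective, surjective_of_sphericallyComplete f hf hsc₁ himm₂⟩,
    hf, hfσ ()⟩

end Difference

/-! ### Immediate extensions inside an algebraically closed field -/

section Existence

open Cardinal

variable {Γ : Type*} [LinearOrderedCommGroupWithZero Γ]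

/-- Krull's bound for the cardinality of an immediate extension: an element `x` of `L` is determined
by the function that assigns to a radius `t` the leading term of the difference between `x` and a
fixed representative of the ball of radius `v t` around `x`. -/
theorem IsImmediateOver.exists_injective {E L : Type*} [Field E] [Field L] [Algebra E L]
    {v : Valuation L Γ} (h : IsImmediateOver E v) : ∃ f : L → E → E, Function.Injective f := by
  classical
  let r : E → Setoid L := fun t =>
    { r := fun x y => v (x - y) ≤ v (algebraMap E L t)
      iseqv := ⟨fun x => by simp, fun {x y} hxy => by rwa [v.map_sub_swap], fun {x y z} h1 h2 => by
        rw [show x - z = (x - y) + (y - z) by ring]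
        exact (v.map_add _ _).trans (max_le h1 h2)⟩ }
  let ρ : E → L → L := fun t x => (Quotient.mk (r t) x).out
  have hρ : ∀ t x, v (x - ρ t x) ≤ v (algebraMap E L t) := fun t x => by
    rw [v.map_sub_swap]
    exact Quotient.exact (s := r t) (Quotient.out_eq _)
  have hex : ∀ (t : E) (x : L), ∃ a : E, t ≠ 0 →
      v (x - ρ t x - algebraMap E L a) < v (algebraMap E L t) := by
    intro t x
    by_cases hx : x - ρ t x = 0
    · refine ⟨0, fun ht => ?_⟩
      rw [hx]
      simpa [v.pos_iff] using ht
    · obtain ⟨a, ha⟩ := h _ hx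
      exact ⟨a, fun _ => ha.trans_le (hρ t x)⟩
  choose f hf using hex
  refine ⟨fun x t => f t x, fun x y hxy => ?_⟩
  by_contra hne
  obtain ⟨t, ht⟩ := h.exists_value_eq (x - y)
  have ht0 : t ≠ 0 := by
    rintro rfl
    rw [map_zero, map_zero, eq_comm, v.zero_iff, sub_eq_zero] at ht
    exact hne ht
  have h1 : ρ t x = ρ t y := congrArg Quotient.out (Quotient.sound (s := r t) ht.ge)
  have h2 : f t x = f t y := congrFun hxy t
  have h3 := hf t x ht0
  have h4 := hf t y ht0
  rw [h1, h2] at h3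
  have h5 := (v.map_sub _ _).trans_lt (max_lt h3 h4)
  rw [ht, show x - ρ t y - algebraMap E L (f t y) - (y - ρ t y - algebraMap E L (f t y)) = x - y by
    ring] at h5
  exact lt_irrefl _ h5

/-- An embedding of fields that respects given valuation rings respects the order of values. -/
theorem valuation_le_iff_of_mem_iff {A B : Type*} [Field A] [Field B] {W : ValuationSubring A}
    {V : ValuationSubring B} (φ : A →+* B) (h : ∀ x, φ x ∈ V ↔ x ∈ W) (x y : A) :
    W.valuation x ≤ W.valuation y ↔ V.valuation (φ x) ≤ V.valuation (φ y) := by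
  by_cases hy : y = 0
  · simp [hy]
  have hy' : φ y ≠ 0 := by simpa using hy
  rw [← div_le_one₀ (zero_lt_iff.2 (W.valuation.ne_zero_iff.2 hy)),
    ← div_le_one₀ (zero_lt_iff.2 (V.valuation.ne_zero_iff.2 hy')), ← map_div₀, ← map_div₀,
    ← map_div₀, W.valuation_le_one_iff, V.valuation_le_one_iff, h]

theorem valuation_lt_iff_of_mem_iff {A B : Type*} [Field A] [Field B] {W : ValuationSubring A}
    {V : ValuationSubring B} (φ : A →+* B) (h : ∀ x, φ x ∈ V ↔ x ∈ W) (x y : A) :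
    W.valuation x < W.valuation y ↔ V.valuation (φ x) < V.valuation (φ y) := by
  rw [← not_le, ← not_le, valuation_le_iff_of_mem_iff φ h]

theorem uniqueAlgEquiv_pderiv {E : Type*} [Field E] (G : MvPolynomial Unit E) :
    uniqueAlgEquiv E Unit (pderiv () G) = Polynomial.derivative (uniqueAlgEquiv E Unit G) := by
  have hX : uniqueAlgEquiv E Unit (X ()) = Polynomial.X := by
    rw [X, uniqueAlgEquiv_monomial]
    simp [Polynomial.monomial_one_one_eq_X]
  have hC : ∀ a, uniqueAlgEquiv E Unit (C a) = Polynomial.C a := fun a =>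
    (uniqueAlgEquiv E Unit).commutes a
  induction G using MvPolynomial.induction_on with
  | C a => rw [pderiv_C, map_zero, hC, Polynomial.derivative_C]
  | add f g hf hg => rw [map_add, map_add, map_add, map_add, hf, hg]
  | mul_X f j hf =>
    rw [Derivation.leibniz, pderiv_X_self, map_add, smul_eq_mul, smul_eq_mul, mul_one, map_mul, hf,
      map_mul, Polynomial.derivative_mul, hX, Polynomial.derivative_X]
    ring

theorem aeval_uniqueAlgEquiv {E L : Type*} [Field E] [Field L] [Algebra E L]
    (G : MvPolynomial Unit E) (x : L) :
    Polynomial.aeval x (uniqueAlgEquiv E Unit G) = aeval (fun _ => x) G := by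
  rw [← aeval_uniqueAlgEquiv_symm, AlgEquiv.symm_apply_apply]

variable {E L : Type*} [Field E] [Field L] [Algebra E L] {v : Valuation L Γ}

/-- If `G` is a polynomial of minimal degree that is not stable at a limit `b`, then the root of `G`
closest to `b` realizes the cut of `b`. -/
theorem exists_root_sameCut [IsAlgClosed L] (hv : ∀ n : ℕ, n ≠ 0 → v n = 1) {b : L}
    (hb : IsLimitOver E v b) {G : MvPolynomial Unit E} (hG : ¬ IsStable v b G)
    (hder : pderiv () G ≠ 0 → IsStable v b (pderiv () G)) :
    ∃ b', SameCut E v v b b' ∧ aeval (fun _ => b') G = 0 := by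
  classical
  by_cases hGb : aeval (fun _ => b) G = 0
  · exact ⟨b, SameCut.refl b, hGb⟩
  let P := (uniqueAlgEquiv E Unit G).map (algebraMap E L)
  have hPe : ∀ x, P.eval x = aeval (fun _ => x) G := fun x => by
    rw [← aeval_uniqueAlgEquiv, Polynomial.eval_map_algebraMap]
  have hPd : P.derivative.eval b = coeff (Finsupp.single () 1) (taylor (fun _ => b) G) := by
    have h1 := coeff_taylor_pderiv (fun _ : Unit => b) () G 0
    rw [coeff_zero_taylor, ← aeval_uniqueAlgEquiv, uniqueAlgEquiv_pderiv] at h1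
    simp only [P, Polynomial.derivative_map, Polynomial.eval_map_algebraMap]
    simpa using h1
  have hP0 : P.eval b ≠ 0 := by rwa [hPe]
  -- Near `b`, the logarithmic derivative of `G` at `b` has value at least `1 / v (b - a)`.
  obtain ⟨a₀, ha₀⟩ : ∃ a₀ : E, ∀ a : E, v (b - algebraMap E L a) ≤ v (b - algebraMap E L a₀) →
      v (P.eval b) ≤ v (P.derivative.eval b) * v (b - algebraMap E L a) := by
    obtain ⟨a₀, ha₀⟩ := exists_linear_dominance (E := E) (b := b) (G := G) hv strictMono_unit
      (τ := fun _ => RingEquiv.refl L) (fun _ => hder)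
    refine ⟨a₀, fun a ha => ?_⟩
    have hns : ∃ i ≠ 0, v (aeval (fun _ => b) G) ≤ v (coeff i (taylor (fun _ => b) G)) *
        monomialValue (fun (_ : Unit) (γ : Γ) => γ) i (v (b - algebraMap E L a)) := by
      by_contra! h
      exact hG ⟨a, h⟩
    obtain ⟨i, hi, hle⟩ := hns
    obtain ⟨_, k, rfl⟩ := monomialValue_ne_zero_split hi
    rw [hPe, hPd]
    refine hle.trans ?_
    rw [monomialValue_add, monomialValue_single, ← mul_assoc]
    gcongr
    by_cases hk : k = 0
    · rw [hk, monomialValue_zero, mul_one, zero_add]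
    by_cases h0 : pderiv () G = 0
    · -- The derivative of a nonconstant polynomial is not zero.
      rw [← valuation_coeff_taylor_pderiv hv, h0, map_zero, coeff_zero, map_zero, zero_mul]
      exact zero_le
    · exact (ha₀ a ha () h0 k hk).le
  have hsplit : P.Splits := IsAlgClosed.splits P
  -- If all roots were farther from `b` than `a`, the sum of the `1 / (b - z)` over the roots `z`, which
  -- is the logarithmic derivative, would have a value less than `1 / v (b - a)`.
  have hlog := hsplit.eval_derivative_div_eval_of_ne_zero hP0
  have hroot : ∀ a : E, v (b - algebraMap E L a) ≤ v (b - algebraMap E L a₀) →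
      ∃ z ∈ P.roots, v (b - z) ≤ v (b - algebraMap E L a) := by
    intro a ha
    by_contra! h
    have h1 := ha₀ a ha
    have hba : 0 < v (b - algebraMap E L a) := by
      rw [v.pos_iff, sub_ne_zero]
      exact hb.notMem a
    have h2 : v ((P.roots.map fun z => 1 / (b - z)).sum) < (v (b - algebraMap E L a))⁻¹ := by
      have : ∀ s : Multiset L, (∀ z ∈ s, v (b - algebraMap E L a) < v (b - z)) →
          v ((s.map fun z => 1 / (b - z)).sum) < (v (b - algebraMap E L a))⁻¹ := by
        intro s
        induction s using Multiset.induction_on with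
        | empty => intro _; simpa using hba
        | cons z s ih =>
          intro hs
          rw [Multiset.map_cons, Multiset.sum_cons]
          refine (v.map_add _ _).trans_lt (max_lt ?_ (ih fun z hz =>
            hs z (Multiset.mem_cons_of_mem hz)))
          have := hs z (Multiset.mem_cons_self _ _)
          rw [map_div₀, map_one, one_div]
          exact (inv_lt_inv₀ (hba.trans this) hba).2 this
      exact this _ h
    rw [← hlog, map_div₀, div_lt_iff₀ (v.pos_iff.2 hP0), inv_mul_eq_div, lt_div_iff₀ hba] at h2
    exact absurd h1 h2.not_ge
  have hne : P.roots.toFinset.Nonempty := by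
    obtain ⟨z, hz, -⟩ := hroot a₀ le_rfl
    exact ⟨z, Multiset.mem_toFinset.2 hz⟩
  obtain ⟨z, hz, hzmin⟩ := P.roots.toFinset.exists_min_image (fun z => v (b - z)) hne
  refine ⟨z, sameCut_of_forall_lt fun a => ?_, ?_⟩
  · have hle : ∀ a : E, v (b - algebraMap E L a) ≤ v (b - algebraMap E L a₀) →
        v (b - z) ≤ v (b - algebraMap E L a) := fun a ha => by
      obtain ⟨y, hy, hya⟩ := hroot a ha
      exact (hzmin y (Multiset.mem_toFinset.2 hy)).trans hya
    rw [v.map_sub_swap]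
    rcases le_total (v (b - algebraMap E L a)) (v (b - algebraMap E L a₀)) with h | h
    · obtain ⟨a', ha'⟩ := hb a
      exact (hle a' (ha'.le.trans h)).trans_lt ha'
    · obtain ⟨a', ha'⟩ := hb a₀
      exact (hle a' ha'.le).trans_lt (ha'.trans_le h)
  · rw [← hPe]
    exact (Polynomial.mem_roots'.1 (Multiset.mem_toFinset.1 hz)).2

/-- The cut of a limit is realized in an algebraically closed field by an element that generates an
immediate extension. -/
theorem exists_sameCut_adjoin_immediate [IsAlgClosed L] (hv : ∀ n : ℕ, n ≠ 0 → v n = 1) {b : L}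
    (hb : IsLimitOver E v b) :
    ∃ b', SameCut E v v b b' ∧ ∀ x ∈ IntermediateField.adjoin E {b'}, x ≠ 0 →
      ∃ a : E, v (x - algebraMap E L a) < v x := by
  have hτ := isValuedAction_unit (E := E) (v := v)
  suffices ∃ b', SameCut E v v b b' ∧ ∀ G : MvPolynomial Unit E, aeval (fun _ => b') G ≠ 0 →
      ∃ a : E, v (aeval (fun _ => b') G - algebraMap E L a) < v (aeval (fun _ => b') G) by
    obtain ⟨b', hb', h⟩ := this
    refine ⟨b', hb', fun x hx hx0 => ?_⟩
    obtain ⟨r, s, rfl⟩ := (IntermediateField.mem_adjoin_simple_iff E x).1 hx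
    rw [div_ne_zero_iff] at hx0
    rw [← aeval_uniqueAlgEquiv_symm, ← aeval_uniqueAlgEquiv_symm] at hx0 ⊢
    obtain ⟨a, ha⟩ := h _ hx0.1
    obtain ⟨c, hc⟩ := h _ hx0.2
    generalize aeval (fun _ => b') ((uniqueAlgEquiv E Unit).symm r) = y at *
    generalize aeval (fun _ => b') ((uniqueAlgEquiv E Unit).symm s) = z at *
    have hcz : v (algebraMap E L c) = v z := v.map_eq_of_sub_lt (by rwa [v.map_sub_swap])
    have hz := v.pos_iff.2 hx0.2
    have hc0 : algebraMap E L c ≠ 0 := by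
      rw [← v.pos_iff, hcz]
      exact hz
    have hay : v (algebraMap E L a) = v y := v.map_eq_of_sub_lt (by rwa [v.map_sub_swap])
    have hy := v.pos_iff.2 hx0.1
    refine ⟨a / c, ?_⟩
    have h1 : y / z - algebraMap E L (a / c) = ((y - algebraMap E L a) * algebraMap E L c -
        algebraMap E L a * (z - algebraMap E L c)) / (z * algebraMap E L c) := by
      rw [map_div₀]
      have := hx0.2
      field_simp
      ring
    rw [h1, map_div₀, map_div₀, map_mul _ z, hcz, div_lt_div_iff₀ (mul_pos hz hz) hz, ← mul_assoc]
    gcongr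
    refine (v.map_sub _ _).trans_lt (max_lt ?_ ?_)
    · rw [map_mul, hcz]
      gcongr
    · rw [map_mul, hay]
      gcongr
  by_cases hall : ∀ G : MvPolynomial Unit E, G ≠ 0 → IsStable v b G
  · refine ⟨b, SameCut.refl b, fun G hG => ?_⟩
    obtain ⟨a, ha⟩ := (hall G (by rintro rfl; exact hG (map_zero _))).exists_approx hτ
      strictMono_unit
    exact ⟨_, ha a le_rfl⟩
  push Not at hall
  obtain ⟨G, -, hG0, hGs, hdeg, h𝒞, hst, hder⟩ := exists_minimal_not_isStableAt
    (E := E) (𝒮 := Set.univ) (fun _ _ _ => trivial)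
    (by obtain ⟨G, h1, h2⟩ := hall; exact ⟨G, trivial, h1, h2⟩)
  obtain ⟨b', hbb', hGb'⟩ := exists_root_sameCut hv hb hGs (hst _ (hder ()))
  refine ⟨b', hbb', fun F hF => ?_⟩
  obtain ⟨Q, R, rfl, hR⟩ := exists_division G F hdeg
  rw [map_add, map_mul, hGb', mul_zero, zero_add] at hF ⊢
  have hst' : IsStable v b' R := (isStableAt_iff_of_sameCut hv hv hτ hτ (fun _ => rfl) hbb' h𝒞 hst R
    (h𝒞 R ⟨trivial, hR⟩)).1 (hst R ⟨trivial, hR⟩ (by rintro rfl; exact hF (map_zero _)))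
  obtain ⟨a, ha⟩ := hst'.exists_approx hτ strictMono_unit
  exact ⟨_, ha a le_rfl⟩

end Existence

/-! ### Existence of spherically complete immediate extensions -/

section Completion

open Cardinal

/-- If the balls of the family `S` over `E` meet pairwise and `b` is transcendental over `E`, then a
valuation ring of `E` extends to one of `L` for which `b` belongs to all the balls. -/
theorem exists_valuationSubring_mem_balls {E L : Type*} [Field E] [Field L] [Algebra E L]
    (W : ValuationSubring E) {b : L} (hb : Transcendental E b) {S : Set (E × E)} (hS : S.Nonempty)
    (hS0 : ∀ p ∈ S, p.2 ≠ 0) (hpair : ∀ p ∈ S, ∀ q ∈ S,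
      W.valuation (p.1 - q.1) ≤ max (W.valuation p.2) (W.valuation q.2)) :
    ∃ V : ValuationSubring L, (∀ a, algebraMap E L a ∈ V ↔ a ∈ W) ∧
      ∀ p ∈ S, V.valuation (b - algebraMap E L p.1) ≤ V.valuation (algebraMap E L p.2) := by
  -- The polynomials that are eventually integral on the centres of the balls.
  have hcomb : ∀ P Q T : E → Prop, (∀ a, P a → Q a → T a) →
      (∃ p ∈ S, ∀ q ∈ S, W.valuation q.2 ≤ W.valuation p.2 → P q.1) →
      (∃ p ∈ S, ∀ q ∈ S, W.valuation q.2 ≤ W.valuation p.2 → Q q.1) →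
      ∃ p ∈ S, ∀ q ∈ S, W.valuation q.2 ≤ W.valuation p.2 → T q.1 := by
    intro P Q T h
    rintro ⟨p, hp, hpP⟩ ⟨p', hp', hpQ⟩
    rcases le_total (W.valuation p.2) (W.valuation p'.2) with hle | hle
    · exact ⟨p, hp, fun q hq hqp => h _ (hpP q hq hqp) (hpQ q hq (hqp.trans hle))⟩
    · exact ⟨p', hp', fun q hq hqp => h _ (hpP q hq (hqp.trans hle)) (hpQ q hq hqp)⟩
  obtain ⟨p₀, hp₀⟩ := hS
  let R : Subring (Polynomial E) :=
    { carrier := {P | ∃ p ∈ S, ∀ q ∈ S, W.valuation q.2 ≤ W.valuation p.2 →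
        W.valuation (P.eval q.1) ≤ 1}
      mul_mem' := fun {P Q} => hcomb (fun a => W.valuation (P.eval a) ≤ 1)
        (fun a => W.valuation (Q.eval a) ≤ 1) (fun a => W.valuation ((P * Q).eval a) ≤ 1)
        fun a hP hQ => by
          rw [Polynomial.eval_mul, map_mul]
          exact mul_le_one' hP hQ
      one_mem' := ⟨p₀, hp₀, fun q _ _ => by simp⟩
      add_mem' := fun {P Q} => hcomb (fun a => W.valuation (P.eval a) ≤ 1)
        (fun a => W.valuation (Q.eval a) ≤ 1) (fun a => W.valuation ((P + Q).eval a) ≤ 1)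
        fun a hP hQ => by
          rw [Polynomial.eval_add]
          exact (W.valuation.map_add _ _).trans (max_le hP hQ)
      zero_mem' := ⟨p₀, hp₀, fun q _ _ => by simp⟩
      neg_mem' := fun {P} hP => by simpa using hP }
  let I : Ideal R :=
    { carrier := {P | ∃ p ∈ S, ∀ q ∈ S, W.valuation q.2 ≤ W.valuation p.2 →
        W.valuation (P.1.eval q.1) < 1}
      add_mem' := fun {P Q} => hcomb (fun a => W.valuation (P.1.eval a) < 1)
        (fun a => W.valuation (Q.1.eval a) < 1) (fun a => W.valuation ((P + Q).1.eval a) < 1)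
        fun a hP hQ => by
          rw [Subring.coe_add, Polynomial.eval_add]
          exact (W.valuation.map_add _ _).trans_lt (max_lt hP hQ)
      zero_mem' := ⟨p₀, hp₀, fun q _ _ => by simp⟩
      smul_mem' := fun P Q => hcomb (fun a => W.valuation (P.1.eval a) ≤ 1)
        (fun a => W.valuation (Q.1.eval a) < 1) (fun a => W.valuation ((P • Q).1.eval a) < 1)
        (fun a hP hQ => by
          rw [smul_eq_mul, Subring.coe_mul, Polynomial.eval_mul, map_mul]
          exact (mul_le_of_le_one_left' hP).trans_lt hQ) P.2 }
  let φ : Polynomial E →+* L := (Polynomial.aeval b : Polynomial E →ₐ[E] L)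
  have hφ : Function.Injective φ := transcendental_iff_injective.1 hb
  let ψ : R →+* R.map φ := φ.restrict R (R.map φ) fun P hP => ⟨P, hP, rfl⟩
  have hψ : Function.Surjective ψ := by
    rintro ⟨_, P, hP, rfl⟩
    exact ⟨⟨P, hP⟩, rfl⟩
  have hI : I.map ψ ≠ ⊤ := by
    rw [Ideal.ne_top_iff_one, Ideal.mem_map_iff_of_surjective _ hψ]
    rintro ⟨P, ⟨p, hp, hpP⟩, hP1⟩
    have h1 : φ P.1 = 1 := congrArg Subtype.val hP1
    have h2 : P.1 = 1 := hφ (by rw [h1, map_one])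
    have := hpP p hp le_rfl
    rw [h2] at this
    simp at this
  obtain ⟨V, hV, hVI⟩ := Ideal.image_subset_nonunits_valuationSubring _ hI
  have hmem : ∀ P ∈ R, φ P ∈ V := fun P hP => hV ⟨P, hP, rfl⟩
  have hmax : ∀ P (hP : P ∈ R), ⟨P, hP⟩ ∈ I → V.valuation (φ P) < 1 := fun P hP hPI =>
    (V.mem_nonunits_iff).1 (hVI ⟨ψ ⟨P, hP⟩, Ideal.mem_map_of_mem _ hPI, rfl⟩)
  have hφC : ∀ a, φ (Polynomial.C a) = algebraMap E L a := fun a => Polynomial.aeval_C b a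
  have hCR : ∀ a ∈ W, Polynomial.C a ∈ R := fun a ha => ⟨p₀, hp₀, fun q _ _ => by
    rw [Polynomial.eval_C]
    exact (W.valuation_le_one_iff a).2 ha⟩
  refine ⟨V, fun a => ⟨fun ha => ?_, fun ha => ?_⟩, fun p hp => ?_⟩
  · by_contra haW
    have h1 : W.valuation a⁻¹ < 1 := by
      rw [map_inv₀]
      rw [← W.valuation_le_one_iff, not_le] at haW
      exact inv_lt_one_of_one_lt₀ haW
    have h2 := hmax (Polynomial.C a⁻¹) (hCR _ ((W.valuation_le_one_iff _).1 h1.le))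
      ⟨p₀, hp₀, fun q _ _ => by simpa using h1⟩
    have ha0 : algebraMap E L a ≠ 0 := by
      rintro h
      rw [map_eq_zero] at h
      exact haW (h ▸ W.zero_mem)
    rw [hφC, map_inv₀, map_inv₀, inv_lt_one₀ (V.valuation.pos_iff.2 ha0)] at h2
    exact h2.not_ge ((V.valuation_le_one_iff _).2 ha)
  · rw [← hφC]
    exact hmem _ (hCR a ha)
  · have hp2 : algebraMap E L p.2 ≠ 0 := by simpa using hS0 p hp
    have h1 := hmem ((Polynomial.X - Polynomial.C p.1) * Polynomial.C p.2⁻¹)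
      ⟨p, hp, fun q hq hqp => by
        have := hpair q hq p hp
        rw [max_eq_right hqp] at this
        have h0 := W.valuation.pos_iff.2 (hS0 p hp)
        simp only [Polynomial.eval_mul, Polynomial.eval_sub, Polynomial.eval_X, Polynomial.eval_C,
          map_mul, map_inv₀]
        rwa [← div_eq_mul_inv, div_le_one₀ h0]⟩
    rw [map_mul, map_sub, hφC, hφC, show φ Polynomial.X = b from Polynomial.aeval_X b, map_inv₀,
      ← div_eq_mul_inv, ← V.valuation_le_one_iff, map_div₀,
      div_le_one₀ (V.valuation.pos_iff.2 hp2)] at h1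
    exact h1

/-- The limit of a family of valuation rings along an ultrafilter. -/
def ultrafilterLimit {L ι : Type*} [Field L] (U : Ultrafilter ι) (V : ι → ValuationSubring L) :
    ValuationSubring L where
  carrier := {x | ∀ᶠ i in U, x ∈ V i}
  mul_mem' hx hy := by
    filter_upwards [hx, hy] with i h1 h2 using (V i).mul_mem _ _ h1 h2
  one_mem' := Filter.Eventually.of_forall fun i => (V i).one_mem
  add_mem' hx hy := by
    filter_upwards [hx, hy] with i h1 h2 using (V i).add_mem _ _ h1 h2
  zero_mem' := Filter.Eventually.of_forall fun i => (V i).zero_mem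
  neg_mem' hx := by
    filter_upwards [hx] with i h1 using (V i).neg_mem _ h1
  mem_or_inv_mem' x := by
    rcases U.em fun i => x ∈ V i with h | h
    · exact Or.inl h
    · refine Or.inr ?_
      filter_upwards [h] with i hi using ((V i).mem_or_inv_mem x).resolve_left hi

/-- `F`, with the valuation ring that `V` induces on it, is an immediate extension of `L` with the
valuation ring `O`. -/
structure IsImmediateIn {L Ω : Type*} [Field L] [Field Ω] [Algebra L Ω] (O : ValuationSubring L)
    (F : IntermediateField L Ω) (V : ValuationSubring Ω) : Prop where
  mem_iff : ∀ a, algebraMap L Ω a ∈ V ↔ a ∈ O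
  approx : ∀ b ∈ F, b ≠ 0 → ∃ a, V.valuation (b - algebraMap L Ω a) < V.valuation b

/-- Being an immediate extension depends only on the valuation ring that `V` induces on `F`. -/
theorem IsImmediateIn.congr {L Ω : Type*} [Field L] [Field Ω] [Algebra L Ω]
    {O : ValuationSubring L} {F : IntermediateField L Ω} {V V' : ValuationSubring Ω}
    (h : IsImmediateIn O F V) (hV : ∀ x ∈ F, x ∈ V' ↔ x ∈ V) : IsImmediateIn O F V' := by
  refine ⟨fun a => (hV _ (F.algebraMap_mem a)).trans (h.mem_iff a), fun b hb hb0 => ?_⟩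
  obtain ⟨a, ha⟩ := h.approx b hb hb0
  refine ⟨a, ?_⟩
  have h1 := valuation_lt_iff_of_mem_iff (W := V.comap (algebraMap F Ω)) (V := V)
    (algebraMap F Ω) (fun x => Iff.rfl) (⟨b, hb⟩ - algebraMap L F a) ⟨b, hb⟩
  have h2 := valuation_lt_iff_of_mem_iff (W := V.comap (algebraMap F Ω)) (V := V')
    (algebraMap F Ω) (fun x => hV x x.2) (⟨b, hb⟩ - algebraMap L F a) ⟨b, hb⟩
  exact h2.1 (h1.2 ha)

/-- There is a maximal immediate extension inside a given algebraically closed field. -/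
theorem exists_maximal_isImmediateIn {L Ω : Type*} [Field L] [Field Ω] [Algebra L Ω]
    (O : ValuationSubring L) :
    ∃ (F : IntermediateField L Ω) (V : ValuationSubring Ω), IsImmediateIn O F V ∧
      ∀ F' V', IsImmediateIn O F' V' → F ≤ F' → (∀ x ∈ F, x ∈ V' ↔ x ∈ V) → F' ≤ F := by
  let T := {p : IntermediateField L Ω × ValuationSubring Ω // IsImmediateIn O p.1 p.2}
  let r : T → T → Prop := fun p q => p.1.1 ≤ q.1.1 ∧ ∀ x ∈ p.1.1, x ∈ q.1.2 ↔ x ∈ p.1.2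
  have hrefl : ∀ p, r p p := fun p => ⟨le_rfl, fun _ _ => Iff.rfl⟩
  have htrans : ∀ {p q d}, r p q → r q d → r p d := fun h1 h2 =>
    ⟨h1.1.trans h2.1, fun x hx => (h2.2 x (h1.1 hx)).trans (h1.2 x hx)⟩
  have hT : Nonempty T := by
    let A : Subring Ω := O.toSubring.map (algebraMap L Ω)
    let ψ : O →+* A := ((algebraMap L Ω).comp O.subtype).codRestrict A fun x => ⟨x, x.2, rfl⟩
    have hψ : Function.Surjective ψ := by
      rintro ⟨_, x, hx, rfl⟩
      exact ⟨⟨x, hx⟩, rfl⟩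
    have hI : (Ideal.map ψ (IsLocalRing.maximalIdeal O)) ≠ ⊤ := by
      rw [Ideal.ne_top_iff_one, Ideal.mem_map_iff_of_surjective _ hψ]
      rintro ⟨x, hx, hx1⟩
      have h1 : algebraMap L Ω x.1 = 1 := congrArg Subtype.val hx1
      rw [map_eq_one_iff _ (algebraMap L Ω).injective] at h1
      exact (IsLocalRing.mem_maximalIdeal x).1 hx (by
        rw [show x = 1 from Subtype.ext h1]
        exact isUnit_one)
    obtain ⟨V, hV, hVI⟩ := Ideal.image_subset_nonunits_valuationSubring _ hI
    refine ⟨⟨(⊥, V), fun a => ⟨fun ha => ?_, fun ha => hV ⟨a, ha, rfl⟩⟩, ?_⟩⟩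
    · by_contra haO
      have h1 : O.valuation a⁻¹ < 1 := by
        rw [map_inv₀]
        rw [← O.valuation_le_one_iff, not_le] at haO
        exact inv_lt_one_of_one_lt₀ haO
      have h2 : (⟨a⁻¹, (O.valuation_le_one_iff _).1 h1.le⟩ : O) ∈ IsLocalRing.maximalIdeal O :=
        (O.valuation_lt_one_iff _).2 h1
      have h3 := (V.mem_nonunits_iff).1 (hVI ⟨ψ _, Ideal.mem_map_of_mem ψ h2, rfl⟩)
      have h4 : V.valuation (algebraMap L Ω a⁻¹) < 1 := h3
      have ha0 : algebraMap L Ω a ≠ 0 := by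
        rintro h
        rw [map_eq_zero] at h
        exact haO (h ▸ O.zero_mem)
      rw [map_inv₀, map_inv₀, inv_lt_one₀ (V.valuation.pos_iff.2 ha0)] at h4
      exact h4.not_ge ((V.valuation_le_one_iff _).2 ha)
    · rintro b hb hb0
      obtain ⟨a, rfl⟩ := IntermediateField.mem_bot.1 hb
      exact ⟨a, by simpa [V.valuation.pos_iff] using hb0⟩
  obtain ⟨⟨⟨F, V⟩, hFV⟩, hmax⟩ := exists_maximal_of_chains_bounded (r := r) (by
    intro c hc
    rcases c.eq_empty_or_nonempty with rfl | ⟨p₀, hp₀⟩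
    · exact ⟨hT.some, fun _ h => h.elim⟩
    have hdir : ∀ p ∈ c, ∀ q ∈ c, r p q ∨ r q p := fun p hp q hq => by
      rcases eq_or_ne p q with rfl | hne
      · exact Or.inl (hrefl p)
      · exact hc hp hq hne
    have : Nonempty c := ⟨⟨p₀, hp₀⟩⟩
    have hne : (⨅ p : c, Filter.principal {q : c | r p q}).NeBot := by
      refine Filter.iInf_neBot_of_directed (fun p q => ?_) fun p =>
        Filter.principal_neBot_iff.2 ⟨p, hrefl p⟩
      have hle : ∀ p q : c, r p q → Filter.principal {x : c | r q x} ≤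
          Filter.principal {x : c | r p x} := fun p q h =>
        Filter.principal_mono.2 fun x hx => htrans h hx
      rcases hdir p p.2 q q.2 with h | h
      · exact ⟨q, hle p q h, le_rfl⟩
      · exact ⟨p, le_rfl, hle q p h⟩
    -- An upper bound of a chain is the union of the fields with the limit of the valuation rings along
    -- an ultrafilter that contains all end segments: on each field of the chain they are constant from
    -- some point on.
    let U : Ultrafilter c := Ultrafilter.of (⨅ p : c, Filter.principal {q : c | r p q})
    let V := ultrafilterLimit U fun p : c => p.1.1.2
    have hV : ∀ p ∈ c, ∀ x ∈ p.1.1, x ∈ V ↔ x ∈ p.1.2 := by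
      intro p hp x hx
      have h1 : ∀ᶠ q : c in U, r p q := Ultrafilter.of_le _
        (Filter.mem_iInf_of_mem ⟨p, hp⟩ (Filter.mem_principal_self _))
      constructor
      · intro h
        obtain ⟨q, hq1, hq2⟩ := (h1.and h).exists
        exact (hq1.2 x hx).1 hq2
      · intro h
        filter_upwards [h1] with q hq using (hq.2 x hx).2 h
    have hgood : ∀ p ∈ c, IsImmediateIn O p.1.1 V := fun p hp => p.2.congr (hV p hp)
    have hdirF : Directed (· ≤ ·) fun p : c => p.1.1.1 := fun p q => by
      rcases hdir p p.2 q q.2 with h | h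
      · exact ⟨q, h.1, le_rfl⟩
      · exact ⟨p, le_rfl, h.1⟩
    refine ⟨⟨(⨆ p : c, p.1.1.1, V), (hgood p₀ hp₀).mem_iff, fun b hb => ?_⟩, fun p hp =>
      ⟨le_iSup (fun p : c => p.1.1.1) ⟨p, hp⟩, hV p hp⟩⟩
    rw [← SetLike.mem_coe, IntermediateField.coe_iSup_of_directed hdirF, Set.mem_iUnion] at hb
    obtain ⟨p, hp⟩ := hb
    exact (hgood p p.2).approx b hp) htrans
  exact ⟨F, V, hFV, fun F' V' h h1 h2 => (hmax ⟨(F', V'), h⟩ ⟨h1, h2⟩).1⟩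

/-- A valued field of residue characteristic zero has a spherically complete immediate extension. -/
theorem exists_sphericallyComplete_extension {L : Type u} [Field L] (O : ValuationSubring L)
    (hO : ∀ n : ℕ, n ≠ 0 → O.valuation n = 1) :
    ∃ (M : Type u) (_ : Field M) (_ : Algebra L M) (V : ValuationSubring M),
      (∀ a, algebraMap L M a ∈ V ↔ a ∈ O) ∧ IsImmediateOver L V.valuation ∧
      SphericallyComplete V.valuation := by
  have : CharZero L := charZero_of_valuation hO
  -- An algebraically closed field of cardinality larger than Krull's bound.
  let Ω := AlgebraicClosure (FractionRing (MvPolynomial (Set (L → L)) L))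
  have hΩ : #(L → L) < #Ω := by
    refine (cantor #(L → L)).trans_le ?_
    rw [← Cardinal.mk_set]
    refine Cardinal.mk_le_of_injective (f := fun s : Set (L → L) => algebraMap
      (FractionRing (MvPolynomial (Set (L → L)) L)) Ω
      (algebraMap (MvPolynomial (Set (L → L)) L) _ (X s))) ?_
    exact (FaithfulSMul.algebraMap_injective
      (FractionRing (MvPolynomial (Set (L → L)) L)) Ω).comp ((IsFractionRing.injective _ _).comp
      (MvPolynomial.X_injective))
  obtain ⟨F, V, hFV, hmax⟩ := exists_maximal_isImmediateIn (Ω := Ω) O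
  let W : ValuationSubring F := V.comap (algebraMap F Ω)
  have hWV := valuation_le_iff_of_mem_iff (W := W) (V := V) (algebraMap F Ω) fun _ => Iff.rfl
  have hWV' := valuation_lt_iff_of_mem_iff (W := W) (V := V) (algebraMap F Ω) fun _ => Iff.rfl
  have himm : IsImmediateOver L W.valuation := by
    intro b hb
    obtain ⟨a, ha⟩ := hFV.approx b b.2 (by simpa using hb)
    exact ⟨a, (hWV' _ _).2 ha⟩
  refine ⟨F, inferInstance, inferInstance, W, hFV.mem_iff, himm, fun S hS => ?_⟩
  by_contra! hempty
  have hS0 : ∀ p ∈ S, p.2 ≠ 0 := by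
    intro p hp h0
    obtain ⟨q, hq, hlt⟩ := hempty p.1
    have := hS p hp q hq
    rw [h0, map_zero, max_eq_right zero_le] at this
    exact hlt.not_ge this
  have hSne : S.Nonempty := by
    obtain ⟨q, hq, -⟩ := hempty 0
    exact ⟨q, hq⟩
  -- A family of balls without a common point would give, at a transcendental `b`, a valuation on `Ω`
  -- for which `b` is a limit over `F`, and hence a larger immediate extension.
  obtain ⟨b, hb⟩ : ∃ b : Ω, Transcendental F b := by
    have h : ¬ Algebra.IsAlgebraic F Ω := by
      intro h
      have h1 := Algebra.IsAlgebraic.cardinalMk_le_max F Ω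
      obtain ⟨f, hf⟩ := himm.exists_injective
      have h2 := Cardinal.mk_le_of_injective hf
      have h3 : ℵ₀ ≤ #(L → L) := Cardinal.aleph0_le_mk _
      exact (h1.trans (max_le h2 h3)).not_gt hΩ
    rw [← Algebra.transcendental_iff_not_isAlgebraic] at h
    exact h.1
  obtain ⟨V', hV', hbS⟩ := exists_valuationSubring_mem_balls W hb hSne hS0 hS
  have hFV' : IsImmediateIn O F V' := hFV.congr fun x hx => hV' ⟨x, hx⟩
  have hW := valuation_lt_iff_of_mem_iff (W := W) (V := V') (algebraMap F Ω) hV'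
  have hlim : IsLimitOver F V'.valuation b := by
    intro a
    obtain ⟨p, hp, hlt⟩ := hempty a
    have h1 := (hbS p hp).trans_lt ((hW _ _).1 hlt)
    rw [map_sub (algebraMap F Ω)] at h1
    refine ⟨p.1, ?_⟩
    rwa [show b - algebraMap F Ω a = (b - algebraMap F Ω p.1) -
      (algebraMap F Ω a - algebraMap F Ω p.1) by ring, V'.valuation.map_sub_eq_of_lt_right h1]
  have hchar : ∀ n : ℕ, n ≠ 0 → V'.valuation n = 1 := by
    intro n hn
    have h1 := valuation_le_iff_of_mem_iff (W := O) (V := V') (algebraMap L Ω) hFV'.mem_iff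
    have h2 := h1 n 1
    have h3 := h1 1 n
    rw [map_one, map_one, hO n hn, map_one, map_natCast] at h2 h3
    exact le_antisymm (h2.1 le_rfl) (h3.1 le_rfl)
  obtain ⟨b', hbb', hb'⟩ := exists_sameCut_adjoin_immediate hchar hlim
  let F' : IntermediateField L Ω := (IntermediateField.adjoin F {b'}).restrictScalars L
  have hFF' : F ≤ F' := fun x hx => (IntermediateField.adjoin F {b'}).algebraMap_mem ⟨x, hx⟩
  have hle := hmax F' V' ⟨hFV'.mem_iff, fun x hx hx0 => by
    obtain ⟨y, hy⟩ := hb' x hx hx0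
    have hyx : V'.valuation y.1 = V'.valuation x :=
      V'.valuation.map_eq_of_sub_lt (by rw [V'.valuation.map_sub_swap]; exact hy)
    have hy0 : y.1 ≠ 0 := by
      rwa [← V'.valuation.ne_zero_iff, hyx, V'.valuation.ne_zero_iff]
    obtain ⟨a, ha⟩ := hFV'.approx y.1 y.2 hy0
    refine ⟨a, ?_⟩
    rw [show x - algebraMap L Ω a = (x - y.1) + (y.1 - algebraMap L Ω a) by ring]
    exact (V'.valuation.map_add _ _).trans_lt (max_lt hy (ha.trans_eq hyx))⟩ hFF' fun x hx =>
      hV' ⟨x, hx⟩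
  have hbF : b' ∈ F := hle (IntermediateField.mem_adjoin_simple_self F b')
  exact (hbb'.isLimitOver hlim).notMem ⟨b', hbF⟩ rfl

end Completion

/-! ### From valuations to valued difference fields -/

section Transport

variable {Γ Γ' : Type*} [LinearOrderedCommGroupWithZero Γ] [LinearOrderedCommGroupWithZero Γ']
variable {E L L₁ L₂ : Type*} [Field E] [Field L] [Field L₁] [Field L₂] [Algebra E L]

theorem SphericallyComplete.of_surjective {v₁ : Valuation L₁ Γ} {v₂ : Valuation L₂ Γ'}
    (h : SphericallyComplete v₁) (φ : L₁ →+* L₂) (hφ : Function.Surjective φ)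
    (hle : ∀ x y, v₁ x ≤ v₁ y ↔ v₂ (φ x) ≤ v₂ (φ y)) : SphericallyComplete v₂ := by
  intro S hS
  obtain ⟨x, hx⟩ := h {p | (φ p.1, φ p.2) ∈ S} (by
    rintro p hp q hq
    have := hS _ hp _ hq
    rw [le_max_iff] at this ⊢
    rwa [hle, hle, map_sub])
  refine ⟨φ x, ?_⟩
  rintro ⟨c, t⟩ hp
  obtain ⟨c, rfl⟩ := hφ c
  obtain ⟨t, rfl⟩ := hφ t
  have := (hle _ _).1 (hx (c, t) hp)
  rwa [map_sub] at this

theorem IsImmediateOver.of_equiv {v : Valuation L Γ} {v' : Valuation L Γ'}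
    (h : IsImmediateOver E v) (hle : ∀ x y, v' x ≤ v' y ↔ v x ≤ v y) : IsImmediateOver E v' := by
  intro b hb
  obtain ⟨a, ha⟩ := h b hb
  exact ⟨a, by rwa [← not_le, hle, not_le]⟩

theorem IsImmediateOver.trans {K L M : Type*} [Field K] [Field L] [Field M] [Algebra K L]
    [Algebra L M] [Algebra K M] [IsScalarTower K L M] {v : Valuation L Γ} {w : Valuation M Γ'}
    (h : IsImmediateOver K v) (h' : IsImmediateOver L w)
    (hle : ∀ x y, v x ≤ v y ↔ w (algebraMap L M x) ≤ w (algebraMap L M y)) :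
    IsImmediateOver K w := by
  intro b hb
  obtain ⟨y, hy⟩ := h' b hb
  have hyb : w (algebraMap L M y) = w b :=
    w.map_eq_of_sub_lt (by rwa [Valuation.map_sub_swap])
  have hy0 : y ≠ 0 := by
    rintro rfl
    rw [map_zero, map_zero, eq_comm, w.zero_iff] at hyb
    exact hb hyb
  obtain ⟨a, ha⟩ := h y hy0
  refine ⟨a, ?_⟩
  rw [IsScalarTower.algebraMap_apply K L M, show b - algebraMap L M (algebraMap K L a) =
    (b - algebraMap L M y) + algebraMap L M (y - algebraMap K L a) by rw [map_sub]; ring]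
  refine (w.map_add _ _).trans_lt (max_lt hy ?_)
  rw [← hyb]
  rwa [← not_le, ← hle, not_le]

/-- The valuation of an immediate extension takes its values, up to equivalence, in the value group
of the ground field. -/
theorem exists_valuation_of_isImmediateOver {v : Valuation E Γ} {w : Valuation L Γ'}
    (h : ∀ a b : E, v a ≤ v b ↔ w (algebraMap E L a) ≤ w (algebraMap E L b))
    (himm : IsImmediateOver E w) :
    ∃ w' : Valuation L Γ, (∀ a, w' (algebraMap E L a) = v a) ∧ ∀ x y, w' x ≤ w' y ↔ w x ≤ w y := by
  choose g hg using himm.exists_value_eq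
  have heq : ∀ a b : E, w (algebraMap E L a) = w (algebraMap E L b) → v a = v b := fun a b hab =>
    le_antisymm ((h _ _).2 hab.le) ((h _ _).2 hab.ge)
  have hle : ∀ x y, v (g x) ≤ v (g y) ↔ w x ≤ w y := fun x y => by rw [h, hg, hg]
  refine ⟨{
    toFun := fun x => v (g x)
    map_zero' := ?_
    map_one' := ?_
    map_mul' := ?_
    map_add_le_max' := ?_ }, fun a => heq _ _ (hg _), hle⟩
  · rw [heq (g 0) 0 (by rw [hg, map_zero, map_zero, map_zero]), map_zero]
  · rw [heq (g 1) 1 (by rw [hg, map_one, map_one, map_one]), map_one]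
  · intro x y
    rw [← map_mul]
    exact heq _ _ (by rw [hg, map_mul, map_mul, map_mul, hg, hg])
  · intro x y
    rw [le_max_iff, hle, hle, ← le_max_iff]
    exact w.map_add x y

/-- Kaplansky's uniqueness theorem, with the embeddings of the ground field made explicit. -/
theorem exists_ringEquiv_of_sphericallyComplete {v₁ : Valuation L₁ Γ} {v₂ : Valuation L₂ Γ}
    (i₁ : E →+* L₁) (i₂ : E →+* L₂) (hv₁ : ∀ n : ℕ, n ≠ 0 → v₁ n = 1)
    (hv₂ : ∀ n : ℕ, n ≠ 0 → v₂ n = 1) (hE : ∀ a, v₁ (i₁ a) = v₂ (i₂ a))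
    (himm₁ : ∀ b, b ≠ 0 → ∃ a, v₁ (b - i₁ a) < v₁ b)
    (himm₂ : ∀ b, b ≠ 0 → ∃ a, v₂ (b - i₂ a) < v₂ b)
    (hsc₁ : SphericallyComplete v₁) (hsc₂ : SphericallyComplete v₂) :
    ∃ f : L₁ ≃+* L₂, (∀ a, f (i₁ a) = i₂ a) ∧ ∀ x, v₂ (f x) = v₁ x := by
  let _ := i₁.toAlgebra
  let _ := i₂.toAlgebra
  obtain ⟨f, hf⟩ := exists_algEquiv_of_sphericallyComplete (E := E) hv₁ hv₂ hE himm₁ himm₂ hsc₁ hsc₂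
  exact ⟨f, fun a => f.commutes a, hf⟩

/-- Solvability of linear difference equations modulo the maximal ideal passes to immediate
extensions. -/
theorem IsLinearlyClosed.of_isImmediateOver {J : Type*} {v : Valuation E Γ} {w : Valuation L Γ}
    {τE : J → E ≃+* E} {τ : J → L ≃+* L} (h : IsLinearlyClosed v τE) (himm : IsImmediateOver E w)
    (hE : ∀ a, w (algebraMap E L a) = v a)
    (hτ : ∀ j a, τ j (algebraMap E L a) = algebraMap E L (τE j a))
    (hint : ∀ j a, v a ≤ 1 → v (τE j a) ≤ 1) : IsLinearlyClosed w τ := by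
  rintro S α hα ⟨k, hk, hαk⟩
  have happ : ∀ j, ∃ a : E, w (α j) ≤ 1 → w (α j - algebraMap E L a) < 1 := by
    intro j
    by_cases h0 : α j = 0
    · exact ⟨0, fun _ => by simp [h0]⟩
    · obtain ⟨a, ha⟩ := himm _ h0
      exact ⟨a, fun h1 => ha.trans_le h1⟩
  choose a ha using happ
  have ha1 : ∀ j ∈ S, v (a j) ≤ 1 := fun j hj => by
    rw [← hE, show algebraMap E L (a j) = α j - (α j - algebraMap E L (a j)) by ring]
    exact (w.map_sub _ _).trans (max_le (hα j hj) (ha j (hα j hj)).le)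
  have hak : v (a k) = 1 := by
    rw [← hE, ← hαk]
    refine w.map_eq_of_sub_lt ?_
    rw [w.map_sub_swap, hαk]
    exact ha k hαk.le
  obtain ⟨x, hx, hsum⟩ := h S a ha1 ⟨k, hk, hak⟩
  refine ⟨algebraMap E L x, by rwa [hE], ?_⟩
  have h1 : 1 + ∑ j ∈ S, α j * τ j (algebraMap E L x) =
      algebraMap E L (1 + ∑ j ∈ S, a j * τE j x) +
        ∑ j ∈ S, (α j - algebraMap E L (a j)) * τ j (algebraMap E L x) := by
    simp only [map_add, map_one, map_sum, map_mul, hτ, sub_mul, Finset.sum_sub_distrib]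
    ring
  rw [h1]
  refine (w.map_add _ _).trans_lt (max_lt (by rwa [hE]) (w.map_sum_lt one_ne_zero fun j hj => ?_))
  rw [map_mul, hτ, hE]
  exact (mul_le_of_le_one_right' (hint j x hx)).trans_lt (ha j (hα j hj))

end Transport

open ValuedDifferenceField

section Valued

variable {K : Type u} {L : Type v} {M : Type w} [Field K] [ValuedDifferenceField K]
  [Field L] [ValuedDifferenceField L] [Algebra K L]
  [Field M] [ValuedDifferenceField M] [Algebra L M]

theorem val_σ_le_iff (x y : K) : val K (σ x) ≤ val K (σ y) ↔ val K x ≤ val K y :=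
  (valuation_le_iff_of_mem_iff (W := O (K := K)) (V := O (K := K)) (σ (K := K) : K →+* K)
    (fun a => σ_mem_iff a) x y).symm

theorem val_algebraMap_le_iff [Extension K L] (x y : K) :
    val L (algebraMap K L x) ≤ val L (algebraMap K L y) ↔ val K x ≤ val K y :=
  (valuation_le_iff_of_mem_iff (algebraMap K L) (Extension.mem_O_iff) x y).symm

/-- Residue characteristic zero means that the nonzero integers are units of the valuation ring. -/
theorem val_natCast [CharZero (Residue K)] (n : ℕ) (hn : n ≠ 0) : val K n = 1 := by
  have h1 : IsLocalRing.residue (O (K := K)) (n : O (K := K)) ≠ 0 := by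
    rw [map_natCast]
    exact Nat.cast_ne_zero.2 hn
  rw [IsLocalRing.residue_ne_zero_iff_isUnit] at h1
  exact ((O (K := K)).valuation_eq_one_iff _).1 h1

theorem val_natCast_of_extension [Extension K L] (h : ∀ n : ℕ, n ≠ 0 → val K n = 1) (n : ℕ)
    (hn : n ≠ 0) : val L n = 1 := by
  have h1 := val_algebraMap_le_iff (L := L) (n : K) 1
  have h2 := val_algebraMap_le_iff (L := L) 1 (n : K)
  rw [h n hn, map_one, map_one, map_natCast, map_one] at h1 h2
  exact le_antisymm (h1.2 le_rfl) (h2.2 le_rfl)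

theorem residue_eq_iff (a b : O (K := K)) : IsLocalRing.residue (O (K := K)) a =
    IsLocalRing.residue (O (K := K)) b ↔ val K (a.1 - b.1) < 1 := by
  rw [← sub_eq_zero, ← map_sub, IsLocalRing.residue_eq_zero_iff]
  exact (O (K := K)).valuation_lt_one_iff (a - b)

theorem isImmediate_iff [Extension K L] : IsImmediate K L ↔ IsImmediateOver K (val L) := by
  constructor
  · intro h b hb
    obtain ⟨a, ha⟩ := h.value b
    have hb' := (val L).pos_iff.2 hb
    have ha0 : algebraMap K L a ≠ 0 := by
      rwa [← (val L).pos_iff, ha]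
    have hba : val L (b / algebraMap K L a) ≤ 1 := by
      rw [map_div₀, ha, div_self hb'.ne']
    obtain ⟨c, hc⟩ := h.residue ⟨_, ((O (K := L)).valuation_le_one_iff _).1 hba⟩
    rw [residue_eq_iff, Valuation.map_sub_swap] at hc
    refine ⟨a * c, ?_⟩
    have h1 : b - algebraMap K L (a * c) =
        algebraMap K L a * (b / algebraMap K L a - (intMap K L c).1) := by
      rw [map_mul, mul_sub, mul_div_cancel₀ _ ha0]
      rfl
    rw [h1, map_mul, ha]
    exact mul_lt_of_lt_one_right hb' hc
  · intro h
    refine ⟨h.exists_value_eq, fun b => ?_⟩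
    obtain ⟨a, ha⟩ : ∃ a : K, val L (b.1 - algebraMap K L a) < 1 := by
      by_cases hb : b.1 = 0
      · exact ⟨0, by simp [hb]⟩
      · obtain ⟨a, ha⟩ := h _ hb
        exact ⟨a, ha.trans_le (((O (K := L)).valuation_le_one_iff _).2 b.2)⟩
    have haO : a ∈ O (K := K) := by
      rw [← Extension.mem_O_iff (L := L), ← (O (K := L)).valuation_le_one_iff,
        show algebraMap K L a = b.1 - (b.1 - algebraMap K L a) by ring]
      exact ((val L).map_sub _ _).trans
        (max_le (((O (K := L)).valuation_le_one_iff _).2 b.2) ha.le)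
    refine ⟨⟨a, haO⟩, ?_⟩
    rw [residue_eq_iff, Valuation.map_sub_swap]
    exact ha

theorem extension_trans [Extension K L] [Extension L M] [Algebra K M] [IsScalarTower K L M] :
    Extension K M := by
  refine ⟨fun a => ?_, fun a => ?_⟩
  · rw [IsScalarTower.algebraMap_apply K L M, Extension.mem_O_iff, Extension.mem_O_iff]
  · rw [IsScalarTower.algebraMap_apply K L M, Extension.map_σ, Extension.map_σ,
      ← IsScalarTower.algebraMap_apply K L M]

/-- A valued difference field of residue characteristic zero has an immediate extension that is
spherically complete. The difference operator extends to a spherically complete immediate extension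
of the valued field by Kaplansky's uniqueness theorem, applied to the inclusion and to its
composition with the difference operator. -/
theorem exists_sphericallyComplete_difference_extension (L : Type u) [Field L]
    [ValuedDifferenceField L] (hv : ∀ n : ℕ, n ≠ 0 → val L n = 1) :
    ∃ (M : Type u) (_ : Field M) (_ : ValuedDifferenceField M) (_ : Algebra L M)
      (_ : Extension L M), IsImmediateOver L (val M) ∧ SphericallyComplete (val M) := by
  obtain ⟨M, _, _, V, hV, himm, hsc⟩ := exists_sphericallyComplete_extension (O (K := L)) hv
  -- `w` is the valuation of `M` rescaled by `σ`, so that the embeddings `i` and `j = i ∘ σ` induce the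
  -- same valuation on `L`.
  let i : L →+* M := algebraMap L M
  let j : L →+* M := i.comp (σ (K := L) : L →+* L)
  have hi := fun x y => valuation_le_iff_of_mem_iff (W := O (K := L)) (V := V) i hV x y
  have hj : ∀ x y, V.valuation (i x) ≤ V.valuation (i y) ↔ V.valuation (j x) ≤ V.valuation (j y) :=
    fun x y => by
      rw [← hi, ← val_σ_le_iff]
      exact hi _ _
  have hvM : ∀ n : ℕ, n ≠ 0 → V.valuation n = 1 := fun n hn => by
    have h1 := hi n 1
    have h2 := hi 1 n
    rw [hv n hn, map_one, map_one, map_natCast, map_one] at h1 h2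
    exact le_antisymm (h1.1 le_rfl) (h2.1 le_rfl)
  have himmj : ∀ b, b ≠ 0 → ∃ a, V.valuation (b - j a) < V.valuation b := fun b hb => by
    obtain ⟨a, ha⟩ := himm b hb
    refine ⟨(σ (K := L)).symm a, ?_⟩
    change V.valuation (b - i (σ ((σ (K := L)).symm a))) < _
    rwa [RingEquiv.apply_symm_apply]
  obtain ⟨w, hw, hwle⟩ : ∃ w : Valuation M V.ValueGroup, (∀ a, w (j a) = V.valuation (i a)) ∧
      ∀ x y, w x ≤ w y ↔ V.valuation x ≤ V.valuation y := by
    let _ := j.toAlgebra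
    exact exists_valuation_of_isImmediateOver (E := L) (v := V.valuation.comap i)
      (w := V.valuation) hj himmj
  have hwlt : ∀ x y, w x < w y ↔ V.valuation x < V.valuation y := fun x y => by
    rw [← not_le, ← not_le, hwle]
  obtain ⟨f, hf, hfv⟩ := exists_ringEquiv_of_sphericallyComplete (v₁ := V.valuation) (v₂ := w) i j
    hvM (fun n hn => by
      have h1 := hwle n 1
      have h2 := hwle 1 n
      rw [hvM n hn, map_one, map_one] at h1 h2
      exact le_antisymm (h1.2 le_rfl) (h2.2 le_rfl))
    (fun a => (hw a).symm) himm (fun b hb => by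
      obtain ⟨a, ha⟩ := himmj b hb
      exact ⟨a, (hwlt _ _).2 ha⟩) hsc
    (hsc.of_surjective (RingHom.id M) Function.surjective_id fun x y => (hwle x y).symm)
  have hfV : ∀ x, f x ∈ V ↔ x ∈ V := fun x => by
    have h1 := hwle (f x) 1
    rw [map_one, map_one] at h1
    rw [← V.valuation_le_one_iff, ← V.valuation_le_one_iff, ← hfv x, h1]
  let _ : ValuedDifferenceField M :=
    { O := V
      σ := f
      image_O := by
        ext x
        constructor
        · rintro ⟨y, hy, rfl⟩
          exact (hfV y).2 hy
        · intro hx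
          exact ⟨f.symm x, (hfV _).1 (by rwa [RingEquiv.apply_symm_apply]), f.apply_symm_apply x⟩ }
  exact ⟨M, inferInstance, inferInstance, inferInstance, ⟨hV, fun a => (hf a).symm⟩, himm, hsc⟩

/-- A maximal valued difference field is spherically complete, since it coincides with a spherically
complete immediate extension. -/
theorem sphericallyComplete_of_isMaximal (hv : ∀ n : ℕ, n ≠ 0 → val L n = 1) (h : IsMaximal L) :
    SphericallyComplete (val L) := by
  obtain ⟨M, _, _, _, _, himm, hsc⟩ := exists_sphericallyComplete_difference_extension L hv
  have hsurj := h M (isImmediate_iff.2 himm)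
  let e : L ≃+* M := RingEquiv.ofBijective (algebraMap L M) ⟨(algebraMap L M).injective, hsurj⟩
  refine hsc.of_surjective (e.symm : M →+* L) e.symm.surjective fun x y => ?_
  have h1 := val_algebraMap_le_iff (L := M) (e.symm x) (e.symm y)
  have h2 : ∀ x, algebraMap L M (e.symm x) = x := e.apply_symm_apply
  rw [h2, h2] at h1
  exact h1

/-- Solving linear difference equations in the residue field means solving them in `K` modulo the
maximal ideal; an equation in the variables `j ∈ S` is padded by zero coefficients. -/
theorem isLinearlyClosed_of_residue (hK : ResidueLinearDifferenceClosed K) :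
    IsLinearlyClosed (val K) fun n : ℕ => (σ (K := K)) ^ n := by
  classical
  rintro S α hα ⟨k, hk, hαk⟩
  let a : ℕ → O (K := K) := fun i =>
    if h : i ∈ S then ⟨α i, ((O (K := K)).valuation_le_one_iff _).1 (hα i h)⟩ else 0
  have haS : ∀ i ∈ S, (a i).1 = α i := fun i hi => by simp [a, hi]
  have hσ : ∀ (i : ℕ) (x : O (K := K)), ((σInt K)^[i] x).1 = ((σ (K := K)) ^ i) x.1 := by
    intro i x
    induction i with
    | zero => rfl
    | succ i ih =>
      rw [Function.iterate_succ_apply', pow_succ_apply, ← ih]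
      rfl
  have hσBar : ∀ (i : ℕ) (x : O (K := K)), (σBar K)^[i] (IsLocalRing.residue _ x) =
      IsLocalRing.residue _ ((σInt K)^[i] x) := by
    intro i x
    induction i with
    | zero => rfl
    | succ i ih =>
      rw [Function.iterate_succ_apply', Function.iterate_succ_apply', ih]
      rfl
  let n := S.sup id
  have hn : ∀ i ∈ S, i < n + 1 := fun i hi => Nat.lt_succ_of_le (Finset.le_sup (f := id) hi)
  obtain ⟨x, hx⟩ := hK n (fun i => IsLocalRing.residue _ (a i)) ⟨⟨k, hn k hk⟩, by
    rw [IsLocalRing.residue_ne_zero_iff_isUnit]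
    refine ((O (K := K)).valuation_eq_one_iff _).2 ?_
    rw [haS k hk, hαk]⟩
  obtain ⟨x, rfl⟩ := IsLocalRing.residue_surjective x
  refine ⟨x.1, ((O (K := K)).valuation_le_one_iff _).2 x.2, ?_⟩
  have h1 : IsLocalRing.residue (O (K := K))
      (1 + ∑ i ∈ Finset.range (n + 1), a i * (σInt K)^[i] x) = 0 := by
    rw [← hx, map_add, map_one, map_sum, ← Fin.sum_univ_eq_sum_range
      (fun i => IsLocalRing.residue (O (K := K)) (a i * (σInt K)^[i] x))]
    simp only [map_mul, hσBar]
  rw [IsLocalRing.residue_eq_zero_iff, (O (K := K)).valuation_lt_one_iff] at h1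
  -- The coefficients outside `S` are zero.
  have h2 : ∑ i ∈ Finset.range (n + 1), a i * (σInt K)^[i] x = ∑ i ∈ S, a i * (σInt K)^[i] x :=
    (Finset.sum_subset (fun i hi => Finset.mem_range.2 (hn i hi)) fun i _ hi => by
      simp [a, hi]).symm
  rw [h2] at h1
  have h3 : ((1 + ∑ i ∈ S, a i * (σInt K)^[i] x : O (K := K)) : K) =
      1 + ∑ i ∈ S, α i * ((σ (K := K)) ^ i) x.1 := by
    push_cast
    congr 1
    exact Finset.sum_congr rfl fun i hi => by rw [haS i hi, hσ]
  rwa [h3] at h1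

end Valued

/-- Spherically complete immediate extensions of `K` are isomorphic over `K`. -/
theorem isIsomorphicOver_of_sphericallyComplete {K : Type u} [Field K] [ValuedDifferenceField K]
    [CharZero (Residue K)] (hK : ResidueLinearDifferenceClosed K) {L₁ : Type v} {L₂ : Type w}
    [Field L₁] [ValuedDifferenceField L₁] [Algebra K L₁] [Extension K L₁]
    [Field L₂] [ValuedDifferenceField L₂] [Algebra K L₂] [Extension K L₂]
    (himm₁ : IsImmediateOver K (val L₁)) (hsc₁ : SphericallyComplete (val L₁))
    (himm₂ : IsImmediateOver K (val L₂)) (hsc₂ : SphericallyComplete (val L₂)) :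
    IsIsomorphicOver K L₁ L₂ := by
  -- The valuations of `L₁` and `L₂` are replaced by equivalent ones with values in the value group of
  -- `K`, on which the difference operators all act through the same map `s`.
  choose r hr using (O (K := K)).valuation_surjective
  let s := fun γ => val K (σ (r γ))
  have hsv : ∀ x, val K (σ x) = s (val K x) := fun x =>
    le_antisymm ((val_σ_le_iff _ _).2 (hr _).ge) ((val_σ_le_iff _ _).2 (hr _).le)
  have hs : StrictMono s := by
    intro γ δ h
    rw [← not_le]
    change ¬ val K (σ (r δ)) ≤ val K (σ (r γ))
    rw [val_σ_le_iff, hr, hr]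
    exact h.not_ge
  have hlin := isLinearlyClosed_of_residue hK
  have hint : ∀ (n : ℕ) (a : K), val K a ≤ 1 → val K (((σ (K := K)) ^ n) a) ≤ 1 := by
    intro n a ha
    induction n with
    | zero => exact ha
    | succ n ih =>
      rw [pow_succ_apply]
      exact ((O (K := K)).valuation_le_one_iff _).2
        ((σ_mem_iff _).2 (((O (K := K)).valuation_le_one_iff _).1 ih))
  obtain ⟨w₁, hw₁, hle₁⟩ := exists_valuation_of_isImmediateOver (v := val K) (w := val L₁)
    (fun a b => (val_algebraMap_le_iff a b).symm) himm₁
  obtain ⟨w₂, hw₂, hle₂⟩ := exists_valuation_of_isImmediateOver (v := val K) (w := val L₂)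
    (fun a b => (val_algebraMap_le_iff a b).symm) himm₂
  have himm₁' : IsImmediateOver K w₁ := himm₁.of_equiv hle₁
  have himm₂' : IsImmediateOver K w₂ := himm₂.of_equiv hle₂
  have hσ₁ : ∀ x, w₁ (σ x) = s (w₁ x) := by
    intro x
    obtain ⟨a, ha⟩ := himm₁'.exists_value_eq x
    rw [← ha, hw₁, ← hsv, ← hw₁, Extension.map_σ]
    exact le_antisymm ((hle₁ _ _).2 ((val_σ_le_iff _ _).2 ((hle₁ _ _).1 ha.ge)))
      ((hle₁ _ _).2 ((val_σ_le_iff _ _).2 ((hle₁ _ _).1 ha.le)))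
  have hσ₂ : ∀ x, w₂ (σ x) = s (w₂ x) := by
    intro x
    obtain ⟨a, ha⟩ := himm₂'.exists_value_eq x
    rw [← ha, hw₂, ← hsv, ← hw₂, Extension.map_σ]
    exact le_antisymm ((hle₂ _ _).2 ((val_σ_le_iff _ _).2 ((hle₂ _ _).1 ha.ge)))
      ((hle₂ _ _).2 ((val_σ_le_iff _ _).2 ((hle₂ _ _).1 ha.le)))
  obtain ⟨f, hf, hfσ⟩ := exists_difference_algEquiv (E := K) (v₁ := w₁) (v₂ := w₂) (s := s)
    (σE := σ) (σ₁ := σ) (σ₂ := σ)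
    (fun n hn => by rw [← map_natCast (algebraMap K L₁), hw₁, val_natCast n hn])
    (fun n hn => by rw [← map_natCast (algebraMap K L₂), hw₂, val_natCast n hn])
    (fun a => by rw [hw₁, hw₂]) himm₁' himm₂'
    (hsc₁.of_surjective (RingHom.id L₁) Function.surjective_id fun x y => (hle₁ x y).symm)
    (hsc₂.of_surjective (RingHom.id L₂) Function.surjective_id fun x y => (hle₂ x y).symm) hs hσ₁ hσ₂
    (fun a => (Extension.map_σ a).symm) (fun a => (Extension.map_σ a).symm)
    (hlin.of_isImmediateOver himm₁' hw₁
      (fun j a => pow_apply_algebraMap (fun a => (Extension.map_σ a).symm) j a) hint)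
    (hlin.of_isImmediateOver himm₂' hw₂
      (fun j a => pow_apply_algebraMap (fun a => (Extension.map_σ a).symm) j a) hint)
  refine ⟨f, fun x => ?_, hfσ⟩
  rw [← (O (K := L₁)).valuation_le_one_iff, ← (O (K := L₂)).valuation_le_one_iff,
    ← map_one (val L₁), ← map_one (val L₂), ← hle₁, ← hle₂, hf, map_one, map_one]

/-! ### Difference algebraic elements -/

section DifferenceAlgebraic

variable {E L : Type*} [Field E] [Field L] [Algebra E L] {σ : L ≃+* L} {σE : E ≃+* E}

/-- An element is difference algebraic over `E` if all its transforms, including those under negative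
powers of `σ`, are algebraic over one finitely generated extension of `E`. In this form it is plain
that the difference algebraic elements form a difference field. -/
def IsDifferenceAlgebraic (E : Type*) {L : Type*} [Field E] [Field L] [Algebra E L] (σ : L ≃+* L)
    (x : L) : Prop :=
  ∃ D : IntermediateField E L, D.FG ∧ ∀ m : ℤ, IsAlgebraic D ((σ ^ m) x)

theorem isAlgebraic_of_le {D D' : IntermediateField E L} (h : D ≤ D') {x : L}
    (hx : IsAlgebraic D x) : IsAlgebraic D' x :=
  isAlgebraic_map (F := D) (F' := D') (RingEquiv.refl L)
    (fun y hy => isAlgebraic_algebraMap (⟨y, h hy⟩ : D')) hx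

/-- An element is difference algebraic if and only if it is a zero of a nonzero difference
polynomial. -/
theorem isDifferenceAlgebraic_iff (hσE : ∀ a, σ (algebraMap E L a) = algebraMap E L (σE a)) (x : L) :
    IsDifferenceAlgebraic E σ x ↔ ¬ AlgebraicIndependent E fun n : ℕ => (σ ^ n) x := by
  constructor
  · rintro ⟨D, hD, hx⟩ h
    have : FinTrdeg E D := by
      have := IntermediateField.essFiniteType_iff.2 hD
      infer_instance
    have : FinTrdeg E (algebraicClosure D L) := FinTrdeg.trans E D _
    have h1 : AlgebraicIndependent E fun n : ℕ =>
        (⟨(σ ^ n) x, mem_algebraicClosure_iff.2 (by simpa using hx n)⟩ : algebraicClosure D L) :=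
      AlgebraicIndependent.of_comp ((algebraicClosure D L).val.restrictScalars E) h
    exact not_finite_iff_infinite.2 inferInstance (finite_of_algebraicIndependent h1)
  · intro h
    have hex : ∃ n, ¬ AlgebraicIndependent E fun i : Fin n => (σ ^ (i : ℕ)) x := by
      by_contra! hn
      refine h (algebraicIndependent_iff.2 fun F hF => ?_)
      obtain ⟨F', hF'⟩ := exists_rename_eq_of_vars_subset_range F
        (fun i : Fin (F.vars.sup id + 1) => (i : ℕ)) Fin.val_injective
        (fun j hj => ⟨⟨j, Nat.lt_succ_of_le (Finset.le_sup (f := id) hj)⟩, rfl⟩)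
      rw [← hF', aeval_rename] at hF
      rw [← hF', algebraicIndependent_iff.1 (hn _) F' hF, map_zero]
    obtain ⟨n, hdep, hind⟩ : ∃ n, ¬ (AlgebraicIndependent E fun i : Fin (n + 1) => (σ ^ (i : ℕ)) x) ∧
        AlgebraicIndependent E fun i : Fin n => (σ ^ (i : ℕ)) x := by
      classical
      have h0 : Nat.find hex ≠ 0 := by
        intro h0
        have := Nat.find_spec hex
        rw [h0, algebraicIndependent_empty_type_iff] at this
        exact this (algebraMap E L).injective
      obtain ⟨n, hn⟩ := Nat.exists_eq_succ_of_ne_zero h0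
      have hspec := Nat.find_spec hex
      rw [hn] at hspec
      refine ⟨n, hspec, not_not.1 (Nat.find_min hex (m := n) (by omega))⟩
    have hmem := map_mem_algebraicClosure hσE hind hdep
    refine ⟨_, IntermediateField.fg_adjoin_of_finite (Set.finite_range
      fun i : Fin n => (σ ^ (i : ℕ)) x), fun m => ?_⟩
    induction m using Int.induction_on with
    | zero => exact isAlgebraic_of_minimal_dependence hind hdep
    | succ i ih =>
      rw [add_comm, zpow_one_add]
      exact (hmem _).2 ih
    | pred i ih =>
      rw [← hmem]
      rwa [show (-(i : ℤ)) = 1 + (-(i : ℤ) - 1) by ring, zpow_one_add] at ih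

/-- The difference algebraic elements form a subfield. -/
def differenceAlgebraicClosure (E : Type*) {L : Type*} [Field E] [Field L] [Algebra E L]
    (σ : L ≃+* L) : Subfield L where
  carrier := {x | IsDifferenceAlgebraic E σ x}
  mul_mem' := by
    rintro x y ⟨D, hD, hx⟩ ⟨D', hD', hy⟩
    refine ⟨D ⊔ D', IntermediateField.fg_sup hD hD', fun m => ?_⟩
    rw [map_mul]
    exact (isAlgebraic_of_le le_sup_left (hx m)).mul (isAlgebraic_of_le le_sup_right (hy m))
  one_mem' := ⟨⊥, IntermediateField.fg_bot, fun m => by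
    rw [map_one]
    exact isAlgebraic_one⟩
  add_mem' := by
    rintro x y ⟨D, hD, hx⟩ ⟨D', hD', hy⟩
    refine ⟨D ⊔ D', IntermediateField.fg_sup hD hD', fun m => ?_⟩
    rw [map_add]
    exact (isAlgebraic_of_le le_sup_left (hx m)).add (isAlgebraic_of_le le_sup_right (hy m))
  zero_mem' := ⟨⊥, IntermediateField.fg_bot, fun m => by
    rw [map_zero]
    exact isAlgebraic_zero⟩
  neg_mem' := by
    rintro x ⟨D, hD, hx⟩
    refine ⟨D, hD, fun m => ?_⟩
    rw [map_neg]
    exact (hx m).neg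
  inv_mem' := by
    rintro x ⟨D, hD, hx⟩
    refine ⟨D, hD, fun m => ?_⟩
    rw [map_inv₀]
    exact (hx m).inv

theorem map_mem_differenceAlgebraicClosure_iff (x : L) :
    σ x ∈ differenceAlgebraicClosure E σ ↔ x ∈ differenceAlgebraicClosure E σ := by
  constructor
  · rintro ⟨D, hD, hx⟩
    refine ⟨D, hD, fun m => ?_⟩
    have := hx (m - 1)
    rwa [show (σ ^ (m - 1)) (σ x) = (σ ^ (m - 1) * σ) x from rfl, ← zpow_add_one,
      sub_add_cancel] at this
  · rintro ⟨D, hD, hx⟩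
    refine ⟨D, hD, fun m => ?_⟩
    rw [show (σ ^ m) (σ x) = (σ ^ m * σ) x from rfl, ← zpow_add_one]
    exact hx _

end DifferenceAlgebraic

open ValuedDifferenceField

theorem pow_apply_eq_iterate {M : Type*} [Field M] (τ : M ≃+* M) (n : ℕ) (x : M) : (τ ^ n) x = τ^[n] x := by
  induction n with
  | zero => rfl
  | succ n ih => rw [pow_succ_apply, Function.iterate_succ_apply', ih]

/-- An element is a zero of a nonzero difference polynomial if and only if its transforms are
algebraically dependent. -/
theorem exists_sigmaEval_eq_zero_iff {K M : Type*} [Field K] [Field M]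
    [ValuedDifferenceField M] [Algebra K M] (x : M) :
    (∃ F : MvPolynomial ℕ K, F ≠ 0 ∧ sigmaEval K M F x = 0) ↔
      ¬ AlgebraicIndependent K fun n : ℕ => ((σ (K := M)) ^ n) x := by
  rw [algebraicIndependent_iff]
  push Not
  simp only [sigmaEval, pow_apply_eq_iterate, and_comm]

section SigmaAlgebraic

variable {K : Type*} {L M : Type u} [Field K] [ValuedDifferenceField K]
  [Field L] [ValuedDifferenceField L] [Field M] [ValuedDifferenceField M]

/-- A difference subfield of a valued difference field, with the induced structure. -/
abbrev subfieldStructure (N : Subfield M) (hN : ∀ x, σ (K := M) x ∈ N ↔ x ∈ N) :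
    ValuedDifferenceField N where
  O := (O (K := M)).comap N.subtype
  σ :=
    { (σ (K := M) : M →+* M).restrict N N (fun x hx => (hN x).2 hx) with
      invFun := fun x => ⟨(σ (K := M)).symm x, (hN _).1 (by
        rw [RingEquiv.apply_symm_apply]
        exact x.2)⟩
      left_inv := fun x => Subtype.ext ((σ (K := M)).symm_apply_apply x)
      right_inv := fun x => Subtype.ext ((σ (K := M)).apply_symm_apply x) }
  image_O := by
    ext x
    constructor
    · rintro ⟨y, hy, rfl⟩
      exact (σ_mem_iff (y : M)).2 hy
    · intro hx
      refine ⟨⟨(σ (K := M)).symm x, (hN _).1 ?_⟩, ?_, Subtype.ext ?_⟩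
      · rw [RingEquiv.apply_symm_apply]
        exact x.2
      · refine (σ_mem_iff (K := M) _).1 ?_
        change σ ((σ (K := M)).symm x) ∈ _
        rw [RingEquiv.apply_symm_apply]
        exact hx
      · exact (σ (K := M)).apply_symm_apply x

/-- In an immediate extension of a `σ`-algebraically maximal `σ`-algebraic extension `L` of `K`,
the field `L` consists of the elements that are difference algebraic over `K`, that is, of those
whose transforms are algebraically dependent. -/
theorem mem_range_iff_isDifferenceAlgebraic [Algebra K L] [Extension K L] [Algebra L M]
    [Extension L M] [Algebra K M] [IsScalarTower K L M] (halg : IsSigmaAlgebraic K L)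
    (hmax : IsSigmaAlgebraicallyMaximal L) (himm : IsImmediateOver L (val M)) (x : M) :
    (∃ y : L, algebraMap L M y = x) ↔
      ¬ AlgebraicIndependent K fun n : ℕ => ((σ (K := M)) ^ n) x := by
  have : Extension K M := extension_trans (L := L)
  have hK := fun x => isDifferenceAlgebraic_iff (E := K) (σ := σ (K := M)) (σE := σ)
    (fun a => (Extension.map_σ a).symm) x
  have hL : ∀ y : L, ¬ AlgebraicIndependent K fun n : ℕ => ((σ (K := M)) ^ n) (algebraMap L M y) := by
    intro y
    have h1 := (exists_sigmaEval_eq_zero_iff (K := K) y).1 (halg y)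
    rw [← AlgHom.algebraicIndependent_iff (IsScalarTower.toAlgHom K L M)
      (algebraMap L M).injective] at h1
    have h2 : (fun n : ℕ => ((σ (K := M)) ^ n) (algebraMap L M y)) =
        IsScalarTower.toAlgHom K L M ∘ fun n : ℕ => ((σ (K := L)) ^ n) y :=
      funext fun n => pow_apply_algebraMap (fun a => (Extension.map_σ a).symm) n y
    rwa [h2]
  constructor
  · rintro ⟨y, rfl⟩
    exact hL y
  intro hx
  -- The difference algebraic elements form an immediate `σ`-algebraic extension of `L`.
  let N := differenceAlgebraicClosure K (σ (K := M))
  have hLN : ∀ y, algebraMap L M y ∈ N := fun y => (hK _).2 (hL y)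
  let _ : ValuedDifferenceField N := subfieldStructure N map_mem_differenceAlgebraicClosure_iff
  let _ : Algebra L N := ((algebraMap L M).codRestrict N hLN).toAlgebra
  have : Extension L N := ⟨fun a => Extension.mem_O_iff (L := M) a, fun a =>
    Subtype.ext (Extension.map_σ (L := M) a)⟩
  have himmN : IsImmediateOver L (val N) := by
    intro b hb
    obtain ⟨a, ha⟩ := himm b (by simpa using hb)
    exact ⟨a, (valuation_lt_iff_of_mem_iff (V := O (K := M)) N.subtype (fun _ => Iff.rfl) _ _).2 ha⟩
  let f : N →ₐ[L] M := { N.subtype with commutes' := fun _ => rfl }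
  have halgN : IsSigmaAlgebraic L N := by
    intro b
    rw [exists_sigmaEval_eq_zero_iff, ← AlgHom.algebraicIndependent_iff f Subtype.val_injective]
    intro h
    have h2 : (fun n : ℕ => ((σ (K := M)) ^ n) b.1) = f ∘ fun n : ℕ => ((σ (K := N)) ^ n) b := by
      funext n
      induction n with
      | zero => rfl
      | succ n ih =>
        change _ = (((σ (K := N)) ^ (n + 1)) b).1
        rw [pow_succ_apply, pow_succ_apply, ih]
        rfl
    refine (hK b).1 b.2 ?_
    rw [h2]
    exact h.restrictScalars (algebraMap K L).injective
  obtain ⟨y, hy⟩ := hmax N (isImmediate_iff.2 himmN) halgN ⟨x, (hK x).2 hx⟩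
  exact ⟨y, congrArg Subtype.val hy⟩

end SigmaAlgebraic

/-- An isomorphism over `K` restricts to subextensions that correspond to each other. -/
theorem isIsomorphicOver_of_algEquiv {K : Type*} {L₁ L₂ M₁ M₂ : Type*} [Field K]
    [ValuedDifferenceField K] [Field L₁] [ValuedDifferenceField L₁] [Algebra K L₁] [Extension K L₁]
    [Field L₂] [ValuedDifferenceField L₂] [Algebra K L₂] [Extension K L₂]
    [Field M₁] [ValuedDifferenceField M₁] [Algebra K M₁] [Algebra L₁ M₁] [Extension L₁ M₁]
    [IsScalarTower K L₁ M₁]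
    [Field M₂] [ValuedDifferenceField M₂] [Algebra K M₂] [Algebra L₂ M₂] [Extension L₂ M₂]
    [IsScalarTower K L₂ M₂] {e : M₁ ≃ₐ[K] M₂} (heO : ∀ x, e x ∈ O (K := M₂) ↔ x ∈ O (K := M₁))
    (heσ : ∀ x, e (σ x) = σ (e x))
    (hL : ∀ x, (∃ y, algebraMap L₂ M₂ y = e x) ↔ ∃ y, algebraMap L₁ M₁ y = x) :
    IsIsomorphicOver K L₁ L₂ := by
  let φ₁ := IsScalarTower.toAlgHom K L₁ M₁
  let φ₂ := IsScalarTower.toAlgHom K L₂ M₂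
  have hφ₂ : Function.Injective φ₂ := (algebraMap L₂ M₂).injective
  let f : L₁ →ₐ[K] L₂ := (AlgEquiv.ofInjective φ₂ hφ₂).symm.toAlgHom.comp
    ((e.toAlgHom.comp φ₁).codRestrict φ₂.range fun x => (hL _).2 ⟨x, rfl⟩)
  have hf : ∀ x, algebraMap L₂ M₂ (f x) = e (algebraMap L₁ M₁ x) := fun x =>
    congrArg Subtype.val ((AlgEquiv.ofInjective φ₂ hφ₂).apply_symm_apply _)
  have hfsurj : Function.Surjective f := by
    intro y
    obtain ⟨x, hx⟩ := (hL (e.symm (algebraMap L₂ M₂ y))).1 ⟨y, by rw [AlgEquiv.apply_symm_apply]⟩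
    refine ⟨x, hφ₂ ?_⟩
    change algebraMap L₂ M₂ _ = algebraMap L₂ M₂ y
    rw [hf, hx, AlgEquiv.apply_symm_apply]
  refine ⟨AlgEquiv.ofBijective f ⟨f.injective, hfsurj⟩, fun x => ?_, fun x => hφ₂ ?_⟩
  · change f x ∈ _ ↔ _
    rw [← Extension.mem_O_iff (L := M₂), hf, heO, Extension.mem_O_iff]
  · change algebraMap L₂ M₂ (f (σ x)) = algebraMap L₂ M₂ (σ (f x))
    rw [hf, Extension.map_σ, heσ, Extension.map_σ, hf]

/-! ### Uniqueness of maximal immediate extensions -/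

section Main

variable {K : Type u} [Field K] [ValuedDifferenceField K] [CharZero (Residue K)]
  {L₁ : Type v} {L₂ : Type w}
  [Field L₁] [ValuedDifferenceField L₁] [Algebra K L₁] [Extension K L₁]
  [Field L₂] [ValuedDifferenceField L₂] [Algebra K L₂] [Extension K L₂]

theorem isIsomorphicOver_of_isMaximal (hK : ResidueLinearDifferenceClosed K)
    (himm₁ : IsImmediate K L₁) (hmax₁ : IsMaximal L₁)
    (himm₂ : IsImmediate K L₂) (hmax₂ : IsMaximal L₂) : IsIsomorphicOver K L₁ L₂ :=
  have hv := val_natCast (K := K)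
  isIsomorphicOver_of_sphericallyComplete hK (isImmediate_iff.1 himm₁)
    (sphericallyComplete_of_isMaximal (val_natCast_of_extension hv) hmax₁) (isImmediate_iff.1 himm₂)
    (sphericallyComplete_of_isMaximal (val_natCast_of_extension hv) hmax₂)

/-- `L₁` and `L₂` are embedded in spherically complete immediate extensions `M₁` and `M₂`. An
isomorphism of these over `K` preserves the difference algebraic elements. -/
theorem isIsomorphicOver_of_isSigmaAlgebraicallyMaximal (hK : ResidueLinearDifferenceClosed K)
    (himm₁ : IsImmediate K L₁) (halg₁ : IsSigmaAlgebraic K L₁)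
    (hmax₁ : IsSigmaAlgebraicallyMaximal L₁)
    (himm₂ : IsImmediate K L₂) (halg₂ : IsSigmaAlgebraic K L₂)
    (hmax₂ : IsSigmaAlgebraicallyMaximal L₂) : IsIsomorphicOver K L₁ L₂ := by
  have hv := val_natCast (K := K)
  obtain ⟨M₁, _, _, _, _, hM₁, hsc₁⟩ := exists_sphericallyComplete_difference_extension L₁
    (val_natCast_of_extension hv)
  obtain ⟨M₂, _, _, _, _, hM₂, hsc₂⟩ := exists_sphericallyComplete_difference_extension L₂
    (val_natCast_of_extension hv)
  let _ : Algebra K M₁ := ((algebraMap L₁ M₁).comp (algebraMap K L₁)).toAlgebra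
  let _ : Algebra K M₂ := ((algebraMap L₂ M₂).comp (algebraMap K L₂)).toAlgebra
  have : IsScalarTower K L₁ M₁ := IsScalarTower.of_algebraMap_eq fun _ => rfl
  have : IsScalarTower K L₂ M₂ := IsScalarTower.of_algebraMap_eq fun _ => rfl
  have : Extension K M₁ := extension_trans (L := L₁)
  have : Extension K M₂ := extension_trans (L := L₂)
  obtain ⟨e, heO, heσ⟩ := isIsomorphicOver_of_sphericallyComplete hK
    ((isImmediate_iff.1 himm₁).trans hM₁ fun x y => (val_algebraMap_le_iff x y).symm) hsc₁
    ((isImmediate_iff.1 himm₂).trans hM₂ fun x y => (val_algebraMap_le_iff x y).symm) hsc₂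
  refine isIsomorphicOver_of_algEquiv heO heσ fun x => ?_
  rw [mem_range_iff_isDifferenceAlgebraic halg₂ hmax₂ hM₂,
    mem_range_iff_isDifferenceAlgebraic halg₁ hmax₁ hM₁,
    ← AlgHom.algebraicIndependent_iff e.toAlgHom e.injective]
  have h : (fun n : ℕ => ((σ (K := M₂)) ^ n) (e x)) =
      e ∘ fun n : ℕ => ((σ (K := M₁)) ^ n) x := by
    ext n
    induction n with
    | zero => rfl
    | succ n ih => simp only [Function.comp_apply, pow_succ_apply, heσ, ih]
  rw [h]
  rfl

end Main

end Kaplansky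

theorem mainTheorem7 (K : Type u) [Field K] [ValuedDifferenceField K]
    [CharZero (ValuedDifferenceField.Residue K)]
    (hK : ValuedDifferenceField.ResidueLinearDifferenceClosed K) :
    (∀ (L₁ : Type v) (L₂ : Type w)
      [Field L₁] [ValuedDifferenceField L₁] [Algebra K L₁] [ValuedDifferenceField.Extension K L₁]
      [Field L₂] [ValuedDifferenceField L₂] [Algebra K L₂] [ValuedDifferenceField.Extension K L₂],
      ValuedDifferenceField.IsImmediate K L₁ → ValuedDifferenceField.IsMaximal L₁ →
      ValuedDifferenceField.IsImmediate K L₂ → ValuedDifferenceField.IsMaximal L₂ →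
      ValuedDifferenceField.IsIsomorphicOver K L₁ L₂) ∧
    (∀ (L₁ : Type v) (L₂ : Type w)
      [Field L₁] [ValuedDifferenceField L₁] [Algebra K L₁] [ValuedDifferenceField.Extension K L₁]
      [Field L₂] [ValuedDifferenceField L₂] [Algebra K L₂] [ValuedDifferenceField.Extension K L₂],
      ValuedDifferenceField.IsImmediate K L₁ → ValuedDifferenceField.IsSigmaAlgebraic K L₁ →
      ValuedDifferenceField.IsSigmaAlgebraicallyMaximal L₁ →
      ValuedDifferenceField.IsImmediate K L₂ → ValuedDifferenceField.IsSigmaAlgebraic K L₂ →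
      ValuedDifferenceField.IsSigmaAlgebraicallyMaximal L₂ →
      ValuedDifferenceField.IsIsomorphicOver K L₁ L₂) :=
  ⟨fun _ _ _ _ _ _ _ _ _ _ => Kaplansky.isIsomorphicOver_of_isMaximal hK,
    fun _ _ _ _ _ _ _ _ _ _ => Kaplansky.isIsomorphicOver_of_isSigmaAlgebraicallyMaximal hK⟩
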